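/- Let $n\ge 1$ and let $B$ be an $n$-manifold with an atlas of local coordinates $r=(r_1,\dots,r_n)$ whose transitions lie locally in $SL(n,\mathbb Z)\ltimes\mathbb R^n$. Let $(X,\omega)\to B$ be a Lagrangian torus bundle with action-angle coordinates $(r,\theta)$, $\theta\in\mathbb R^n/\mathbb Z^n$, $\omega=\sum_i d\theta_i\wedge dr_i$, where $r'=Ar+c$ corresponds to $\theta'=A^{-T}\theta+d$ with $c,d$ locally constant (e.g. $X=T^*B/\Lambda^*$). Let $\check X=TB/\Lambda\to B$ be the dual torus bundle, $\Lambda$ being generated by the $\partial/\partial r_i$, with fibre coordinates $\check\theta_i$, complex coordinates $z_i=\check\theta_i+\mathbf i r_i$ and holomorphic volume form $\check\Omega=dz_1\wedge\dots\wedge dz_n$. *Fourier–Mukai transform.* Let $\mathcal P$ be the operator $dz_I\wedge d\bar z_J\mapsto d\check\theta_I\wedge dr_J$ (linear over functions of $r$). For torus-invariant forms (coefficients depending on $r$ only) put $$\mathrm{FT}\,\check\phi=\pi_*\Big(\mathcal P\check\phi\wedge e^{\sum_i d\check\theta_i\wedge d\theta_i}\Big),\qquad \mathrm{FT}\,\phi=\mathcal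 P^{-1}\check\pi_*\Big(\phi\wedge e^{-\sum_i d\check\theta_i\wedge d\theta_i}\Big)$$ on $X\times_B\check X$, where $\pi_*$ (resp. $\check\pi_*$) integrates along the $\check\theta$-torus (resp. the $\theta$-torus), with $d\check\theta_1\cdots d\check\theta_n\wedge\alpha\mapsto\alpha$ (resp. $d\theta_1\cdots d\theta_n\wedge\alpha\mapsto\alpha$). *$SU(n)$ structures.* An $SU(n)$ structure on a $2n$-manifold is a pair $(\omega,\Omega)$ of smooth forms such that $\Omega$ is a nowhere vanishing decomposable complex $n$-form with $TM\otimes\mathbb C=T^{1,0}\oplus T^{0,1}$ for $T^{0,1}=\{v:\iota_v\Omega=0\}$, $T^{1,0}=\overline{T^{0,1}}$, and, for the resulting almost complex structure $J$, $\omega$ is a non-degenerate real $(1,1)$-form with $\omega(\cdot,J\cdot)$ a (positive definite) Hermitian metric. Its conformal factor is the nowhere vanishing real function $F$ with $\Omega\wedge\bar\Omega=\mathbf i^nF\,\omega^n/n!$. It is of *Type IIB* if $d\Omega=0$ and $d(\omega^{n-1})=0$ (balanced). Given an integrable Lagrangian distribution $L$ that is special (for some phase $\vartheta$, $\Omega|_{L}\in\mathbb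 R_{>0}e^{\mathbf i\vartheta}$ with $L$ suitably oriented), let $\pi^{p,q}$ be the projection to forms with $p$ directions along $L$ and $q$ along $L^\perp$; the structure is of *Type IIA* (with respect to $L$) if $d\omega=0$, $d(\pi^{n,0}\Omega)=0$ and $d(\pi^{1,n-1}\Omega)=0$. The fluxes are $$\rho_A=-\mathbf i\,d\,d^{\Lambda}\big(F(\pi^{n-1,1}\Omega+\pi^{0,n}\Omega)\big),\qquad \rho_B=2\mathbf i\,\partial\bar\partial(F^{-1}\omega),$$ where $d^\Lambda=d\Lambda-\Lambda d$ and $\Lambda$ is the adjoint of the Lefschetz operator $\omega\wedge\cdot$ (for $\omega=\sum d\theta_i\wedge dr_i$: $\Lambda=\sum_i\iota_{\partial/\partial r_i}\iota_{\partial/\partial\theta_i}$). **Theorem.** There is a constant $c_n\in\mathbb R\setminus\{0\}$ depending only on $n$ such that the following holds. Let $\check\omega$ be a smooth form on $\check X$ which is locally $\frac{\mathbf i}{2}\sum_{i,j}\mu_{ij}(r)\,dz_i\wedge d\bar z_j$ with $(\mu_{ij})$ real and symmetric, and let $\Omega=\mathrm{FT}(e^{2\check\omega})$. 1. $(\check X,\check\omega,\check\Omega)$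 is an $SU(n)$ structure if and only if $(X,\omega,\Omega)$ is. In this case both conformal factors $\check F$, $F$ exist and are unique, and $\check F(y)=2^{2n}F(x)^{-1}$ for all $y\in\check X$, $x\in X$ over the same point of $B$. 2. $(X,\omega,\Omega)$ is of Type IIA with respect to the polarization by the tangent spaces of the torus fibres if and only if $(\check X,\check\omega,\check\Omega)$ is of Type IIB. 3. If these are $SU(n)$ structures (in particular if they are supersymmetric), then $\mathrm{FT}(\rho_A)=c_n\,\check\rho_B$. -/

import Mathlib

open scoped Manifold Topology Matrix

noncomputable section

namespace SemiFlat

/-! ### Exterior algebra of the complexified cotangent space with coordinates `x i`, `i : ι` -/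

section Pointwise

variable {ι κ : Type*} [Fintype ι] [LinearOrder ι] [Fintype κ] [LinearOrder κ]

/-- Complex-valued exterior forms (of mixed degree) at a point with real coordinates indexed by `ι`.
The covector `∑ α i dx i` is `α : ι → ℂ`; the wedge product is the product of the algebra. -/
abbrev Ext (ι : Type*) := ExteriorAlgebra ℂ (ι → ℂ)

/-- The `i`-th standard basis vector of `ℂ^ι`: the covector `dx i`, or the vector `∂/∂x i`. -/
def unitVec (i : ι) : ι → ℂ := Pi.single i 1

/-- The vector `∂/∂x i` as a real tangent vector. -/
def realUnitVec (i : ι) : ι → ℝ := Pi.single i 1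

/-- The coordinate one-form `dx i`. -/
def dx (i : ι) : Ext ι := ExteriorAlgebra.ι ℂ (unitVec i)

/-- The monomials `dx I`, with increasing indices, as a basis of the exterior algebra. -/
def mono : Module.Basis (Finset ι) ℂ (Ext ι) := (Pi.basisFun ℂ ι).ExteriorAlgebra

/-- The coefficient of `dx I`. -/
def coeff (I : Finset ι) (φ : Ext ι) : ℂ := mono.repr φ I

/-- Complex conjugation of forms; the `dx i` are real. -/
def conjForm (φ : Ext ι) : Ext ι := ∑ I, (starRingEnd ℂ (coeff I φ)) • mono I

/-- The homomorphism of exterior algebras that sends `dx i` to the covector `f i`. -/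
def extHom (f : ι → κ → ℂ) : Ext ι →ₐ[ℂ] Ext κ :=
  ExteriorAlgebra.map ((Pi.basisFun ℂ ι).constr ℂ f)

/-- Pull-back of forms under a real linear map of tangent spaces. -/
def pullLin (L : (ι → ℝ) →L[ℝ] (κ → ℝ)) : Ext κ →ₐ[ℂ] Ext ι :=
  extHom fun k i => ((L (realUnitVec i) k : ℝ) : ℂ)

/-- A real tangent vector as a complex tangent vector. -/
def realVec (v : ι → ℝ) : ι → ℂ := fun i => (v i : ℂ)

/-- Interior product with a complex tangent vector, bilinear in the vector and the form. -/
def contractBilin : (ι → ℂ) →ₗ[ℂ] Ext ι →ₗ[ℂ] Ext ι :=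
  CliffordAlgebra.contractLeft.comp
    (∑ i, (LinearMap.proj i : (ι → ℂ) →ₗ[ℂ] ℂ).smulRight
      (LinearMap.proj i : Module.Dual ℂ (ι → ℂ)))

/-- Interior product `ι_v φ`. -/
def contract (v : ι → ℂ) (φ : Ext ι) : Ext ι := contractBilin v φ

/-- The value `φ (v 0, …, v (k - 1))` of a `k`-form. -/
def evalForm {k : ℕ} (φ : Ext ι) (v : Fin k → ι → ℂ) : ℂ :=
  ExteriorAlgebra.algebraMapInv ((List.ofFn v).foldl (fun ψ u => contract u ψ) φ)

/-- Forms with `p` factors in `A` and `q` factors in `B`, for two spaces of covectors. -/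
def bideg (A B : Submodule ℂ (ι → ℂ)) (p q : ℕ) : Submodule ℂ (Ext ι) :=
  (A.map (ExteriorAlgebra.ι ℂ)) ^ p * (B.map (ExteriorAlgebra.ι ℂ)) ^ q

/-- The component of bidegree `(p, q)` of a form; it is unique when the covectors split as
`A ⊕ B`. -/
def bidegProj (A B : Submodule ℂ (ι → ℂ)) (p q : ℕ) (φ : Ext ι) : Ext ι :=
  Classical.epsilon fun ψ => ψ ∈ bideg A B p q ∧
    φ - ψ ∈ ⨆ (a : ℕ × ℕ) (_ : a ≠ (p, q)), bideg A B a.1 a.2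

/-- `T^(0,1) = {v | ι_v Ω = 0}`. -/
def T01 (Ω : Ext ι) : Submodule ℂ (ι → ℂ) := LinearMap.ker (contractBilin.flip Ω)

/-- `T^(1,0)`, the complex conjugate of `T^(0,1)`. -/
def T10 (Ω : Ext ι) : Submodule ℂ (ι → ℂ) where
  carrier := {v | star v ∈ T01 Ω}
  add_mem' := by
    intro a b ha hb
    simpa [star_add] using (T01 Ω).add_mem ha hb
  zero_mem' := by simp
  smul_mem' := by
    intro c a ha
    simpa [star_smul] using (T01 Ω).smul_mem (star c) ha

/-- The almost complex structure of `Ω`: `J v` is the real vector with `v + i J v ∈ T^(0,1)`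
(that is, `J = i` on `T^(1,0)` and `J = -i` on `T^(0,1)`). -/
def acs (Ω : Ext ι) (v : ι → ℝ) : ι → ℝ :=
  Classical.epsilon fun w => realVec v + Complex.I • realVec w ∈ T01 Ω

/-- The bilinear form `g (u, v) = ω (u, J v)` on real tangent vectors. -/
def metric (ω Ω : Ext ι) (u v : ι → ℝ) : ℂ := evalForm ω ![realVec u, realVec (acs Ω v)]

/-- `(ω, Ω)` is an `SU(n)` structure at a point. -/
structure IsSUAt (n : ℕ) (ω Ω : Ext ι) : Prop where
  decomposable : ∃ η : Fin n → ι → ℂ, Ω = ExteriorAlgebra.ιMulti ℂ n η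
  ne_zero : Ω ≠ 0
  splitting : IsCompl (T10 Ω) (T01 Ω)
  degree_two : ω ∈ ⋀[ℂ]^2 (ι → ℂ)
  real : conjForm ω = ω
  type_one_one : (∀ u ∈ T10 Ω, ∀ v ∈ T10 Ω, evalForm ω ![u, v] = 0) ∧
    ∀ u ∈ T01 Ω, ∀ v ∈ T01 Ω, evalForm ω ![u, v] = 0
  nondegenerate : ∀ u, contract u ω = 0 → u = 0
  metric_symm : ∀ u v, metric ω Ω u v = metric ω Ω v u
  metric_pos : ∀ u, u ≠ 0 → 0 < (metric ω Ω u u).re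

/-- The complex covectors that vanish on a set of real tangent vectors. -/
def annih (S : Set (ι → ℝ)) : Submodule ℂ (ι → ℂ) where
  carrier := {α | ∀ v ∈ S, α ⬝ᵥ realVec v = 0}
  add_mem' := by
    intro a b ha hb v hv
    rw [add_dotProduct, ha v hv, hb v hv, add_zero]
  zero_mem' := by
    intro v _
    exact zero_dotProduct _
  smul_mem' := by
    intro c a ha v hv
    rw [smul_dotProduct, ha v hv, smul_zero]

/-- The orthogonal complement of `D` for the metric `ω (·, J ·)`. -/
def perp (ω Ω : Ext ι) (D : Submodule ℝ (ι → ℝ)) : Set (ι → ℝ) :=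
  {v | ∀ u ∈ D, metric ω Ω u v = 0}

/-- The projection `π^(p,q)` to forms with `p` directions along `D` and `q` along its orthogonal
complement. The covectors along `D` are those that vanish on the complement. -/
def polProj (ω Ω : Ext ι) (D : Submodule ℝ (ι → ℝ)) (p q : ℕ) (φ : Ext ι) : Ext ι :=
  bidegProj (annih (perp ω Ω D)) (annih D) p q φ

/-- The adjoint `Λ` of the Lefschetz operator of `ω = ½ ∑ W i j dx i ∧ dx j`:
`Λ φ = ½ ∑ (W⁻¹) i j ι_(∂ i) ι_(∂ j) φ`. -/
def lefschetzAdj (ω φ : Ext ι) : Ext ι :=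
  let W : Matrix ι ι ℂ := .of fun i j => evalForm ω ![unitVec i, unitVec j]
  (1 / 2 : ℂ) • ∑ i, ∑ j, W⁻¹ i j • contract (unitVec i) (contract (unitVec j) φ)

/-- The coordinate derivative `∂ φ / ∂ x i`, coefficient by coefficient. -/
def pderiv (i : ι) (φ : (ι → ℝ) → Ext ι) (p : ι → ℝ) : Ext ι :=
  ∑ I, (fderiv ℝ (fun q => coeff I (φ q)) p (realUnitVec i)) • mono I

/-- The exterior derivative `d φ = ∑ dx i ∧ ∂ φ / ∂ x i`. -/
def extd (φ : (ι → ℝ) → Ext ι) (p : ι → ℝ) : Ext ι := ∑ i, dx i * pderiv i φ p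

/-- The symplectic adjoint `d^Λ = d Λ - Λ d`. -/
def extdLambda (ω φ : (ι → ℝ) → Ext ι) (p : ι → ℝ) : Ext ι :=
  extd (fun q => lefschetzAdj (ω q) (φ q)) p - lefschetzAdj (ω p) (extd φ p)

end Pointwise

/-! ### Manifolds covered by local parametrizations, and their differential forms -/

/-- A family of local parametrizations `par i : dom i → M`, `dom i ⊆ ℝ^ι`. They need not be
injective: angle coordinates are allowed to run over all of `ℝ`. -/
structure LocalParam (ι : Type*) (M : Type*) where
  idx : Type*
  dom : idx → Set (ι → ℝ)
  par : idx → (ι → ℝ) → M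

section Manifold

variable {ι M : Type*} [Fintype ι] [LinearOrder ι] (P : LocalParam ι M)

/-- `τ` is the change of coordinates from the `i`-th to the `j`-th coordinates near `p`. -/
def IsTransition (i j : P.idx) (p : ι → ℝ) (τ : (ι → ℝ) → (ι → ℝ)) : Prop :=
  p ∈ P.dom i ∧ DifferentiableAt ℝ τ p ∧
    ∀ᶠ q in 𝓝 p, τ q ∈ P.dom j ∧ P.par j (τ q) = P.par i q

/-- A form (possibly of mixed degree) on `M` through its local expressions. -/
abbrev FormFamily := P.idx → (ι → ℝ) → Ext ι

/-- The local expressions are smooth and match under all changes of coordinates, that is, they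
are those of a smooth differential form on `M`. -/
structure IsForm (φ : FormFamily P) : Prop where
  smooth : ∀ i I, ContDiffOn ℝ (⊤ : ℕ∞) (fun p => coeff I (φ i p)) (P.dom i)
  compat : ∀ i j p τ, IsTransition P i j p τ → φ i p = pullLin (fderiv ℝ τ p) (φ j (τ p))

/-- `(M, ω, Ω)` is an `SU(n)` structure. -/
structure IsSU (n : ℕ) (ω Ω : FormFamily P) : Prop where
  form_left : IsForm P ω
  form_right : IsForm P Ω
  su : ∀ i, ∀ p ∈ P.dom i, IsSUAt n (ω i p) (Ω i p)

/-- `F` is the conformal factor: `Ω ∧ conj Ω = i^n F ω^n / n!` with `F` nowhere zero. -/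
def IsConformalFactor (n : ℕ) (ω Ω : FormFamily P) (F : M → ℝ) : Prop :=
  (∀ x, F x ≠ 0) ∧ ∀ i, ∀ p ∈ P.dom i,
    Ω i p * conjForm (Ω i p) =
      (Complex.I ^ n * (F (P.par i p) : ℂ) / (n.factorial : ℂ)) • ω i p ^ n

/-- Supersymmetric of type IIB: `dΩ = 0` and `d (ω^(n-1)) = 0`. -/
structure IsTypeIIB (n : ℕ) (ω Ω : FormFamily P) : Prop where
  su : IsSU P n ω Ω
  closed : ∀ i, ∀ p ∈ P.dom i, extd (Ω i) p = 0
  balanced : ∀ i, ∀ p ∈ P.dom i, extd (fun q => ω i q ^ (n - 1)) p = 0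

/-- `D` is a real polarization with respect to `ω`: an integrable Lagrangian distribution over the
open dense subset `U` (integrable: locally the kernel of the differential of a map to `ℝ^n`). -/
structure IsRealPolarization (n : ℕ) (ω : FormFamily P) (U : Set M)
    (D : P.idx → (ι → ℝ) → Submodule ℝ (ι → ℝ)) : Prop where
  isOpen : ∀ i, IsOpen {p | p ∈ P.dom i ∧ P.par i p ∈ U}
  dense : ∀ i, P.dom i ⊆ closure {p | p ∈ P.dom i ∧ P.par i p ∈ U}
  compat : ∀ i j p τ, IsTransition P i j p τ → P.par i p ∈ U →
    D i p = (D j (τ p)).comap (fderiv ℝ τ p).toLinearMap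
  integrable : ∀ i, ∀ p ∈ P.dom i, P.par i p ∈ U → ∃ f : (ι → ℝ) → (Fin n → ℝ),
    ContDiffAt ℝ (⊤ : ℕ∞) f p ∧ ∀ᶠ q in 𝓝 p, D i q = LinearMap.ker (fderiv ℝ f q).toLinearMap
  finrank_eq : ∀ i, ∀ p ∈ P.dom i, P.par i p ∈ U → Module.finrank ℝ (D i p) = n
  lagrangian : ∀ i, ∀ p ∈ P.dom i, P.par i p ∈ U → ∀ u ∈ D i p, ∀ v ∈ D i p,
    evalForm (ω i p) ![realVec u, realVec v] = 0

/-- `D` is special with respect to `Ω` of phase `θ`: the restriction of `Ω` to `D` is positive up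
to the factor `e^(iθ)` (`Ω` itself then orients `D`). -/
def IsSpecial (n : ℕ) (Ω : FormFamily P) (U : Set M)
    (D : P.idx → (ι → ℝ) → Submodule ℝ (ι → ℝ)) (θ : ℝ) : Prop :=
  ∀ i, ∀ p ∈ P.dom i, P.par i p ∈ U → ∃ b : Fin n → ι → ℝ, (∀ k, b k ∈ D i p) ∧
    ∃ t : ℝ, 0 < t ∧
      evalForm (Ω i p) (fun k => realVec (b k)) = (t : ℂ) * Complex.exp (Complex.I * (θ : ℂ))

/-- Supersymmetric of type IIA with respect to the special real polarization `(U, D)`. -/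
structure IsTypeIIA (n : ℕ) (ω Ω : FormFamily P) (U : Set M)
    (D : P.idx → (ι → ℝ) → Submodule ℝ (ι → ℝ)) : Prop where
  su : IsSU P n ω Ω
  polarization : IsRealPolarization P n ω U D
  special : ∃ θ : ℝ, IsSpecial P n Ω U D θ
  symplectic : ∀ i, ∀ p ∈ P.dom i, extd (ω i) p = 0
  closed_left : ∀ i, ∀ p ∈ P.dom i, P.par i p ∈ U →
    extd (fun q => polProj (ω i q) (Ω i q) (D i q) n 0 (Ω i q)) p = 0
  closed_right : ∀ i, ∀ p ∈ P.dom i, P.par i p ∈ U →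
    extd (fun q => polProj (ω i q) (Ω i q) (D i q) 1 (n - 1) (Ω i q)) p = 0

/-- The flux `ρ_A = -i d d^Λ (F (π^(n-1,1) Ω + π^(0,n) Ω))`. -/
def fluxA (n : ℕ) (ω Ω : FormFamily P) (D : P.idx → (ι → ℝ) → Submodule ℝ (ι → ℝ)) (F : M → ℝ) :
    FormFamily P := fun i p =>
  -Complex.I • extd (extdLambda (ω i) fun q => (F (P.par i q) : ℂ) •
    (polProj (ω i q) (Ω i q) (D i q) (n - 1) 1 (Ω i q) +
      polProj (ω i q) (Ω i q) (D i q) 0 n (Ω i q))) p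

end Manifold

/-! ### Semi-flat mirror pairs -/

/-- Indices of semi-flat coordinates: `n` base coordinates `r i`, then `n` fibre coordinates. -/
abbrev Idx (n : ℕ) := Fin n ⊕ₗ Fin n

section SemiFlatPair

variable {n : ℕ}

/-- Index of the base coordinate `r i`. -/
def bi (i : Fin n) : Idx n := toLex (Sum.inl i)

/-- Index of the `i`-th fibre coordinate (`θ i` on `X`, `θ̌ i` on the dual bundle). -/
def fi (i : Fin n) : Idx n := toLex (Sum.inr i)

/-- The base coordinates of a point. -/
def base (p : Idx n → ℝ) : Fin n → ℝ := fun i => p (bi i)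

/-- The fibre coordinates of a point. -/
def fib (p : Idx n → ℝ) : Fin n → ℝ := fun i => p (fi i)

/-- The point with base coordinates `r` and fibre coordinates `θ`. -/
def pt (r θ : Fin n → ℝ) : Idx n → ℝ := fun k => Sum.elim r θ (ofLex k)

variable (n) in
/-- A torus bundle `X → B` with action-angle coordinates: every chart `e` of the atlas of `B` (action
coordinates `r`) comes with angle coordinates `θ ∈ ℝ^n / ℤ^n` on the part of `X` over it. Between two
charts, locally `r' = A r + c` with `A ∈ SL(n, ℤ)`, so that `B` is a special integral affine
manifold, and `θ' = A⁻ᵀ θ + d`. The smooth structure and the symplectic form `∑ dθ i ∧ dr i` of `X`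
are those given by these coordinates. -/
structure ActionAngle (B : Type*) [TopologicalSpace B] [ChartedSpace (Fin n → ℝ) B]
    (X : Type*) where
  proj : X → B
  coord : atlas (Fin n → ℝ) B → (Fin n → ℝ) → (Fin n → ℝ) → X
  proj_coord : ∀ e, ∀ r ∈ e.1.target, ∀ θ, proj (coord e r θ) = e.1.symm r
  surj : ∀ e x, proj x ∈ e.1.source → ∃ θ, coord e (e.1 (proj x)) θ = x
  period : ∀ e, ∀ r ∈ e.1.target, ∀ θ θ', coord e r θ = coord e r θ' ↔
    ∃ m : Fin n → ℤ, ∀ i, θ' i = θ i + (m i : ℝ)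
  transition : ∀ e e', ∀ r ∈ e.1.target, e.1.symm r ∈ e'.1.source →
    ∃ (A : Matrix.SpecialLinearGroup (Fin n) ℤ) (c d : Fin n → ℝ), ∀ᶠ s in 𝓝 r,
      e'.1 (e.1.symm s) = (A.1.map (Int.cast : ℤ → ℝ)) *ᵥ s + c ∧
      ∀ θ, coord e s θ =
        coord e' (e'.1 (e.1.symm s)) (((A⁻¹).1ᵀ.map (Int.cast : ℤ → ℝ)) *ᵥ θ + d)

variable {B : Type*} [TopologicalSpace B] [ChartedSpace (Fin n → ℝ) B] {X : Type*}

/-- The local parametrizations `(r, θ) ↦ x` of `X`. -/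
def ActionAngle.param (S : ActionAngle n B X) : LocalParam (Idx n) X where
  idx := atlas (Fin n → ℝ) B
  dom e := {p | base p ∈ e.1.target}
  par e p := S.coord e (base p) (fib p)

/-- The symplectic form `ω = ∑ dθ i ∧ dr i` of `X`. -/
def ActionAngle.symp (S : ActionAngle n B X) : FormFamily S.param := fun _ _ =>
  ∑ i, dx (fi i) * dx (bi i)

/-- The polarization of `X` by the tangent spaces of the torus fibres. -/
def ActionAngle.fibrePol (S : ActionAngle n B X) :
    S.param.idx → (Idx n → ℝ) → Submodule ℝ (Idx n → ℝ) := fun _ _ =>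
  Submodule.span ℝ (Set.range fun i : Fin n => realUnitVec (fi i))

variable (n) in
/-- The lattice `Λ_b ⊆ T_b B` generated by `∂/∂r 1, …, ∂/∂r n`. Here `T_b B` is identified with
`ℝ^n` by the preferred chart at `b`; as coordinate changes are in `SL(n, ℤ) ⋉ ℝ^n`, all charts
give the same lattice. -/
def tangentLattice (b : B) : AddSubgroup (TangentSpace 𝓘(ℝ, Fin n → ℝ) b) :=
  AddSubgroup.closure (Set.range fun i : Fin n => (Pi.single i 1 : Fin n → ℝ))

variable (n B) in
/-- The dual torus bundle `TB / Λ`. The class of `∑ θ̌ i ∂/∂r i` in `T_b B / Λ_b` stands for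
the flat `U(1)` connection with holonomies `e^(2πi θ̌ i)` on the fibre `T*_b B / Λ*_b`. -/
def DualBundle : Type _ := Σ b : B, TangentSpace 𝓘(ℝ, Fin n → ℝ) b ⧸ tangentLattice n b

/-- The projection of the dual torus bundle. -/
def DualBundle.proj (y : DualBundle n B) : B := y.1

variable (n B) in
/-- The local parametrizations `(r, θ̌) ↦ (b, [∑ θ̌ i ∂/∂r i])` of the dual torus bundle, where `r`
are the coordinates of `b` in a chart `e` and `∂/∂r i` are the coordinate vectors of `e`, expressed
in the preferred chart at `b`. -/
def dualParam : LocalParam (Idx n) (DualBundle n B) where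
  idx := atlas (Fin n → ℝ) B
  dom e := {p | base p ∈ e.1.target}
  par e p := ⟨e.1.symm (base p), QuotientAddGroup.mk
    (fderiv ℝ (fun s => chartAt (Fin n → ℝ) (e.1.symm (base p)) (e.1.symm s)) (base p) (fib p))⟩

/-- The covector `dz i = dθ̌ i + i dr i`. -/
def dz (i : Fin n) : Idx n → ℂ := unitVec (fi i) + Complex.I • unitVec (bi i)

/-- The covector `conj (dz i) = dθ̌ i - i dr i`. -/
def dzbar (i : Fin n) : Idx n → ℂ := unitVec (fi i) - Complex.I • unitVec (bi i)

variable (n B) in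
/-- The holomorphic volume form `dz 1 ∧ … ∧ dz n` of the dual bundle. -/
def dualVol : FormFamily (dualParam n B) := fun _ _ => ExteriorAlgebra.ιMulti ℂ n dz

/-- A semi-flat (torus-invariant) real `(1,1)`-form on the dual bundle: a smooth form that is
locally `(i/2) ∑ μ i j (r) dz i ∧ conj (dz j)` with `μ` real and symmetric. -/
def IsSemiFlatRealOneOne (φ : FormFamily (dualParam n B)) : Prop :=
  IsForm (dualParam n B) φ ∧
    ∀ e : atlas (Fin n → ℝ) B, ∃ μ : (Fin n → ℝ) → Matrix (Fin n) (Fin n) ℝ,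
      (∀ r ∈ e.1.target, (μ r).IsSymm) ∧ ∀ p : Idx n → ℝ, base p ∈ e.1.target →
        φ e p = (Complex.I / 2) • ∑ i, ∑ j, ((μ (base p) i j : ℝ) : ℂ) •
          (ExteriorAlgebra.ι ℂ (dz i) * ExteriorAlgebra.ι ℂ (dzbar j))

/-- The Dolbeault operator `∂ φ = ∑ dz i ∧ ∂φ/∂z i`, `∂/∂z i = ½ (∂/∂θ̌ i - i ∂/∂r i)`. -/
def del (φ : (Idx n → ℝ) → Ext (Idx n)) (p : Idx n → ℝ) : Ext (Idx n) :=
  ∑ i, ExteriorAlgebra.ι ℂ (dz i) *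
    ((1 / 2 : ℂ) • (pderiv (fi i) φ p - Complex.I • pderiv (bi i) φ p))

/-- The Dolbeault operator `∂̄ φ = ∑ conj (dz i) ∧ ∂φ/∂z̄ i`,
`∂/∂z̄ i = ½ (∂/∂θ̌ i + i ∂/∂r i)`. -/
def delbar (φ : (Idx n → ℝ) → Ext (Idx n)) (p : Idx n → ℝ) : Ext (Idx n) :=
  ∑ i, ExteriorAlgebra.ι ℂ (dzbar i) *
    ((1 / 2 : ℂ) • (pderiv (fi i) φ p + Complex.I • pderiv (bi i) φ p))

/-- The flux `ρ_B = 2i ∂ ∂̄ (F⁻¹ ω)` on the dual bundle. -/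
def fluxB (ω : FormFamily (dualParam n B)) (F : DualBundle n B → ℝ) :
    FormFamily (dualParam n B) := fun e p =>
  (2 * Complex.I) •
    del (delbar fun q => (((F ((dualParam n B).par e q))⁻¹ : ℝ) : ℂ) • ω e q) p

/-! ### Fourier-Mukai transform -/

/-- The polarization switch `dz_I ∧ conj dz_J ↦ dθ̌_I ∧ dr_J`: the algebra homomorphism with
`dz i ↦ dθ̌ i` and `conj (dz i) ↦ dr i`, that is, `dθ̌ i ↦ (dθ̌ i + dr i) / 2` and
`dr i ↦ (dθ̌ i - dr i) / 2i`. -/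
def polSwitch : Ext (Idx n) →ₐ[ℂ] Ext (Idx n) :=
  extHom fun k => Sum.elim
    (fun i => (1 / (2 * Complex.I)) • (unitVec (fi i) - unitVec (bi i)))
    (fun i => (1 / 2 : ℂ) • (unitVec (fi i) + unitVec (bi i))) (ofLex k)

/-- The inverse of the polarization switch: `dθ̌ i ↦ dz i`, `dr i ↦ conj (dz i)`. -/
def polSwitchInv : Ext (Idx n) →ₐ[ℂ] Ext (Idx n) :=
  extHom fun k => Sum.elim dzbar dz (ofLex k)

/-- Indices of coordinates on the fibre product of `X` and the dual bundle over `B`: those of one of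
the two bundles (the target of a push-forward), then the fibre coordinates of the other one. -/
abbrev Idx3 (n : ℕ) := Idx n ⊕ₗ Fin n

/-- Index in the fibre product of a coordinate of the target bundle. -/
def ti (k : Idx n) : Idx3 n := toLex (Sum.inl k)

/-- Index in the fibre product of a fibre coordinate of the other bundle. -/
def oi (i : Fin n) : Idx3 n := toLex (Sum.inr i)

/-- Pull-back to the fibre product of a form on the other bundle. -/
def pullOther : Ext (Idx n) →ₐ[ℂ] Ext (Idx3 n) :=
  extHom fun k => Sum.elim (fun i => unitVec (ti (bi i))) (fun i => unitVec (oi i)) (ofLex k)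

/-- The part of a form on the fibre product with all fibre covectors of the other bundle, put in
front and removed: `dt 1 ∧ … ∧ dt n ∧ α ↦ α`. -/
def stripFibre (Ψ : Ext (Idx3 n)) : Ext (Idx n) :=
  extHom (fun k => Sum.elim (fun l => unitVec l) (fun _ => 0) (ofLex k))
    ((List.ofFn fun i : Fin n => unitVec (oi i)).foldl
      (fun ψ v => contract v ψ) Ψ)

/-- Push-forward along the torus fibres `ℝ^n / ℤ^n` of the other bundle, at the point `p` of the
target bundle. The form is given as a function of the fibre coordinates `t`. -/
def pushForward (Ψ : (Idx n → ℝ) → (Fin n → ℝ) → Ext (Idx3 n)) (p : Idx n → ℝ) : Ext (Idx n) :=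
  ∑ I, (∫ t in Set.Icc (0 : Fin n → ℝ) 1, coeff I (stripFibre (Ψ p t))) • mono I

/-- The Fourier-Mukai transform of a torus-invariant form on the dual bundle,
`FT φ = π_* (π̌^* (𝒫 φ) ∧ exp (𝐅 / 2i))` with `𝐅 / 2i = ∑ dθ̌ i ∧ dθ i`. -/
def FT (S : ActionAngle n B X) (φ : FormFamily (dualParam n B)) : FormFamily S.param := fun e =>
  pushForward fun p t => pullOther (polSwitch (φ e (pt (base p) t))) *
    IsNilpotent.exp (∑ i, dx (oi i) * dx (ti (fi i)))

/-- The Fourier-Mukai transform of a torus-invariant form on `X`,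
`FT φ = 𝒫⁻¹ (π̌_* (π^* φ ∧ exp (-𝐅 / 2i)))`. -/
def FTdual (S : ActionAngle n B X) (φ : FormFamily S.param) : FormFamily (dualParam n B) :=
  fun e p => polSwitchInv (pushForward (fun p t => pullOther (φ e (pt (base p) t)) *
    IsNilpotent.exp (-∑ i, dx (ti (fi i)) * dx (oi i))) p)

/-- The form `Ω`: the Fourier-Mukai transform of `e^(2 ω̌)`. -/
def mirrorVol (S : ActionAngle n B X) (ω' : FormFamily (dualParam n B)) : FormFamily S.param :=
  FT S fun e p => IsNilpotent.exp ((2 : ℂ) • ω' e p)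

end SemiFlatPair

end SemiFlat

end

set_option linter.unusedSectionVars false

/-! In a chart everything is governed by the symmetric matrix `μ`. Its symmetry turns the given form
into `∑ μ i j dθ̌ i ∧ dr j` (`mixedForm_of_symm`). The transform of its exponential is a Gaussian
integral in odd variables: fibre integration of `exp (∑ dθ̌ i ∧ ξ i)` leaves the product of the `ξ
i`, in reverse order, and here `ξ i` is `η i = dθ i + i ∑ μ i j dr j` (`fourier_exp`). So both sides
are pairs `(mixedForm a, etaVol b σ)`, with `(a, b) = (μ, 1)` on the dual bundle and `(1, μ)` on
`X`. For commuting symmetric `a`, `b` such a pair is an SU(n) structure exactly when `a b` is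
positive definite (`isSUAt_etaVol_iff`), the same condition on both sides. Comparing top-degree
forms gives the conformal factors `C / det μ` and `C det μ` with `C² = 2^(2n)`; the determinant
descends to `B` because coordinate changes are unimodular.

For supersymmetry and fluxes the transform is used as an operator. Up to sign, `fourier` turns `dz k
∧` into contraction with `∂/∂θ k` and `conj (dz k) ∧` into `dr k ∧`; `fourierDual` reverses both, so
the composite is the scalar `revSign n` (`fourierDual_fourier`). Both operators have constant
coefficients and commute with derivatives in `r`. Counting `dθ` and `dr` factors identifies
`π^(n-k,k) Ω` with the transform of `(2ω̌)^k / k!` (`bidegProj_fourier_exp`).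

Hence `π^(n,0) Ω` is constant, and closedness of `π^(1,n-1) Ω` becomes `∑ conj (dz k) ∧ ∂_k ω̌^(n-1)
= 0`, whereas the balanced condition is `∑ dr k ∧ ∂_k ω̌^(n-1) = 0`. Exchanging `dθ̌` and `dr` sends
`ω̌` to `-ω̌` and `conj (dz k)` to a multiple of `dz k`, which makes the two conditions equivalent
(`sum_dzbar_mul_eq_zero_iff`).

On invariant forms `d^Λ = ∑ ι_(∂/∂θ k) ∂_k`, so the transform carries `d d^Λ` to a multiple of `∑ dz
k ∧ conj (dz l) ∧ ∂_k ∂_l = 4 ∂∂̄`. The potential of `ρ_A` corresponds to `F (2ω̌ + (2ω̌)^n / n!)`;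
its top-degree term is killed by any covector, and `2 F ω̌ = 2^(2n+1) F̌⁻¹ ω̌` is a multiple of the
potential of `ρ_B`. -/

namespace SemiFlat

/-! ### Exterior algebra: covectors, contractions and exponentials of two-forms -/

section Exterior

variable {ι κ : Type*} [Fintype ι] [LinearOrder ι] [Fintype κ] [LinearOrder κ]

/-- The one-form with covector `α`. -/
abbrev cov (α : ι → ℂ) : Ext ι := ExteriorAlgebra.ι ℂ α

theorem cov_sum {σ : Type*} (s : Finset σ) (f : σ → ι → ℂ) :
    cov (∑ i ∈ s, f i) = ∑ i ∈ s, cov (f i) := map_sum (ExteriorAlgebra.ι ℂ) _ _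

theorem cov_add (α β : ι → ℂ) : cov (α + β) = cov α + cov β := map_add _ _ _

theorem cov_sub (α β : ι → ℂ) : cov (α - β) = cov α - cov β := map_sub _ _ _

theorem cov_smul (c : ℂ) (α : ι → ℂ) : cov (c • α) = c • cov α := map_smul _ _ _

theorem cov_mul_comm (α β : ι → ℂ) : cov α * cov β = -(cov β * cov α) :=
  eq_neg_of_add_eq_zero_left (ExteriorAlgebra.ι_add_mul_swap α β)

theorem cov_mul_comm_assoc (α β : ι → ℂ) (x : Ext ι) :
    cov α * (cov β * x) = -(cov β * (cov α * x)) := by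
  rw [← mul_assoc, cov_mul_comm, neg_mul, mul_assoc]

theorem cov_mul_self (α : ι → ℂ) : cov α * cov α = 0 := ExteriorAlgebra.ι_sq_zero α

/-- The algebra is generated by one-forms, so a linear identity only has to survive left
multiplication by a covector. Most identities below are proved this way, without reference to degree
or to a basis. -/
theorem left_induction {C : Ext ι → Prop} (x : Ext ι) (hone : C 1)
    (hadd : ∀ x y, C x → C y → C (x + y)) (hsmul : ∀ (c : ℂ) x, C x → C (c • x))
    (hmul : ∀ α x, C x → C (cov α * x)) : C x := by
  refine CliffordAlgebra.left_induction (Q := (0 : QuadraticForm ℂ (ι → ℂ))) (P := C) ?_ hadd ?_ x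
  · intro r
    rw [Algebra.algebraMap_eq_smul_one]
    exact hsmul r 1 hone
  · intro x m hx
    exact hmul m x hx

theorem contract_add (v : ι → ℂ) (x y : Ext ι) :
    contract v (x + y) = contract v x + contract v y := map_add _ _ _

theorem contract_sub (v : ι → ℂ) (x y : Ext ι) :
    contract v (x - y) = contract v x - contract v y := map_sub _ _ _

theorem contract_neg (v : ι → ℂ) (x : Ext ι) : contract v (-x) = -contract v x := map_neg _ _

theorem contract_smul (v : ι → ℂ) (c : ℂ) (x : Ext ι) :
    contract v (c • x) = c • contract v x := map_smul _ _ _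

theorem contract_zero (v : ι → ℂ) : contract v (0 : Ext ι) = 0 := map_zero _

theorem contract_sum {σ : Type*} (s : Finset σ) (v : ι → ℂ) (f : σ → Ext ι) :
    contract v (∑ i ∈ s, f i) = ∑ i ∈ s, contract v (f i) := map_sum (contractBilin v) _ _

theorem contract_cov_mul (v α : ι → ℂ) (x : Ext ι) :
    contract v (cov α * x) = (α ⬝ᵥ v) • x - cov α * contract v x := by
  refine (CliffordAlgebra.contractLeft_ι_mul _ _ _).trans ?_
  congr 1
  simp [dotProduct, mul_comm]

theorem contract_one (v : ι → ℂ) : contract v (1 : Ext ι) = 0 :=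
  CliffordAlgebra.contractLeft_one (Q := (0 : QuadraticForm ℂ (ι → ℂ))) _

theorem contract_cov (v α : ι → ℂ) : contract v (cov α) = (α ⬝ᵥ v) • (1 : Ext ι) := by
  simpa [contract_one] using contract_cov_mul v α 1

theorem contract_comm (u v : ι → ℂ) (x : Ext ι) :
    contract u (contract v x) = -contract v (contract u x) :=
  CliffordAlgebra.contractLeft_comm (Q := (0 : QuadraticForm ℂ (ι → ℂ))) _ _ _

theorem contract_contract (v : ι → ℂ) (x : Ext ι) : contract v (contract v x) = 0 :=
  CliffordAlgebra.contractLeft_contractLeft (Q := (0 : QuadraticForm ℂ (ι → ℂ))) _ _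

theorem extHom_cov (f : ι → κ → ℂ) (α : ι → ℂ) :
    extHom f (cov α) = cov (fun k => ∑ i, α i * f i k) := by
  unfold extHom cov
  rw [ExteriorAlgebra.map_apply_ι]
  congr 1
  ext k
  simp [Module.Basis.constr_apply_fintype]

/-- Naturality of the interior product: pushing covectors forward is dual to pulling the vector
back, and both sides obey the same rule under multiplication by a covector. -/
theorem contract_extHom (f : ι → κ → ℂ) (v : κ → ℂ) (x : Ext ι) :
    contract v (extHom f x) = extHom f (contract (fun i => f i ⬝ᵥ v) x) := by
  induction x using left_induction with
  | hone => simp [contract_one]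
  | hadd x y hx hy => simp [contract_add, hx, hy]
  | hsmul c x hx => simp [contract_smul, hx]
  | hmul α x hx =>
    rw [map_mul, extHom_cov, contract_cov_mul, contract_cov_mul, hx, map_sub, map_mul, extHom_cov,
      map_smul]
    congr 2
    simp only [dotProduct, Finset.sum_mul, Finset.mul_sum]
    rw [Finset.sum_comm]
    simp [mul_assoc]

/-- The involution that is `-1` on one-forms. -/
def gradeInv : Ext ι →ₐ[ℂ] Ext ι := CliffordAlgebra.involute

theorem gradeInv_cov (α : ι → ℂ) : gradeInv (cov α) = -cov α := CliffordAlgebra.involute_ι _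

theorem cov_mul (α : ι → ℂ) (x : Ext ι) : cov α * x = gradeInv x * cov α := by
  induction x using left_induction with
  | hone => simp
  | hadd x y hx hy => simp [mul_add, add_mul, hx, hy]
  | hsmul c x hx => simp [hx]
  | hmul β x hx =>
    rw [cov_mul_comm_assoc, hx, map_mul, gradeInv_cov, neg_mul, neg_mul, mul_assoc]

theorem contract_mul (v : ι → ℂ) (x y : Ext ι) :
    contract v (x * y) = contract v x * y + gradeInv x * contract v y := by
  induction x using left_induction with
  | hone => simp [contract_one]
  | hadd x z hx hz => simp only [contract_add, add_mul, hx, hz, map_add]; abel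
  | hsmul c x hx => simp [contract_smul, hx]
  | hmul β x hx =>
    rw [mul_assoc, contract_cov_mul, contract_cov_mul, hx, map_mul, gradeInv_cov, sub_mul, mul_add,
      smul_mul_assoc, neg_mul, neg_mul, mul_assoc, mul_assoc]
    abel

/-! ### Two-forms -/

theorem cov_mul_cov_mem (α β : ι → ℂ) : cov α * cov β ∈ ⋀[ℂ]^2 (ι → ℂ) := by
  change cov α * cov β ∈ LinearMap.range _ ^ 2
  rw [pow_two]
  exact Submodule.mul_mem_mul ⟨α, rfl⟩ ⟨β, rfl⟩

theorem two_form_induction {C : Ext ι → Prop} {x : Ext ι} (hx : x ∈ ⋀[ℂ]^2 (ι → ℂ))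
    (hmul : ∀ α β, C (cov α * cov β))
    (hadd : ∀ x ∈ ⋀[ℂ]^2 (ι → ℂ), ∀ y ∈ ⋀[ℂ]^2 (ι → ℂ), C x → C y → C (x + y)) : C x := by
  have h : x ∈ ⋀[ℂ]^2 (ι → ℂ) ∧ C x := by
    change x ∈ LinearMap.range _ ^ 2 at hx
    rw [pow_two] at hx
    refine Submodule.mul_induction_on (C := fun x => x ∈ ⋀[ℂ]^2 (ι → ℂ) ∧ C x) hx ?_ ?_
    · rintro _ ⟨α, rfl⟩ _ ⟨β, rfl⟩
      exact ⟨cov_mul_cov_mem α β, hmul α β⟩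
    · intro x y hx hy
      exact ⟨add_mem hx.1 hy.1, hadd _ hx.1 _ hy.1 hx.2 hy.2⟩
  exact h.2

/-- A product of two covectors passes a third with two sign changes, so two-forms are central. Their
exponentials therefore multiply as in a commutative ring. -/
theorem two_form_comm {x : Ext ι} (hx : x ∈ ⋀[ℂ]^2 (ι → ℂ)) (y : Ext ι) : Commute x y := by
  refine two_form_induction hx (C := fun x => Commute x y) ?_ ?_
  · intro α β
    induction y using left_induction with
    | hone => exact Commute.one_right _
    | hadd y z hy hz => exact hy.add_right hz
    | hsmul c y hy => exact hy.smul_right c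
    | hmul γ y hy =>
      refine Commute.mul_right ?_ hy
      change cov α * cov β * cov γ = cov γ * (cov α * cov β)
      rw [cov_mul_comm_assoc, cov_mul_comm γ β, mul_neg, neg_neg, mul_assoc]
  · intro x _ z _ hx hz
    exact hx.add_left hz

theorem two_form_nilpotent {x : Ext ι} (hx : x ∈ ⋀[ℂ]^2 (ι → ℂ)) : IsNilpotent x := by
  refine two_form_induction hx (C := fun x => IsNilpotent x) ?_ ?_
  · intro α β
    refine ⟨2, ?_⟩
    rw [pow_two, mul_assoc, cov_mul_comm_assoc, ← mul_assoc (cov α), cov_mul_self]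
    simp
  · intro x hx y hy h1 h2
    exact (two_form_comm hx y).isNilpotent_add h1 h2

theorem contract_two_mul {x : Ext ι} (hx : x ∈ ⋀[ℂ]^2 (ι → ℂ)) (v : ι → ℂ) (y : Ext ι) :
    contract v (x * y) = contract v x * y + x * contract v y := by
  rw [contract_mul]
  congr 2
  refine two_form_induction hx (C := fun x => gradeInv x = x) ?_ ?_
  · intro α β
    rw [map_mul, gradeInv_cov, gradeInv_cov, neg_mul_neg]
  · intro x _ y _ hx hy
    rw [map_add, hx, hy]

theorem contract_two_pow {x : Ext ι} (hx : x ∈ ⋀[ℂ]^2 (ι → ℂ)) (v : ι → ℂ) (k : ℕ) :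
    contract v (x ^ (k + 1)) = ((k + 1 : ℕ) : ℂ) • (contract v x * x ^ k) := by
  induction k with
  | zero => simp
  | succ k ih =>
    rw [pow_succ', contract_two_mul hx, ih, mul_smul_comm, ← mul_assoc,
      (two_form_comm hx _).eq, mul_assoc, ← pow_succ']
    nth_rw 1 [← one_smul ℂ (contract v x * x ^ (k + 1))]
    rw [← add_smul]
    congr 1
    push_cast
    ring

theorem exp_eq_sum_smul {x : Ext ι} {N : ℕ} (h : x ^ N = 0) :
    IsNilpotent.exp x = ∑ k ∈ Finset.range N, ((k.factorial : ℂ)⁻¹) • x ^ k := by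
  rw [IsNilpotent.exp_eq_sum h]
  refine Finset.sum_congr rfl fun k _ => ?_
  rw [← Rat.cast_smul_eq_qsmul ℂ]
  simp

/-- Contraction is a derivation with respect to two-forms, and these are central, so the usual chain
rule for the exponential applies. Applied to the kernel, it turns contractions into multiplications
and conversely. -/
theorem contract_exp {x : Ext ι} (hx : x ∈ ⋀[ℂ]^2 (ι → ℂ)) (v : ι → ℂ) :
    contract v (IsNilpotent.exp x) = contract v x * IsNilpotent.exp x := by
  obtain ⟨N, hN⟩ := two_form_nilpotent hx
  conv_lhs =>
    -- The series is cut off one term later on this side, because contraction lowers the power by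
    -- one.
    rw [exp_eq_sum_smul (N := N + 1) (by rw [pow_succ, hN, zero_mul]), Finset.sum_range_succ',
      contract_add, contract_sum]
  rw [exp_eq_sum_smul hN, Finset.mul_sum]
  simp only [pow_zero, contract_smul, contract_one, smul_zero, add_zero]
  refine Finset.sum_congr rfl fun k _ => ?_
  rw [contract_two_pow hx, smul_smul, mul_smul_comm]
  congr 1
  rw [Nat.factorial_succ]
  have : (k.factorial : ℂ) ≠ 0 := Nat.cast_ne_zero.2 k.factorial_ne_zero
  have : ((k + 1 : ℕ) : ℂ) ≠ 0 := Nat.cast_ne_zero.2 k.succ_ne_zero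
  push_cast at *
  field_simp

theorem exp_two_comm {x : Ext ι} (hx : x ∈ ⋀[ℂ]^2 (ι → ℂ)) (y : Ext ι) :
    Commute (IsNilpotent.exp x) y := by
  obtain ⟨N, hN⟩ := two_form_nilpotent hx
  rw [exp_eq_sum_smul hN]
  exact Commute.sum_left _ _ _ fun k _ => ((two_form_comm hx y).pow_left k).smul_left _

theorem extHom_two_mem (f : ι → κ → ℂ) {x : Ext ι} (hx : x ∈ ⋀[ℂ]^2 (ι → ℂ)) :
    extHom f x ∈ ⋀[ℂ]^2 (κ → ℂ) := by
  refine two_form_induction hx (C := fun x => extHom f x ∈ ⋀[ℂ]^2 (κ → ℂ)) ?_ ?_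
  · intro α β
    rw [map_mul, extHom_cov, extHom_cov]
    exact cov_mul_cov_mem _ _
  · intro x _ y _ hx hy
    rw [map_add]
    exact add_mem hx hy

theorem extHom_exp (f : ι → κ → ℂ) {x : Ext ι} (hx : x ∈ ⋀[ℂ]^2 (ι → ℂ)) :
    extHom f (IsNilpotent.exp x) = IsNilpotent.exp (extHom f x) :=
  IsNilpotent.map_exp (two_form_nilpotent hx) (extHom f)

/-! ### Iterated contractions -/

/-- Contraction with the vectors of a list, one after the other. -/
noncomputable def contractList : List (ι → ℂ) → Ext ι →ₗ[ℂ] Ext ι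
  | [] => LinearMap.id
  | v :: l => contractList l ∘ₗ contractBilin v

theorem contractList_nil (x : Ext ι) : contractList [] x = x := rfl

theorem contractList_cons (v : ι → ℂ) (l : List (ι → ℂ)) (x : Ext ι) :
    contractList (v :: l) x = contractList l (contract v x) := rfl

theorem foldl_contract (l : List (ι → ℂ)) (x : Ext ι) :
    l.foldl (fun ψ u => contract u ψ) x = contractList l x := by
  induction l generalizing x with
  | nil => rfl
  | cons v l ih => rw [List.foldl_cons, ih, contractList_cons]

theorem contractList_cov_mul {l : List (ι → ℂ)} {α : ι → ℂ} (h : ∀ v ∈ l, α ⬝ᵥ v = 0)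
    (x : Ext ι) : contractList l (cov α * x) = (-1 : ℂ) ^ l.length • (cov α * contractList l x) := by
  induction l generalizing x with
  | nil => simp [contractList_nil]
  | cons v l ih =>
    rw [contractList_cons, contract_cov_mul, h v (by simp), zero_smul, zero_sub, map_neg,
      ih (fun v hv => h v (by simp [hv])), contractList_cons, List.length_cons, pow_succ]
    simp

theorem contractList_contract (l : List (ι → ℂ)) (u : ι → ℂ) (x : Ext ι) :
    contractList l (contract u x) = (-1 : ℂ) ^ l.length • contract u (contractList l x) := by
  induction l generalizing x with
  | nil => simp [contractList_nil]
  | cons v l ih =>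
    rw [contractList_cons, contract_comm, map_neg, ih, contractList_cons, List.length_cons, pow_succ]
    simp

/-- Contractions anticommute and square to zero. For fibre integration this says that the integral
of a contraction along the fibre vanishes, which serves as integration by parts. -/
theorem contractList_contract_mem {l : List (ι → ℂ)} {u : ι → ℂ} (h : u ∈ l) (x : Ext ι) :
    contractList l (contract u x) = 0 := by
  induction l generalizing x with
  | nil => simp at h
  | cons v l ih =>
    rw [contractList_cons]
    rcases List.mem_cons.1 h with rfl | h
    · rw [contract_contract, map_zero]
    · rw [contract_comm, map_neg, ih h, neg_zero]

theorem contractList_prod_of_dual {n : ℕ} (η v : Fin n → ι → ℂ)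
    (h : ∀ i j, η i ⬝ᵥ v j = if i = j then 1 else 0) :
    contractList (List.ofFn v) (List.ofFn fun i => cov (η i)).prod = 1 := by
  have key : ∀ {m : ℕ} (ξ : Fin m → ι → ℂ) (u : ι → ℂ), (∀ i, ξ i ⬝ᵥ u = 0) →
      contract u (List.ofFn fun i => cov (ξ i)).prod = 0 := by
    intro m ξ u hu
    induction m with
    | zero => simp [contract_one]
    | succ m ih =>
      rw [List.ofFn_succ, List.prod_cons, contract_cov_mul, hu, ih _ fun i => hu i.succ]
      simp
  induction n with
  | zero => simp [contractList_nil]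
  | succ n ih =>
    rw [List.ofFn_succ, List.ofFn_succ, List.prod_cons, contractList_cons, contract_cov_mul, h,
      key _ _ fun i => by simp [h]]
    simp only [if_true, one_smul, mul_zero, sub_zero]
    exact ih _ _ fun i j => by simp [h]

/-- A Gaussian integral in odd variables: each contraction brings down one covector from `E` and
places it in front of the earlier ones, hence the reversed order. By `h` the later contractions do
not see the covectors already brought down; `Y` accumulates them in the induction. -/
theorem contractList_exp {n : ℕ} (η v : Fin n → ι → ℂ) (h : ∀ i j, η i ⬝ᵥ v j = 0) {E : Ext ι}
    (hE : ∀ i, contract (v i) E = cov (η i) * E) (Y : Ext ι) (hY : ∀ i, contract (v i) Y = 0) :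
    contractList (List.ofFn v) (Y * E) = (List.ofFn fun i => cov (η i)).reverse.prod * (Y * E) := by
  induction n generalizing Y with
  | zero => simp [contractList_nil]
  | succ n ih =>
    have hstep : contract (v 0) (Y * E) = cov (η 0) * Y * E := by
      rw [contract_mul, hY, zero_mul, zero_add, hE, ← mul_assoc, ← cov_mul]
    rw [List.ofFn_succ, List.ofFn_succ, contractList_cons, hstep,
      ih (fun i => η i.succ) (fun i => v i.succ) (fun i j => h _ _) (fun i => hE _) _ fun i => ?_]
    · simp [mul_assoc]
    · rw [contract_cov_mul, h, hY]
      simp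

end Exterior

/-! ### Products of pairs, determinants and complex conjugation -/

section Products

variable {ι κ : Type*} [Fintype ι] [LinearOrder ι] [Fintype κ] [LinearOrder κ]

theorem add_pow_of_sq_zero {R : Type*} [Ring R] {a S : R} (h : Commute a S) (ha : a * a = 0)
    (m : ℕ) : (a + S) ^ (m + 1) = S ^ (m + 1) + ((m + 1 : ℕ) : R) * (a * S ^ m) := by
  induction m with
  | zero => simp [add_comm]
  | succ m ih =>
    have h1 : a * (((m + 1 : ℕ) : R) * (a * S ^ m)) = 0 := by
      rw [← mul_assoc, ← (Nat.cast_commute (m + 1) a).eq, mul_assoc, ← mul_assoc a, ha]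
      simp
    have h2 : S * (((m + 1 : ℕ) : R) * (a * S ^ m)) = ((m + 1 : ℕ) : R) * (a * S ^ (m + 1)) := by
      rw [← mul_assoc, ← (Nat.cast_commute (m + 1) S).eq, mul_assoc, ← mul_assoc S, ← h.eq,
        mul_assoc, ← pow_succ']
    rw [pow_succ', ih, add_mul, mul_add, mul_add, h1, h2, ← pow_succ', add_zero]
    push_cast
    noncomm_ring

theorem pair_sq_zero (α β : ι → ℂ) : cov α * cov β * (cov α * cov β) = 0 := by
  rw [mul_assoc, cov_mul_comm_assoc, ← mul_assoc (cov α), cov_mul_self]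
  simp

theorem sum_pairs_mem {σ : Type*} (s : Finset σ) (u v : σ → ι → ℂ) :
    ∑ i ∈ s, cov (u i) * cov (v i) ∈ ⋀[ℂ]^2 (ι → ℂ) :=
  Submodule.sum_mem _ fun _ _ => cov_mul_cov_mem _ _

/-- The pairs commute and square to zero, so only squarefree products survive in the expansion. The
two claims go through one induction, since the power formula for a longer sum uses the vanishing for
the shorter one. -/
theorem sum_pairs_pow {n : ℕ} (u v : Fin n → ι → ℂ) :
    (∑ i, cov (u i) * cov (v i)) ^ n =
        (n.factorial : Ext ι) * (List.ofFn fun i => cov (u i) * cov (v i)).prod ∧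
      (∑ i, cov (u i) * cov (v i)) ^ (n + 1) = 0 := by
  induction n with
  | zero => simp
  | succ n ih =>
    obtain ⟨h1, h2⟩ := ih (fun i => u i.succ) (fun i => v i.succ)
    have hc := two_form_comm (cov_mul_cov_mem (u 0) (v 0)) (∑ i : Fin n, cov (u i.succ) * cov (v i.succ))
    rw [Fin.sum_univ_succ]
    constructor
    · rw [add_pow_of_sq_zero hc (pair_sq_zero _ _), h2, h1, zero_add, List.ofFn_succ,
        List.prod_cons, Nat.factorial_succ, Nat.cast_mul, mul_assoc ((n + 1 : ℕ) : Ext ι)]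
      congr 1
      rw [← mul_assoc, ← (Nat.cast_commute n.factorial _).eq, mul_assoc]
    · rw [add_pow_of_sq_zero hc (pair_sq_zero _ _), h2, pow_succ, h2]
      simp

/-- In `u₁ ⋯ uₙ vₙ ⋯ v₁` the partners meet from the inside outwards, and every completed pair is
even, so no sign arises. This is why reversed products are convenient. -/
theorem prod_mul_reverse_prod {n : ℕ} (u v : Fin n → ι → ℂ) :
    (List.ofFn fun i => cov (u i)).prod * (List.ofFn fun i => cov (v i)).reverse.prod =
      (List.ofFn fun i => cov (u i) * cov (v i)).prod := by
  induction n with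
  | zero => simp
  | succ n ih =>
    have hc : Commute (List.ofFn fun i : Fin n => cov (u i.succ) * cov (v i.succ)).prod
        (cov (v 0)) := by
      refine Commute.list_prod_left _ _ fun x hx => ?_
      obtain ⟨i, rfl⟩ := (List.mem_ofFn' _ _).1 hx
      exact two_form_comm (cov_mul_cov_mem _ _) _
    rw [List.ofFn_succ, List.ofFn_succ, List.ofFn_succ, List.prod_cons, List.prod_cons,
      List.reverse_cons, List.prod_append, mul_assoc, ← mul_assoc _ _ [_].prod, ih,
      List.prod_singleton, hc.eq, mul_assoc]

/-- The sign of the reversal of `n` factors. -/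
def revSign (n : ℕ) : ℂ := ((Equiv.Perm.sign (Fin.revPerm : Equiv.Perm (Fin n)) : ℤ) : ℂ)

theorem revSign_mul_self (n : ℕ) : revSign n * revSign n = 1 := by
  unfold revSign
  rw [← Int.cast_mul, ← Units.val_mul, Int.units_mul_self]
  simp

theorem revSign_ne_zero (n : ℕ) : revSign n ≠ 0 := fun h => by
  simpa [h] using revSign_mul_self n

theorem reverse_prod_eq {n : ℕ} (u : Fin n → ι → ℂ) :
    (List.ofFn fun i => cov (u i)).reverse.prod = revSign n • ExteriorAlgebra.ιMulti ℂ n u := by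
  have h : (List.ofFn fun i => cov (u i)).reverse.prod =
      ExteriorAlgebra.ιMulti ℂ n (u ∘ Fin.revPerm) := by
    rw [ExteriorAlgebra.ιMulti_apply]
    congr 1
    refine List.ext_getElem (by simp) fun i h1 h2 => ?_
    simp only [List.getElem_reverse, List.getElem_ofFn, List.length_ofFn, Function.comp_apply,
      Fin.revPerm_apply]
    congr 2
    ext
    simp only [Fin.val_rev]
    omega
  rw [h, AlternatingMap.map_perm, revSign, Units.smul_def, Int.cast_smul_eq_zsmul]

/-- Both sides are alternating in the rows of `M`, so it suffices to compare them on permutation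
matrices, where both reduce to the sign. -/
theorem ιMulti_matrix {n : ℕ} (M : Matrix (Fin n) (Fin n) ℂ) (u : Fin n → ι → ℂ) :
    ExteriorAlgebra.ιMulti ℂ n (fun i => ∑ j, M i j • u j) =
      M.det • ExteriorAlgebra.ιMulti ℂ n u := by
  let f : (Fin n → ℂ) [⋀^Fin n]→ₗ[ℂ] Ext ι := (ExteriorAlgebra.ιMulti ℂ n).compLinearMap
    (Fintype.linearCombination ℂ u)
  let g : (Fin n → ℂ) [⋀^Fin n]→ₗ[ℂ] Ext ι :=
    (LinearMap.toSpanSingleton ℂ _ (ExteriorAlgebra.ιMulti ℂ n u)).compAlternatingMap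
      Matrix.detRowAlternating
  have hfg : f = g := by
    refine (Pi.basisFun ℂ (Fin n)).ext_alternating fun σ hσ => ?_
    let τ : Equiv.Perm (Fin n) := Equiv.ofBijective σ (Finite.injective_iff_bijective.1 hσ)
    have h1 : f (fun i => Pi.basisFun ℂ (Fin n) (σ i)) = ExteriorAlgebra.ιMulti ℂ n (u ∘ τ) := by
      simp only [f, AlternatingMap.compLinearMap_apply]
      congr 1
      ext i k
      simp [τ, Fintype.linearCombination_apply, Pi.single_apply, ite_apply]
    have h2 : (Matrix.detRowAlternating fun i => Pi.basisFun ℂ (Fin n) (σ i)) =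
        ((Equiv.Perm.sign τ : ℤ) : ℂ) := by
      have := Matrix.det_permutation (R := ℂ) τ
      rw [← this]
      change Matrix.det _ = _
      congr 1
      ext i j
      simp [τ, Equiv.Perm.permMatrix, PEquiv.toMatrix_apply, Pi.single_apply, eq_comm]
    rw [h1, AlternatingMap.map_perm]
    simp only [g, LinearMap.compAlternatingMap_apply, LinearMap.toSpanSingleton_apply]
    rw [h2, Units.smul_def, Int.cast_smul_eq_zsmul]
  have := congrArg (fun F => F (fun i => M i)) hfg
  simp only [f, g, Fintype.linearCombination_apply, AlternatingMap.compLinearMap_apply,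
    LinearMap.compAlternatingMap_apply, LinearMap.toSpanSingleton_apply] at this
  exact this

/-! ### Complex conjugation -/

/-- Real forms as complex forms. -/
noncomputable def complexify : ExteriorAlgebra ℝ (ι → ℝ) →ₐ[ℝ] Ext ι :=
  ExteriorAlgebra.lift ℝ ⟨
    { toFun := fun v => cov (realVec v)
      map_add' := fun u v => by
        rw [← map_add]
        congr 1
        ext i
        simp [realVec]
      map_smul' := fun c v => by
        have : realVec (c • v) = (c : ℂ) • realVec v := by ext i; simp [realVec]
        rw [this]
        exact map_smul (ExteriorAlgebra.ι ℂ) (c : ℂ) _ },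
    fun v => cov_mul_self _⟩

theorem complexify_ι (v : ι → ℝ) : complexify (ExteriorAlgebra.ι ℝ v) = cov (realVec v) := by
  unfold complexify
  rw [ExteriorAlgebra.lift_ι_apply]
  rfl

theorem mono_eq_complexify (I : Finset ι) :
    mono I = complexify ((Pi.basisFun ℝ ι).ExteriorAlgebra I) := by
  unfold mono
  rw [ExteriorAlgebra.basis_apply, ExteriorAlgebra.basis_apply]
  unfold ExteriorAlgebra.ιMulti_family
  rw [ExteriorAlgebra.ιMulti_apply, ExteriorAlgebra.ιMulti_apply, map_list_prod, List.map_ofFn]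
  congr 2
  ext i
  simp only [Function.comp_apply]
  rw [complexify_ι]
  congr 1
  ext k
  simp [realVec, Pi.single_apply, apply_ite]

theorem sum_coeff_mono (φ : Ext ι) : ∑ I, coeff I φ • mono I = φ := mono.sum_repr φ

theorem coeff_mono (I J : Finset ι) : coeff I (mono J : Ext ι) = if J = I then 1 else 0 := by
  simp [coeff, Finsupp.single_apply]

theorem coeff_add (I : Finset ι) (x y : Ext ι) : coeff I (x + y) = coeff I x + coeff I y := by
  simp [coeff]

theorem coeff_smul (I : Finset ι) (c : ℂ) (x : Ext ι) : coeff I (c • x) = c * coeff I x := by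
  simp [coeff]

theorem coeff_sum {σ : Type*} (s : Finset σ) (I : Finset ι) (f : σ → Ext ι) :
    coeff I (∑ i ∈ s, f i) = ∑ i ∈ s, coeff I (f i) := by
  simp [coeff]

theorem ext_coeff {x y : Ext ι} (h : ∀ I, coeff I x = coeff I y) : x = y := by
  rw [← sum_coeff_mono x, ← sum_coeff_mono y]
  simp [h]

theorem coeff_conjForm (I : Finset ι) (x : Ext ι) :
    coeff I (conjForm x) = starRingEnd ℂ (coeff I x) := by
  simp [conjForm, coeff_sum, coeff_smul, coeff_mono]

theorem conjForm_smul (c : ℂ) (x : Ext ι) : conjForm (c • x) = starRingEnd ℂ c • conjForm x :=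
  ext_coeff fun I => by simp [coeff_conjForm, coeff_smul]

theorem conjForm_sum {σ : Type*} (s : Finset σ) (f : σ → Ext ι) :
    conjForm (∑ i ∈ s, f i) = ∑ i ∈ s, conjForm (f i) :=
  ext_coeff fun I => by simp [coeff_conjForm, coeff_sum]

theorem conjForm_complexify (y : ExteriorAlgebra ℝ (ι → ℝ)) :
    conjForm (complexify y) = complexify y := by
  have h : complexify y =
      ∑ I, (((Pi.basisFun ℝ ι).ExteriorAlgebra.repr y I : ℝ) : ℂ) • mono I := by
    conv_lhs => rw [← (Pi.basisFun ℝ ι).ExteriorAlgebra.sum_repr y, map_sum]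
    refine Finset.sum_congr rfl fun I _ => ?_
    rw [map_smul, mono_eq_complexify]
    rfl
  rw [h, conjForm_sum]
  refine Finset.sum_congr rfl fun I _ => ?_
  rw [conjForm_smul, Complex.conj_ofReal]
  congr 1
  refine ext_coeff fun J => ?_
  rw [coeff_conjForm, coeff_mono]
  split_ifs <;> simp

/-- Conjugation is defined on coefficients, so multiplicativity amounts to real structure constants
of the monomial basis. These are real because the monomials come from the real exterior algebra. -/
theorem conjForm_mul (x y : Ext ι) : conjForm (x * y) = conjForm x * conjForm y := by
  have key : ∀ I J : Finset ι, conjForm (mono I * mono J : Ext ι) = mono I * mono J := by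
    intro I J
    rw [mono_eq_complexify, mono_eq_complexify, ← map_mul, conjForm_complexify]
  conv_lhs => rw [← sum_coeff_mono x, ← sum_coeff_mono y]
  simp only [conjForm, Finset.sum_mul_sum, smul_mul_smul_comm]
  rw [← conjForm, conjForm_sum]
  refine Finset.sum_congr rfl fun I _ => ?_
  rw [conjForm_sum]
  refine Finset.sum_congr rfl fun J _ => ?_
  rw [conjForm_smul, key, map_mul]

theorem conjForm_one : conjForm (1 : Ext ι) = 1 := by
  simpa using conjForm_complexify (ι := ι) 1

theorem conjForm_cov (α : ι → ℂ) : conjForm (cov α) = cov (star α) := by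
  have h : ∀ β : ι → ℂ, cov β = ∑ i, β i • complexify (ExteriorAlgebra.ι ℝ (Pi.single i 1)) := by
    intro β
    simp only [complexify_ι]
    simp only [← map_smul, ← map_sum]
    congr 1
    ext k
    simp [realVec, Finset.sum_apply, Pi.single_apply, apply_ite]
  rw [h α, h (star α), conjForm_sum]
  refine Finset.sum_congr rfl fun i _ => ?_
  rw [conjForm_smul, conjForm_complexify]
  rfl

theorem conjForm_ιMulti {n : ℕ} (u : Fin n → ι → ℂ) :
    conjForm (ExteriorAlgebra.ιMulti ℂ n u) = ExteriorAlgebra.ιMulti ℂ n fun i => star (u i) := by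
  rw [ExteriorAlgebra.ιMulti_apply, ExteriorAlgebra.ιMulti_apply]
  induction n with
  | zero => simp [conjForm_one]
  | succ n ih =>
    rw [List.ofFn_succ, List.ofFn_succ, List.prod_cons, List.prod_cons, conjForm_mul, conjForm_cov, ih]

end Products

section Vectors

variable {ι κ : Type*} [Fintype ι] [LinearOrder ι] [Fintype κ] [LinearOrder κ]

theorem unitVec_dotProduct (i : ι) (v : ι → ℂ) : unitVec i ⬝ᵥ v = v i := by
  simp [unitVec]

theorem unitVec_apply (i j : ι) : unitVec i j = if j = i then 1 else 0 := by
  simp [unitVec, Pi.single_apply]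

theorem eq_sum_unitVec (α : ι → ℂ) : α = ∑ i, α i • unitVec i := by
  ext k
  simp [unitVec, Finset.sum_apply, Pi.single_apply]

theorem extHom_unitVec (f : ι → κ → ℂ) (i : ι) : extHom f (cov (unitVec i)) = cov (f i) := by
  rw [extHom_cov]
  congr 1
  ext k
  simp [unitVec_apply]

theorem dx_eq_cov (i : ι) : dx i = cov (unitVec i) := rfl

theorem contract_zero_left (x : Ext ι) : contract 0 x = 0 := by
  simp [contract]

end Vectors

/-! ### Coordinates on the two bundles and the forms `∑ a i j dθ i ∧ dr j` -/

section Indices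

variable {n : ℕ}

theorem sum_idx {M : Type*} [AddCommMonoid M] (f : Idx n → M) :
    ∑ k, f k = ∑ i, f (bi i) + ∑ i, f (fi i) := by
  rw [← toLex.sum_comp, Fintype.sum_sum_type]
  rfl

theorem idx_cases {C : Idx n → Prop} (hb : ∀ i, C (bi i)) (hf : ∀ i, C (fi i)) (k : Idx n) :
    C k := by
  rcases h : ofLex k with i | i
  · have := hb i
    rwa [bi, ← h] at this
  · have := hf i
    rwa [fi, ← h] at this

@[simp] theorem bi_inj (i j : Fin n) : bi i = bi j ↔ i = j := by simp [bi]

@[simp] theorem fi_inj (i j : Fin n) : fi i = fi j ↔ i = j := by simp [fi]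

@[simp] theorem bi_ne_fi (i j : Fin n) : bi i ≠ fi j := by simp [bi, fi]

@[simp] theorem fi_ne_bi (i j : Fin n) : fi i ≠ bi j := by simp [bi, fi]

@[simp] theorem ti_inj (i j : Idx n) : ti i = ti j ↔ i = j := by simp [ti]

@[simp] theorem oi_inj (i j : Fin n) : (oi i : Idx3 n) = oi j ↔ i = j := by simp [oi]

@[simp] theorem ti_ne_oi (i : Idx n) (j : Fin n) : ti i ≠ oi j := by simp [ti, oi]

@[simp] theorem oi_ne_ti (i : Fin n) (j : Idx n) : oi i ≠ ti j := by simp [ti, oi]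

theorem polSwitch_fi (i : Fin n) :
    polSwitch (cov (unitVec (fi i))) = cov ((1 / 2 : ℂ) • (unitVec (fi i) + unitVec (bi i))) := by
  unfold polSwitch
  rw [extHom_unitVec]
  rfl

theorem polSwitch_bi (i : Fin n) : polSwitch (cov (unitVec (bi i))) =
    cov ((1 / (2 * Complex.I)) • (unitVec (fi i) - unitVec (bi i))) := by
  unfold polSwitch
  rw [extHom_unitVec]
  rfl

theorem I_mul_inv_two_I : Complex.I * (1 / (2 * Complex.I)) = 1 / 2 := by
  field_simp

theorem polSwitch_dz (i : Fin n) : polSwitch (cov (dz i)) = cov (unitVec (fi i)) := by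
  unfold dz
  rw [cov_add, cov_smul, map_add, map_smul, polSwitch_fi, polSwitch_bi, ← cov_smul, ← cov_add]
  congr 1
  rw [smul_smul, I_mul_inv_two_I, ← smul_add, add_add_sub_cancel, ← two_smul ℂ, smul_smul]
  norm_num

theorem polSwitch_dzbar (i : Fin n) : polSwitch (cov (dzbar i)) = cov (unitVec (bi i)) := by
  unfold dzbar
  rw [cov_sub, cov_smul, map_sub, map_smul, polSwitch_fi, polSwitch_bi, ← cov_smul, ← cov_sub]
  congr 1
  rw [smul_smul, I_mul_inv_two_I, ← smul_sub, add_sub_sub_cancel, ← two_smul ℂ, smul_smul]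
  norm_num

theorem polSwitchInv_fi (i : Fin n) : polSwitchInv (cov (unitVec (fi i))) = cov (dz i) := by
  unfold polSwitchInv
  rw [extHom_unitVec]
  rfl

theorem polSwitchInv_bi (i : Fin n) : polSwitchInv (cov (unitVec (bi i))) = cov (dzbar i) := by
  unfold polSwitchInv
  rw [extHom_unitVec]
  rfl

theorem pullOther_fi (i : Fin n) : pullOther (cov (unitVec (fi i))) = cov (unitVec (oi i)) := by
  unfold pullOther
  rw [extHom_unitVec]
  rfl

theorem pullOther_bi (i : Fin n) :
    pullOther (cov (unitVec (bi i))) = cov (unitVec (ti (bi i))) := by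
  unfold pullOther
  rw [extHom_unitVec]
  rfl

/-- The form `∑ a i j dθ i ∧ dr j`. -/
noncomputable def mixedForm (a : Matrix (Fin n) (Fin n) ℂ) : Ext (Idx n) :=
  ∑ i, ∑ j, a i j • (cov (unitVec (fi i)) * cov (unitVec (bi j)))

/-- The covector `dθ i + i ∑ b i j dr j`. -/
noncomputable def etaCov (b : Matrix (Fin n) (Fin n) ℂ) (i : Fin n) : Idx n → ℂ :=
  unitVec (fi i) + Complex.I • ∑ j, b i j • unitVec (bi j)

theorem etaCov_one : etaCov (1 : Matrix (Fin n) (Fin n) ℂ) = dz := by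
  ext i
  simp [etaCov, dz, Matrix.one_apply]

theorem mixedForm_eq_sum_pairs (a : Matrix (Fin n) (Fin n) ℂ) :
    mixedForm a = ∑ i, cov (unitVec (fi i)) * cov (∑ j, a i j • unitVec (bi j)) := by
  simp only [mixedForm, cov_sum, cov_smul, Finset.mul_sum, mul_smul_comm]

theorem mixedForm_mem (a : Matrix (Fin n) (Fin n) ℂ) : mixedForm a ∈ ⋀[ℂ]^2 (Idx n → ℂ) := by
  rw [mixedForm_eq_sum_pairs]
  exact sum_pairs_mem _ _ _

/-- In the expansion of `dz i ∧ conj (dz j)` the parts `dθ ∧ dθ` and `dr ∧ dr` are antisymmetric in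
`i, j` and cancel against symmetric `a`; the two mixed parts contribute equally. -/
theorem mixedForm_of_symm {a : Matrix (Fin n) (Fin n) ℂ} (ha : a.IsSymm) :
    (Complex.I / 2) • ∑ i, ∑ j, a i j • (cov (dz i) * cov (dzbar j)) = mixedForm a := by
  have h1 : ∀ i j : Fin n, cov (dz i) * cov (dzbar j) =
      (cov (unitVec (fi i)) * cov (unitVec (fi j)) + cov (unitVec (bi i)) * cov (unitVec (bi j))) -
        Complex.I • (cov (unitVec (fi i)) * cov (unitVec (bi j)) +
          cov (unitVec (fi j)) * cov (unitVec (bi i))) := by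
    intro i j
    simp only [dz, dzbar, cov_add, cov_sub, cov_smul, add_mul, mul_sub, smul_mul_assoc,
      mul_smul_comm, smul_smul, Complex.I_mul_I, smul_add, cov_mul_comm (unitVec (bi i)) (unitVec (fi j))]
    simp only [neg_smul, one_smul, smul_neg]
    abel
  have h2 : ∀ u v : Fin n → Idx n → ℂ, (∀ i j, cov (u i) * cov (v j) = -(cov (u j) * cov (v i))) →
      ∑ i, ∑ j, a i j • (cov (u i) * cov (v j)) = 0 := by
    intro u v h
    have : ∑ i, ∑ j, a i j • (cov (u i) * cov (v j)) =
        -∑ i, ∑ j, a i j • (cov (u i) * cov (v j)) := by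
      conv_lhs => rw [Finset.sum_comm]
      simp only [← Finset.sum_neg_distrib, ← smul_neg]
      refine Finset.sum_congr rfl fun i _ => Finset.sum_congr rfl fun j _ => ?_
      rw [h, ha.apply]
    rw [eq_neg_iff_add_eq_zero, ← two_smul ℂ] at this
    exact (smul_eq_zero.1 this).resolve_left two_ne_zero
  have h3 : ∑ i, ∑ j, a i j • (cov (unitVec (fi j)) * cov (unitVec (bi i))) = mixedForm a := by
    rw [Finset.sum_comm]
    refine Finset.sum_congr rfl fun i _ => Finset.sum_congr rfl fun j _ => ?_
    rw [ha.apply]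
  simp only [h1, smul_sub, smul_add, Finset.sum_sub_distrib, Finset.sum_add_distrib]
  rw [h2 _ _ fun i j => cov_mul_comm _ _, h2 _ _ fun i j => cov_mul_comm _ _]
  simp only [smul_comm _ Complex.I, ← Finset.smul_sum]
  rw [h3]
  rw [← mixedForm, smul_zero, add_zero, zero_sub, ← two_smul ℂ, smul_smul, smul_smul, ← neg_smul]
  have : -(2 * (Complex.I * (Complex.I / 2))) = 1 := by
    rw [← mul_div_assoc, mul_div_cancel₀ _ two_ne_zero, Complex.I_mul_I, neg_neg]
  rw [mul_assoc, this, one_smul]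

end Indices

/-! ### The pointwise Fourier-Mukai transforms, their intertwining relations and inversion -/

section FourierOperators

variable {n : ℕ}

/-- Restriction of forms from the fibre product to the target bundle. -/
noncomputable def restrictTarget : Ext (Idx3 n) →ₐ[ℂ] Ext (Idx n) :=
  extHom fun k => Sum.elim (fun l => unitVec l) (fun _ => 0) (ofLex k)

theorem restrictTarget_ti (k : Idx n) : restrictTarget (cov (unitVec (ti k))) = cov (unitVec k) := by
  unfold restrictTarget
  rw [extHom_unitVec]
  rfl

theorem restrictTarget_oi (i : Fin n) :
    (restrictTarget (cov (unitVec (oi i))) : Ext (Idx n)) = 0 := by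
  unfold restrictTarget
  rw [extHom_unitVec]
  exact map_zero (ExteriorAlgebra.ι ℂ)

theorem contract_restrictTarget (k : Idx n) (y : Ext (Idx3 n)) :
    contract (unitVec k) (restrictTarget y) = restrictTarget (contract (unitVec (ti k)) y) := by
  unfold restrictTarget
  rw [contract_extHom]
  congr 2
  ext l
  rcases h : ofLex l with j | j
  · obtain rfl : l = ti j := by rw [ti, ← h]; rfl
    simp [unitVec_dotProduct, unitVec_apply]
  · obtain rfl : l = oi j := by rw [oi, ← h]; rfl
    simp [unitVec_apply]

theorem stripFibre_eq (y : Ext (Idx3 n)) : stripFibre y =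
    restrictTarget (contractList (List.ofFn fun i : Fin n => unitVec (oi i)) y) := by
  unfold stripFibre
  rw [foldl_contract]
  rfl

theorem contract_pullOther (k : Fin n) (x : Ext (Idx n)) :
    contract (unitVec (ti (fi k))) (pullOther x) = 0 := by
  unfold pullOther
  rw [contract_extHom]
  have : (fun i : Idx n => (Sum.elim (fun i => unitVec (ti (bi i))) (fun i => unitVec (oi i))
      (ofLex i) : Idx3 n → ℂ) ⬝ᵥ unitVec (ti (fi k))) = 0 := by
    ext l
    induction l using idx_cases with
    | hb i =>
      change unitVec (ti (bi i)) ⬝ᵥ _ = _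
      rw [unitVec_dotProduct, unitVec_apply]
      simp
    | hf i =>
      change unitVec (oi i) ⬝ᵥ _ = _
      rw [unitVec_dotProduct, unitVec_apply]
      simp
  rw [this, contract_zero_left, map_zero]

theorem contract_pullOther_oi (k : Fin n) (x : Ext (Idx n)) :
    contract (unitVec (oi k)) (pullOther x) = pullOther (contract (unitVec (fi k)) x) := by
  unfold pullOther
  rw [contract_extHom]
  congr 2
  ext l
  induction l using idx_cases with
  | hb i =>
    change unitVec (ti (bi i)) ⬝ᵥ _ = _
    rw [unitVec_dotProduct, unitVec_apply, unitVec_apply]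
    simp
  | hf i =>
    change unitVec (oi i) ⬝ᵥ _ = _
    rw [unitVec_dotProduct, unitVec_apply, unitVec_apply]
    simp

/-- The form `∑ dt i ∧ dθ i` on the fibre product. -/
noncomputable def kernelForm (n : ℕ) : Ext (Idx3 n) := ∑ i, dx (oi i) * dx (ti (fi i))

/-- The form `-∑ dθ i ∧ dt i` on the fibre product. -/
noncomputable def kernelFormDual (n : ℕ) : Ext (Idx3 n) := -∑ i, dx (ti (fi i)) * dx (oi i)

theorem kernelForm_mem : kernelForm n ∈ ⋀[ℂ]^2 (Idx3 n → ℂ) := sum_pairs_mem _ _ _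

theorem kernelFormDual_mem : kernelFormDual n ∈ ⋀[ℂ]^2 (Idx3 n → ℂ) := neg_mem (sum_pairs_mem _ _ _)

/-- The pointwise Fourier-Mukai transform. -/
noncomputable def fourier : Ext (Idx n) →ₗ[ℂ] Ext (Idx n) :=
  restrictTarget.toLinearMap ∘ₗ contractList (List.ofFn fun i : Fin n => unitVec (oi i)) ∘ₗ
    LinearMap.mulRight ℂ (IsNilpotent.exp (kernelForm n)) ∘ₗ
      pullOther.toLinearMap ∘ₗ polSwitch.toLinearMap

/-- The pointwise Fourier-Mukai transform in the opposite direction. -/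
noncomputable def fourierDual : Ext (Idx n) →ₗ[ℂ] Ext (Idx n) :=
  polSwitchInv.toLinearMap ∘ₗ restrictTarget.toLinearMap ∘ₗ
    contractList (List.ofFn fun i : Fin n => unitVec (oi i)) ∘ₗ
      LinearMap.mulRight ℂ (IsNilpotent.exp (kernelFormDual n)) ∘ₗ pullOther.toLinearMap

theorem fourier_apply (x : Ext (Idx n)) : fourier x =
    stripFibre (pullOther (polSwitch x) * IsNilpotent.exp (kernelForm n)) := by
  rw [stripFibre_eq]
  rfl

theorem fourierDual_apply (x : Ext (Idx n)) : fourierDual x =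
    polSwitchInv (stripFibre (pullOther x * IsNilpotent.exp (kernelFormDual n))) := by
  rw [stripFibre_eq]
  rfl

theorem contract_kernel (k : Fin n) : contract (unitVec (ti (fi k))) (IsNilpotent.exp (kernelForm n)) =
    -(cov (unitVec (oi k)) * IsNilpotent.exp (kernelForm n)) := by
  rw [contract_exp kernelForm_mem, ← neg_mul]
  congr 1
  rw [kernelForm, contract_sum, Finset.sum_eq_single k]
  · rw [dx_eq_cov, dx_eq_cov, contract_cov_mul, contract_cov, unitVec_dotProduct, unitVec_dotProduct]
    simp [unitVec_apply]
  · intro i _ hi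
    rw [dx_eq_cov, dx_eq_cov, contract_cov_mul, contract_cov, unitVec_dotProduct, unitVec_dotProduct]
    simp [unitVec_apply, hi]
  · simp

theorem contract_kernelDual (k : Fin n) :
    contract (unitVec (oi k)) (IsNilpotent.exp (kernelFormDual n)) =
      cov (unitVec (ti (fi k))) * IsNilpotent.exp (kernelFormDual n) := by
  rw [contract_exp kernelFormDual_mem]
  congr 1
  rw [kernelFormDual, contract_neg, contract_sum, Finset.sum_eq_single k]
  · rw [dx_eq_cov, dx_eq_cov, contract_cov_mul, contract_cov, unitVec_dotProduct, unitVec_dotProduct]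
    simp [unitVec_apply]
  · intro i _ hi
    rw [dx_eq_cov, dx_eq_cov, contract_cov_mul, contract_cov, unitVec_dotProduct, unitVec_dotProduct]
    simp [unitVec_apply, hi]
  · simp

/-- The sign is the cost of moving one odd operation past the `n` fibre contractions; it recurs in
`stripFibre_cov_mul`. -/
theorem stripFibre_contract (k : Idx n) (y : Ext (Idx3 n)) :
    stripFibre (contract (unitVec (ti k)) y) = (-1 : ℂ) ^ n • contract (unitVec k) (stripFibre y) := by
  rw [stripFibre_eq, stripFibre_eq, contract_restrictTarget, contractList_contract, List.length_ofFn,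
    map_smul]

theorem stripFibre_cov_mul (k : Idx n) (y : Ext (Idx3 n)) :
    stripFibre (cov (unitVec (ti k)) * y) = (-1 : ℂ) ^ n • (cov (unitVec k) * stripFibre y) := by
  rw [stripFibre_eq, stripFibre_eq, contractList_cov_mul, List.length_ofFn, map_smul, map_mul,
    restrictTarget_ti]
  intro v hv
  obtain ⟨i, rfl⟩ := (List.mem_ofFn' _ _).1 hv
  simp [unitVec_dotProduct, unitVec_apply]

theorem stripFibre_contract_oi (k : Fin n) (y : Ext (Idx3 n)) :
    stripFibre (contract (unitVec (oi k)) y) = 0 := by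
  rw [stripFibre_eq, contractList_contract_mem, map_zero]
  exact (List.mem_ofFn' _ _).2 ⟨k, rfl⟩

theorem stripFibre_neg (y : Ext (Idx3 n)) : stripFibre (-y) = -stripFibre y := by
  rw [stripFibre_eq, stripFibre_eq, map_neg, map_neg]

theorem stripFibre_sub (x y : Ext (Idx3 n)) :
    stripFibre (x - y) = stripFibre x - stripFibre y := by
  simp only [stripFibre_eq, map_sub]

/-- On the kernel, multiplication by `dθ̌ k` is minus the contraction with `∂/∂θ k`. The pulled-back
form contains no `dθ`, so this is a contraction of the whole integrand and passes through the fibre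
integral. -/
theorem fourier_dz_mul (k : Fin n) (x : Ext (Idx n)) :
    fourier (cov (dz k) * x) = -(-1 : ℂ) ^ n • contract (unitVec (fi k)) (fourier x) := by
  rw [fourier_apply, fourier_apply, map_mul, map_mul, polSwitch_dz, pullOther_fi]
  have h : cov (unitVec (oi k)) * pullOther (polSwitch x) * IsNilpotent.exp (kernelForm n) =
      -contract (unitVec (ti (fi k)))
        (pullOther (polSwitch x) * IsNilpotent.exp (kernelForm n)) := by
    rw [contract_mul, contract_pullOther, zero_mul, zero_add, contract_kernel, mul_neg, neg_neg,
      ← mul_assoc, ← cov_mul]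
  rw [h, stripFibre_neg, stripFibre_contract, neg_smul]

theorem fourier_dzbar_mul (k : Fin n) (x : Ext (Idx n)) :
    fourier (cov (dzbar k) * x) = (-1 : ℂ) ^ n • (cov (unitVec (bi k)) * fourier x) := by
  rw [fourier_apply, fourier_apply, map_mul, map_mul, polSwitch_dzbar, pullOther_bi, mul_assoc,
    stripFibre_cov_mul]

theorem fourierDual_dr_mul (k : Fin n) (x : Ext (Idx n)) :
    fourierDual (cov (unitVec (bi k)) * x) = (-1 : ℂ) ^ n • (cov (dzbar k) * fourierDual x) := by
  rw [fourierDual_apply, fourierDual_apply, map_mul, pullOther_bi, mul_assoc,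
    stripFibre_cov_mul, map_smul, map_mul, polSwitchInv_bi]

/-- Integration by parts: a contraction of the whole integrand along the fibre integrates to zero,
so the contraction of `x` is shifted to the kernel, where it brings down a covector `dθ̌ k`. -/
theorem fourierDual_contract (k : Fin n) (x : Ext (Idx n)) :
    fourierDual (contract (unitVec (fi k)) x) = -(-1 : ℂ) ^ n • (cov (dz k) * fourierDual x) := by
  rw [fourierDual_apply, fourierDual_apply, ← contract_pullOther_oi]
  have h : contract (unitVec (oi k)) (pullOther x) * IsNilpotent.exp (kernelFormDual n) =
      contract (unitVec (oi k)) (pullOther x * IsNilpotent.exp (kernelFormDual n)) -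
        cov (unitVec (ti (fi k))) * (pullOther x * IsNilpotent.exp (kernelFormDual n)) := by
    rw [contract_mul, contract_kernelDual, ← mul_assoc (gradeInv _), ← cov_mul, mul_assoc,
      add_sub_cancel_right]
  rw [h, stripFibre_sub, stripFibre_contract_oi, stripFibre_cov_mul, zero_sub, map_neg, map_smul,
    map_mul, polSwitchInv_fi, neg_smul]

theorem polSwitch_two_mixedForm {a : Matrix (Fin n) (Fin n) ℂ} (ha : a.IsSymm) :
    polSwitch ((2 : ℂ) • mixedForm a) =
      ∑ i, cov (unitVec (fi i)) * cov (Complex.I • ∑ j, a i j • unitVec (bi j)) := by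
  rw [← mixedForm_of_symm ha, smul_smul, mul_div_cancel₀ _ two_ne_zero, map_smul, map_sum,
    Finset.smul_sum]
  refine Finset.sum_congr rfl fun i _ => ?_
  rw [map_sum, Finset.smul_sum, cov_smul, cov_sum, mul_smul_comm, Finset.mul_sum, Finset.smul_sum]
  refine Finset.sum_congr rfl fun j _ => ?_
  rw [map_smul, map_mul, polSwitch_dz, polSwitch_dzbar, cov_smul, mul_smul_comm]

/-- The polarization switch makes the exponent `∑ dθ̌ i ∧ (i ∑ a i j dr j)`, and the kernel adds `∑
dθ̌ i ∧ dθ i`. The integrand is thus a single exponential `exp W` with `W = ∑ dθ̌ i ∧ ξ i`, to which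
`contractList_exp` applies; `W` restricts to zero on the target, so the leftover exponential is `1`.
-/
theorem fourier_exp {a : Matrix (Fin n) (Fin n) ℂ} (ha : a.IsSymm) :
    fourier (IsNilpotent.exp ((2 : ℂ) • mixedForm a)) =
      (List.ofFn fun i => cov (etaCov a i)).reverse.prod := by
  let ξ : Fin n → Idx3 n → ℂ := fun i =>
    Complex.I • (∑ j, a i j • unitVec (ti (bi j))) + unitVec (ti (fi i))
  let W : Ext (Idx3 n) := ∑ i, cov (unitVec (oi i)) * cov (ξ i)
  have hW : W ∈ ⋀[ℂ]^2 (Idx3 n → ℂ) := sum_pairs_mem _ _ _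
  have hmem : (2 : ℂ) • mixedForm a ∈ ⋀[ℂ]^2 (Idx n → ℂ) := Submodule.smul_mem _ _ (mixedForm_mem a)
  have hpull : pullOther (polSwitch ((2 : ℂ) • mixedForm a)) =
      ∑ i, cov (unitVec (oi i)) * cov (Complex.I • ∑ j, a i j • unitVec (ti (bi j))) := by
    rw [polSwitch_two_mixedForm ha, map_sum]
    refine Finset.sum_congr rfl fun i _ => ?_
    simp only [map_mul, pullOther_fi, map_smul, map_sum, pullOther_bi]
  have h1 : polSwitch ((2 : ℂ) • mixedForm a) ∈ ⋀[ℂ]^2 (Idx n → ℂ) := extHom_two_mem _ hmem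
  have h2 : pullOther (polSwitch ((2 : ℂ) • mixedForm a)) ∈ ⋀[ℂ]^2 (Idx3 n → ℂ) :=
    extHom_two_mem _ h1
  have hE : pullOther (polSwitch (IsNilpotent.exp ((2 : ℂ) • mixedForm a))) *
      IsNilpotent.exp (kernelForm n) = IsNilpotent.exp W := by
    rw [polSwitch, extHom_exp _ hmem, ← polSwitch, pullOther, extHom_exp _ h1, ← pullOther,
      ← IsNilpotent.exp_add_of_commute (two_form_comm h2 _) (two_form_nilpotent h2)
        (two_form_nilpotent kernelForm_mem), hpull, kernelForm, ← Finset.sum_add_distrib]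
    congr 1
    refine Finset.sum_congr rfl fun i _ => ?_
    rw [dx_eq_cov, dx_eq_cov, ← mul_add, ← cov_add]
  have hdot : ∀ i j, ξ i ⬝ᵥ unitVec (oi j) = 0 := by
    intro i j
    simp [ξ, add_dotProduct, sum_dotProduct, unitVec_dotProduct, unitVec_apply]
  have hcon : ∀ i, contract (unitVec (oi i)) (IsNilpotent.exp W) = cov (ξ i) * IsNilpotent.exp W := by
    intro k
    rw [contract_exp hW]
    congr 1
    simp only [W]
    rw [contract_sum, Finset.sum_eq_single k]
    · rw [contract_cov_mul, contract_cov, unitVec_dotProduct, hdot]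
      simp [unitVec_apply]
    · intro i _ hi
      rw [contract_cov_mul, contract_cov, unitVec_dotProduct, hdot]
      simp [unitVec_apply, hi]
    · simp
  have hres : ∀ i, restrictTarget (cov (ξ i)) = cov (etaCov a i) := by
    intro i
    simp only [ξ, etaCov, map_add, map_smul, map_sum, restrictTarget_ti]
    rw [add_comm]
  have hresW : restrictTarget W = 0 := by
    simp only [W, map_sum, map_mul, restrictTarget_oi, zero_mul, Finset.sum_const_zero]
  rw [fourier_apply, hE, stripFibre_eq]
  have := contractList_exp ξ (fun i => unitVec (oi i)) hdot hcon 1 fun i => contract_one _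
  rw [one_mul] at this
  rw [this, map_mul, map_list_prod, List.map_reverse, List.map_ofFn]
  have hexp : restrictTarget (IsNilpotent.exp W) = 1 := by
    rw [restrictTarget, extHom_exp _ hW, ← restrictTarget, hresW]
    exact IsNilpotent.exp_zero
  rw [hexp, mul_one]
  congr 3
  ext i
  exact hres i

/-- The transform of `1` is the fibre volume in reverse order, which accounts for `revSign n`. Every
term of the kernel form contains some fibre covector `dt i`, so the kernel exponential acts on this
volume as `1`. -/
theorem fourierDual_fourier_one : fourierDual (fourier (1 : Ext (Idx n))) = revSign n • 1 := by
  have h0 : (0 : Matrix (Fin n) (Fin n) ℂ).IsSymm := by simp [Matrix.IsSymm]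
  have h1 : fourier (1 : Ext (Idx n)) =
      (List.ofFn fun i => cov (unitVec (fi i))).reverse.prod := by
    have := fourier_exp h0
    simpa [mixedForm, etaCov, IsNilpotent.exp_zero] using this
  let P : Ext (Idx3 n) := (List.ofFn fun i : Fin n => cov (unitVec (oi i))).prod
  have h2 : pullOther (fourier (1 : Ext (Idx n))) = revSign n • P := by
    rw [h1, map_list_prod, List.map_reverse, List.map_ofFn]
    have : (⇑pullOther ∘ fun i : Fin n => cov (unitVec (fi i))) =
        fun i : Fin n => cov (unitVec (oi i)) := by
      ext i
      exact pullOther_fi i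
    rw [this, reverse_prod_eq, ExteriorAlgebra.ιMulti_apply]
  have h3 : kernelFormDual n * P = 0 := by
    rw [kernelFormDual, neg_mul, Finset.sum_mul, Finset.sum_eq_zero, neg_zero]
    intro i _
    rw [mul_assoc]
    have := ExteriorAlgebra.ι_mul_prod_list (R := ℂ) (fun i : Fin n => unitVec (oi i : Idx3 n)) i
    rw [dx_eq_cov, dx_eq_cov]
    refine (congrArg _ this).trans (mul_zero _)
  have h4 : P * IsNilpotent.exp (kernelFormDual n) = P := by
    obtain ⟨N, hN⟩ := two_form_nilpotent (kernelFormDual_mem (n := n))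
    rw [← (exp_two_comm kernelFormDual_mem P).eq,
      exp_eq_sum_smul (N := N + 1) (by rw [pow_succ, hN, zero_mul]), Finset.sum_range_succ',
      add_mul, Finset.sum_mul, Finset.sum_eq_zero]
    · simp
    · intro k _
      rw [pow_succ, smul_mul_assoc, mul_assoc, h3, mul_zero, smul_zero]
  rw [fourierDual_apply, h2, smul_mul_assoc, h4, stripFibre_eq, map_smul,
    contractList_prod_of_dual _ _ fun i j => ?_, map_smul, map_one, map_smul, map_one]
  simp [unitVec_dotProduct, unitVec_apply]

/-- The intertwining relations make the composite commute with multiplication by `dz k` and `conj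
(dz k)`, the signs squaring to `1`. These covectors span, so the composite is determined by its
value on `1`. -/
theorem fourierDual_fourier (x : Ext (Idx n)) : fourierDual (fourier x) = revSign n • x := by
  have hs : -(-1 : ℂ) ^ n * -(-1 : ℂ) ^ n = 1 := by
    rw [neg_mul_neg, ← mul_pow]
    simp
  have hs' : (-1 : ℂ) ^ n * (-1 : ℂ) ^ n = 1 := by
    rw [← mul_pow]
    simp
  induction x using left_induction with
  | hone => exact fourierDual_fourier_one
  | hadd x y hx hy => rw [map_add, map_add, hx, hy, smul_add]
  | hsmul c x hx => rw [map_smul, map_smul, hx, smul_comm]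
  | hmul α x hx =>
    have h1 : ∀ k : Fin n, fourierDual (fourier (cov (dz k) * x)) =
        revSign n • (cov (dz k) * x) := by
      intro k
      rw [fourier_dz_mul, map_smul, fourierDual_contract, smul_smul, hs, one_smul, hx,
        mul_smul_comm]
    have h2 : ∀ k : Fin n, fourierDual (fourier (cov (dzbar k) * x)) =
        revSign n • (cov (dzbar k) * x) := by
      intro k
      rw [fourier_dzbar_mul, map_smul, fourierDual_dr_mul, smul_smul, hs', one_smul, hx,
        mul_smul_comm]
    have h3 : ∀ k : Idx n, fourierDual (fourier (cov (unitVec k) * x)) =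
        revSign n • (cov (unitVec k) * x) := by
      intro k
      induction k using idx_cases with
      | hb i =>
        have : (unitVec (bi i) : Idx n → ℂ) = (1 / (2 * Complex.I)) • (dz i - dzbar i) := by
          rw [dz, dzbar, add_sub_sub_cancel, ← two_smul ℂ, smul_smul, smul_smul]
          rw [one_div, mul_assoc, inv_mul_cancel₀ (by simp), one_smul]
        rw [this, cov_smul, cov_sub, smul_mul_assoc, sub_mul]
        simp only [map_smul, map_sub, h1, h2]
        rw [smul_comm, smul_sub (revSign n)]
      | hf i =>
        have : (unitVec (fi i) : Idx n → ℂ) = (1 / 2 : ℂ) • (dz i + dzbar i) := by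
          rw [dz, dzbar, add_add_sub_cancel, ← two_smul ℂ, smul_smul]
          norm_num
        rw [this, cov_smul, cov_add, smul_mul_assoc, add_mul]
        simp only [map_smul, map_add, h1, h2]
        rw [smul_comm, smul_add (revSign n)]
    rw [eq_sum_unitVec α, cov_sum, Finset.sum_mul, map_sum, map_sum, Finset.smul_sum]
    refine Finset.sum_congr rfl fun k _ => ?_
    rw [cov_smul, smul_mul_assoc, map_smul, map_smul, h3, smul_comm]

theorem fourier_injective : Function.Injective (fourier : Ext (Idx n) → Ext (Idx n)) := by
  intro x y h
  have := congrArg fourierDual h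
  rw [fourierDual_fourier, fourierDual_fourier] at this
  exact smul_right_injective _ (revSign_ne_zero n) this

end FourierOperators

/-! ### Uniqueness of bidegree components -/

section Bidegree

variable {ι : Type*} [Fintype ι] [LinearOrder ι]

theorem smul_of_mem_mul {f : Ext ι →ₐ[ℂ] Ext ι} {M N : Submodule ℂ (Ext ι)} {a b : ℂ}
    (hM : ∀ x ∈ M, f x = a • x) (hN : ∀ x ∈ N, f x = b • x) :
    ∀ x ∈ M * N, f x = (a * b) • x := by
  intro x hx
  refine Submodule.mul_induction_on hx (fun m hm k hk => ?_) (fun x y hx hy => ?_)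
  · rw [map_mul, hM m hm, hN k hk, smul_mul_smul_comm]
  · rw [map_add, hx, hy, smul_add]

theorem smul_of_mem_pow {f : Ext ι →ₐ[ℂ] Ext ι} {M : Submodule ℂ (Ext ι)} {a : ℂ}
    (hM : ∀ x ∈ M, f x = a • x) (p : ℕ) : ∀ x ∈ M ^ p, f x = (a ^ p) • x := by
  induction p with
  | zero =>
    intro x hx
    rw [pow_zero] at hx
    obtain ⟨c, rfl⟩ := Submodule.mem_one.1 hx
    rw [pow_zero, one_smul, AlgHom.commutes]
  | succ p ih =>
    rw [pow_succ, pow_succ]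
    exact smul_of_mem_mul ih hM

theorem smul_of_mem_bideg {f : Ext ι →ₐ[ℂ] Ext ι} {A B : Submodule ℂ (ι → ℂ)} {a b : ℂ}
    (hA : ∀ α ∈ A, f (cov α) = a • cov α) (hB : ∀ α ∈ B, f (cov α) = b • cov α) (p q : ℕ) :
    ∀ x ∈ bideg A B p q, f x = (a ^ p * b ^ q) • x := by
  refine smul_of_mem_mul (smul_of_mem_pow ?_ p) (smul_of_mem_pow ?_ q)
  · rintro _ ⟨α, hα, rfl⟩
    exact hA α hα
  · rintro _ ⟨α, hα, rfl⟩
    exact hB α hα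

theorem two_pow_mul_three_pow_inj {a b p q : ℕ} (h : (2 : ℂ) ^ a * 3 ^ b = 2 ^ p * 3 ^ q) :
    (a, b) = (p, q) := by
  have h' : 2 ^ a * 3 ^ b = 2 ^ p * 3 ^ q := by exact_mod_cast h
  have h2 := congrArg (Nat.factorization · 2) h'
  have h3 := congrArg (Nat.factorization · 3) h'
  have e : Nat.factorization 3 2 = 0 := Nat.factorization_eq_zero_of_not_dvd (by norm_num)
  have e' : Nat.factorization 2 3 = 0 := Nat.factorization_eq_zero_of_not_dvd (by norm_num)
  simp [Nat.factorization_mul, Nat.factorization_pow, Nat.Prime.factorization_self Nat.prime_two,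
    Nat.Prime.factorization_self Nat.prime_three, e, e'] at h2 h3
  rw [h2, h3]

/-- The component is defined by a choice, so uniqueness is what has to be shown. An endomorphism
scaling `A` by 2 and `B` by 3 acts on bidegree `(p, q)` as `2^p 3^q`; these numbers are distinct by
unique factorization, and eigenspaces for distinct eigenvalues are independent. -/
theorem bidegProj_eq {f : Ext ι →ₐ[ℂ] Ext ι} {A B : Submodule ℂ (ι → ℂ)}
    (hA : ∀ α ∈ A, f (cov α) = (2 : ℂ) • cov α) (hB : ∀ α ∈ B, f (cov α) = (3 : ℂ) • cov α)
    {p q : ℕ} {φ ψ : Ext ι} (hψ : ψ ∈ bideg A B p q)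
    (hφ : φ - ψ ∈ ⨆ (a : ℕ × ℕ) (_ : a ≠ (p, q)), bideg A B a.1 a.2) :
    bidegProj A B p q φ = ψ := by
  obtain ⟨h1, h2⟩ : bidegProj A B p q φ ∈ bideg A B p q ∧
      φ - bidegProj A B p q φ ∈ ⨆ (a : ℕ × ℕ) (_ : a ≠ (p, q)), bideg A B a.1 a.2 :=
    Classical.epsilon_spec (p := fun ψ => ψ ∈ bideg A B p q ∧
      φ - ψ ∈ ⨆ (a : ℕ × ℕ) (_ : a ≠ (p, q)), bideg A B a.1 a.2) ⟨ψ, hψ, hφ⟩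
  have hind := Module.End.eigenspaces_iSupIndep (R := ℂ) f.toLinearMap ((2 : ℂ) ^ p * 3 ^ q)
  have hle : ∀ a : ℕ × ℕ, bideg A B a.1 a.2 ≤
      Module.End.eigenspace f.toLinearMap ((2 : ℂ) ^ a.1 * 3 ^ a.2) := fun a x hx =>
    Module.End.mem_eigenspace_iff.2 (smul_of_mem_bideg hA hB _ _ x hx)
  have h3 : bidegProj A B p q φ - ψ ∈ ⨆ (a : ℕ × ℕ) (_ : a ≠ (p, q)), bideg A B a.1 a.2 := by
    have := sub_mem hφ h2
    rwa [sub_sub_sub_cancel_left] at this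
  have h4 : (⨆ (a : ℕ × ℕ) (_ : a ≠ (p, q)), bideg A B a.1 a.2) ≤
      ⨆ (c : ℂ) (_ : c ≠ 2 ^ p * 3 ^ q), Module.End.eigenspace f.toLinearMap c :=
    iSup₂_le fun a ha => (hle a).trans (le_iSup₂_of_le _
      (fun h => ha (two_pow_mul_three_pow_inj h)) le_rfl)
  exact sub_eq_zero.1 (Submodule.disjoint_def.1 hind _ (hle (p, q) (sub_mem h1 hψ)) (h4 h3))

theorem bideg_succ_left (A B : Submodule ℂ (ι → ℂ)) (p q : ℕ) :
    bideg A B (p + 1) q = A.map (ExteriorAlgebra.ι ℂ) * bideg A B p q := by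
  rw [bideg, bideg, pow_succ', mul_assoc]

theorem cov_mul_mem_bideg {A B : Submodule ℂ (ι → ℂ)} {β : ι → ℂ} (hβ : β ∈ B) {p q : ℕ}
    {x : Ext ι} (hx : x ∈ bideg A B p q) : cov β * x ∈ bideg A B p (q + 1) := by
  induction p generalizing x with
  | zero =>
    rw [bideg, pow_zero, one_mul] at hx ⊢
    rw [pow_succ']
    exact Submodule.mul_mem_mul ⟨β, hβ, rfl⟩ hx
  | succ p ih =>
    rw [bideg_succ_left] at hx ⊢
    refine Submodule.mul_induction_on hx (fun m hm k hk => ?_) (fun x y hx hy => ?_)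
    · obtain ⟨α, hα, rfl⟩ := hm
      change cov β * (cov α * k) ∈ _
      rw [cov_mul_comm_assoc]
      exact neg_mem (Submodule.mul_mem_mul ⟨α, hα, rfl⟩ (ih hk))
    · rw [mul_add]
      exact add_mem hx hy

theorem contract_mem_bideg {A B : Submodule ℂ (ι → ℂ)} {v : ι → ℂ} (hv : ∀ β ∈ B, β ⬝ᵥ v = 0)
    {p q : ℕ} {x : Ext ι} (hx : x ∈ bideg A B (p + 1) q) : contract v x ∈ bideg A B p q := by
  have h0 : ∀ q, ∀ y ∈ bideg A B 0 q, contract v y = 0 := by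
    intro q
    induction q with
    | zero =>
      intro y hy
      rw [bideg, pow_zero, pow_zero, one_mul] at hy
      obtain ⟨c, rfl⟩ := Submodule.mem_one.1 hy
      rw [Algebra.algebraMap_eq_smul_one, contract_smul, contract_one, smul_zero]
    | succ q ih =>
      intro y hy
      rw [bideg, pow_zero, one_mul, pow_succ'] at hy
      refine Submodule.mul_induction_on hy (fun m hm k hk => ?_) (fun x y hx hy => ?_)
      · obtain ⟨α, hα, rfl⟩ := hm
        rw [contract_cov_mul, hv α hα, ih k (by rwa [bideg, pow_zero, one_mul])]
        simp
      · rw [contract_add, hx, hy, add_zero]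
  induction p generalizing x with
  | zero =>
    rw [bideg_succ_left] at hx
    refine Submodule.mul_induction_on hx (fun m hm k hk => ?_) (fun x y hx hy => ?_)
    · obtain ⟨α, hα, rfl⟩ := hm
      rw [contract_cov_mul, h0 q k hk, mul_zero, sub_zero]
      exact Submodule.smul_mem _ _ hk
    · rw [contract_add]
      exact add_mem hx hy
  | succ p ih =>
    rw [bideg_succ_left] at hx
    refine Submodule.mul_induction_on hx (fun m hm k hk => ?_) (fun x y hx hy => ?_)
    · obtain ⟨α, hα, rfl⟩ := hm
      rw [contract_cov_mul]
      refine sub_mem (Submodule.smul_mem _ _ hk) ?_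
      rw [bideg_succ_left]
      exact Submodule.mul_mem_mul ⟨α, hα, rfl⟩ (ih hk)
    · rw [contract_add]
      exact add_mem hx hy

theorem list_prod_mem_pow {M : Submodule ℂ (Ext ι)} (l : List (Ext ι)) (hl : ∀ x ∈ l, x ∈ M) :
    l.prod ∈ M ^ l.length := by
  induction l with
  | nil => simp
  | cons x l ih =>
    rw [List.prod_cons, List.length_cons, pow_succ']
    exact Submodule.mul_mem_mul (hl x (by simp)) (ih fun y hy => hl y (by simp [hy]))

end Bidegree

/-! ### Bidegree components of the transformed exponential -/

section MirrorComponents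

variable {n : ℕ}

variable (n) in
/-- The covectors `∑ α i dθ i`. -/
def fibreCov : Submodule ℂ (Idx n → ℂ) where
  carrier := {α | ∀ i, α (bi i) = 0}
  add_mem' h h' i := by simp [h i, h' i]
  zero_mem' i := rfl
  smul_mem' c α h i := by simp [h i]

variable (n) in
/-- The covectors `∑ α i dr i`. -/
def baseCov : Submodule ℂ (Idx n → ℂ) where
  carrier := {α | ∀ i, α (fi i) = 0}
  add_mem' h h' i := by simp [h i, h' i]
  zero_mem' i := rfl
  smul_mem' c α h i := by simp [h i]

/-- The rescaling `dr i ↦ s dr i`, `dθ i ↦ t dθ i`. -/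
noncomputable def rescale (s t : ℂ) : Ext (Idx n) →ₐ[ℂ] Ext (Idx n) :=
  extHom fun k => Sum.elim (fun i => s • unitVec (bi i)) (fun i => t • unitVec (fi i)) (ofLex k)

theorem rescale_fi (s t : ℂ) (i : Fin n) :
    rescale s t (cov (unitVec (fi i))) = t • cov (unitVec (fi i)) := by
  unfold rescale
  rw [extHom_unitVec, ← cov_smul]
  rfl

theorem rescale_bi (s t : ℂ) (i : Fin n) :
    rescale s t (cov (unitVec (bi i))) = s • cov (unitVec (bi i)) := by
  unfold rescale
  rw [extHom_unitVec, ← cov_smul]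
  rfl

theorem rescale_fibreCov (s t : ℂ) (α : Idx n → ℂ) (h : α ∈ fibreCov n) :
    rescale s t (cov α) = t • cov α := by
  have hα : cov α = ∑ i, α (fi i) • cov (unitVec (fi i)) := by
    rw [eq_sum_unitVec α, sum_idx, Finset.sum_eq_zero fun i _ => by rw [h i, zero_smul], zero_add,
      cov_sum]
    simp [Finset.sum_apply, unitVec_apply]
  rw [hα, map_sum, Finset.smul_sum]
  refine Finset.sum_congr rfl fun i _ => ?_
  rw [map_smul, rescale_fi, smul_comm]

theorem rescale_baseCov (s t : ℂ) (α : Idx n → ℂ) (h : α ∈ baseCov n) :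
    rescale s t (cov α) = s • cov α := by
  have hα : cov α = ∑ i, α (bi i) • cov (unitVec (bi i)) := by
    rw [eq_sum_unitVec α, sum_idx, Finset.sum_eq_zero (f := fun i => α (fi i) • _)
      fun i _ => by rw [h i, zero_smul], add_zero, cov_sum]
    simp [Finset.sum_apply, unitVec_apply]
  rw [hα, map_sum, Finset.smul_sum]
  refine Finset.sum_congr rfl fun i _ => ?_
  rw [map_smul, rescale_bi, smul_comm]

theorem unitVec_fi_mem (i : Fin n) : unitVec (fi i) ∈ fibreCov n := fun j => by
  simp [unitVec_apply]

theorem unitVec_bi_mem (i : Fin n) : unitVec (bi i) ∈ baseCov n := fun j => by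
  simp [unitVec_apply]

theorem baseCov_dotProduct {β : Idx n → ℂ} (hβ : β ∈ baseCov n) (i : Fin n) :
    β ⬝ᵥ unitVec (fi i) = 0 := by
  rw [dotProduct_comm, unitVec_dotProduct]
  exact hβ i

theorem fourier_one : fourier (1 : Ext (Idx n)) =
    (List.ofFn fun i => cov (unitVec (fi i))).reverse.prod := by
  have := fourier_exp (a := (0 : Matrix (Fin n) (Fin n) ℂ)) (by simp [Matrix.IsSymm])
  simpa [mixedForm, etaCov, IsNilpotent.exp_zero] using this

/-- The transform of `1` is of type `(n, 0)`, and every further factor `dz i ∧ conj (dz j)` adds a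
`dr j` and contracts away a `dθ`. -/
theorem fourier_pow_mem {a : Matrix (Fin n) (Fin n) ℂ} (ha : a.IsSymm) {k : ℕ} (hk : k ≤ n) :
    fourier (((2 : ℂ) • mixedForm a) ^ k) ∈ bideg (fibreCov n) (baseCov n) (n - k) k := by
  induction k with
  | zero =>
    rw [pow_zero, fourier_one, bideg, pow_zero, mul_one, Nat.sub_zero]
    have := list_prod_mem_pow (M := (fibreCov n).map (ExteriorAlgebra.ι ℂ))
      (List.ofFn fun i => cov (unitVec (fi i))).reverse (by
        intro x hx
        rw [List.mem_reverse, List.mem_ofFn'] at hx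
        obtain ⟨i, rfl⟩ := hx
        exact ⟨_, unitVec_fi_mem i, rfl⟩)
    simpa using this
  | succ k ih =>
    have ih := ih (by omega)
    rw [show n - k = (n - (k + 1)) + 1 by omega] at ih
    rw [pow_succ', ← mixedForm_of_symm ha, smul_mul_assoc, smul_mul_assoc, Finset.sum_mul, map_smul,
      map_smul, map_sum]
    refine Submodule.smul_mem _ _ (Submodule.smul_mem _ _ (Submodule.sum_mem _ fun i _ => ?_))
    rw [Finset.sum_mul, map_sum]
    refine Submodule.sum_mem _ fun j _ => ?_
    rw [smul_mul_assoc, map_smul, mul_assoc, fourier_dz_mul, fourier_dzbar_mul, contract_smul,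
      mixedForm_of_symm ha]
    exact Submodule.smul_mem _ _ (Submodule.smul_mem _ _ (Submodule.smul_mem _ _
      (contract_mem_bideg (fun β hβ => baseCov_dotProduct hβ i)
        (cov_mul_mem_bideg (unitVec_bi_mem j) ih))))

theorem mixedForm_pow_succ (a : Matrix (Fin n) (Fin n) ℂ) : mixedForm a ^ (n + 1) = 0 := by
  rw [mixedForm_eq_sum_pairs]
  exact (sum_pairs_pow _ _).2

/-- The exponential series, transformed term by term, is already the decomposition into types;
powers beyond the `n`-th vanish. -/
theorem bidegProj_fourier_exp {a : Matrix (Fin n) (Fin n) ℂ} (ha : a.IsSymm) {k : ℕ} (hk : k ≤ n) :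
    bidegProj (fibreCov n) (baseCov n) (n - k) k
        (fourier (IsNilpotent.exp ((2 : ℂ) • mixedForm a))) =
      fourier ((k.factorial : ℂ)⁻¹ • ((2 : ℂ) • mixedForm a) ^ k) := by
  refine bidegProj_eq (f := rescale 3 2) (rescale_fibreCov 3 2) (rescale_baseCov 3 2) ?_ ?_
  · rw [map_smul]
    exact Submodule.smul_mem _ _ (fourier_pow_mem ha hk)
  · have h0 : ((2 : ℂ) • mixedForm a) ^ (n + 1) = 0 := by
      rw [smul_pow, mixedForm_pow_succ, smul_zero]
    rw [exp_eq_sum_smul h0, map_sum, ← Finset.sum_erase_add _ _ (Finset.mem_range.2 (by omega : k < n + 1)),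
      add_sub_cancel_right]
    refine Submodule.sum_mem _ fun j hj => ?_
    rw [Finset.mem_erase, Finset.mem_range] at hj
    rw [map_smul]
    refine Submodule.smul_mem _ _ (Submodule.mem_iSup_of_mem (n - j, j) (Submodule.mem_iSup_of_mem ?_
      (fourier_pow_mem ha (by omega))))
    intro h
    exact hj.1 (Prod.ext_iff.1 h).2

end MirrorComponents

/-! ### Pointwise SU(n) structures and the orthogonal complement of the fibres -/

section PointwiseSU

variable {n : ℕ}

/-- The base components of a complex tangent vector. -/
def basePart (u : Idx n → ℂ) : Fin n → ℂ := fun i => u (bi i)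

/-- The fibre components of a complex tangent vector. -/
def fibrePart (u : Idx n → ℂ) : Fin n → ℂ := fun i => u (fi i)

/-- The complex matrix with the entries of a real matrix. -/
def cmat (a : Matrix (Fin n) (Fin n) ℝ) : Matrix (Fin n) (Fin n) ℂ := a.map (fun x => (x : ℂ))

theorem cmat_mulVec (a : Matrix (Fin n) (Fin n) ℝ) (v : Fin n → ℝ) (i : Fin n) :
    (cmat a *ᵥ fun j => (v j : ℂ)) i = ((a *ᵥ v) i : ℝ) := by
  simp [cmat, Matrix.mulVec, dotProduct]

theorem cmat_mul (a b : Matrix (Fin n) (Fin n) ℝ) : cmat (a * b) = cmat a * cmat b := by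
  unfold cmat
  exact Matrix.map_mul (f := Complex.ofRealHom)

theorem cmat_one : cmat (1 : Matrix (Fin n) (Fin n) ℝ) = 1 := by
  unfold cmat
  exact Matrix.map_one _ Complex.ofReal_zero Complex.ofReal_one

theorem cmat_det (a : Matrix (Fin n) (Fin n) ℝ) : (cmat a).det = (a.det : ℂ) :=
  (Complex.ofRealHom.map_det a).symm

theorem cmat_symm {a : Matrix (Fin n) (Fin n) ℝ} (ha : a.IsSymm) : (cmat a).IsSymm :=
  ha.map _

theorem etaCov_dotProduct (b : Matrix (Fin n) (Fin n) ℂ) (i : Fin n) (u : Idx n → ℂ) :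
    etaCov b i ⬝ᵥ u = fibrePart u i + Complex.I * (b *ᵥ basePart u) i := by
  simp only [etaCov, add_dotProduct, sum_dotProduct, smul_dotProduct, unitVec_dotProduct]
  rfl

theorem etaCov_dual (b : Matrix (Fin n) (Fin n) ℂ) (i j : Fin n) :
    etaCov b i ⬝ᵥ unitVec (fi j) = if i = j then 1 else 0 := by
  rw [etaCov_dotProduct]
  have : basePart (unitVec (fi j) : Idx n → ℂ) = 0 := by
    ext k
    simp [basePart, unitVec_apply]
  simp [this, fibrePart, unitVec_apply]

theorem evalForm_two {ι : Type*} [Fintype ι] [LinearOrder ι] (φ : Ext ι) (u v : ι → ℂ) :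
    evalForm φ ![u, v] = ExteriorAlgebra.algebraMapInv (contract v (contract u φ)) := by
  simp [evalForm, List.ofFn_succ]

theorem evalForm_mixedForm (a : Matrix (Fin n) (Fin n) ℂ) (u v : Idx n → ℂ) :
    evalForm (mixedForm a) ![u, v] =
      fibrePart u ⬝ᵥ (a *ᵥ basePart v) - fibrePart v ⬝ᵥ (a *ᵥ basePart u) := by
  have hp : ∀ α β : Idx n → ℂ, ExteriorAlgebra.algebraMapInv (contract v (contract u (cov α * cov β))) =
      (α ⬝ᵥ u) * (β ⬝ᵥ v) - (α ⬝ᵥ v) * (β ⬝ᵥ u) := by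
    intro α β
    rw [contract_cov_mul, contract_cov, contract_sub, contract_smul, contract_cov, mul_smul_comm,
      mul_one, contract_smul, contract_cov]
    simp [mul_comm]
  have h : ∀ (i : Fin n) (w : Idx n → ℂ),
      (∑ j, a i j • unitVec (bi j)) ⬝ᵥ w = (a *ᵥ basePart w) i := by
    intro i w
    simp only [sum_dotProduct, smul_dotProduct, unitVec_dotProduct]
    rfl
  rw [evalForm_two, mixedForm_eq_sum_pairs, contract_sum, contract_sum, map_sum]
  simp only [hp, h, unitVec_dotProduct]
  rw [Finset.sum_sub_distrib]
  rfl

theorem conjForm_mixedForm (a : Matrix (Fin n) (Fin n) ℝ) :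
    conjForm (mixedForm (cmat a)) = mixedForm (cmat a) := by
  have hs : ∀ k : Idx n, star (unitVec k) = unitVec k := by
    intro k
    ext l
    simp only [Pi.star_apply, unitVec_apply]
    split_ifs <;> simp
  simp only [mixedForm, conjForm_sum, conjForm_smul, conjForm_mul, conjForm_cov, hs]
  simp [cmat]

section General

variable {ι : Type*} [Fintype ι] [LinearOrder ι]

theorem ιMulti_ne_zero_of_dual (ξ v : Fin n → ι → ℂ)
    (h : ∀ i j, ξ i ⬝ᵥ v j = if i = j then 1 else 0) : ExteriorAlgebra.ιMulti ℂ n ξ ≠ 0 := by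
  intro h0
  have := contractList_prod_of_dual ξ v h
  rw [ExteriorAlgebra.ιMulti_apply] at h0
  rw [show (List.ofFn fun i => cov (ξ i)).prod = 0 from h0, map_zero] at this
  exact zero_ne_one this

/-- If `u` contracts the volume form to zero, contracting the relation `ξ i ∧ Ω = 0` with `u` leaves
`ξ i (u) Ω = 0`. The dual vectors `v` ensure that `Ω` is nonzero. -/
theorem mem_T01_ιMulti (ξ v : Fin n → ι → ℂ) (h : ∀ i j, ξ i ⬝ᵥ v j = if i = j then 1 else 0)
    (u : ι → ℂ) : u ∈ T01 (ExteriorAlgebra.ιMulti ℂ n ξ) ↔ ∀ i, ξ i ⬝ᵥ u = 0 := by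
  change contract u _ = 0 ↔ _
  constructor
  · intro hu i
    have h1 : cov (ξ i) * ExteriorAlgebra.ιMulti ℂ n ξ = 0 := by
      rw [ExteriorAlgebra.ιMulti_apply]
      exact ExteriorAlgebra.ι_mul_prod_list _ i
    have h2 := congrArg (contract u) h1
    rw [contract_cov_mul, hu, mul_zero, sub_zero, contract_zero] at h2
    exact (smul_eq_zero.1 h2).resolve_right (ιMulti_ne_zero_of_dual ξ v h)
  · intro hu
    rw [ExteriorAlgebra.ιMulti_apply]
    clear h
    induction n with
    | zero => simp [contract_one]
    | succ n ih =>
      rw [List.ofFn_succ, List.prod_cons]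
      exact (contract_cov_mul _ _ _).trans (by
        rw [hu, ih (fun i => ξ i.succ) (fun i => v i.succ) fun i => hu _]; simp)

end General

/-- The form `η_(σ 1) ∧ … ∧ η_(σ n)`, `η i = dθ i + i ∑ b i j dr j`. -/
noncomputable def etaVol (b : Matrix (Fin n) (Fin n) ℝ) (σ : Equiv.Perm (Fin n)) : Ext (Idx n) :=
  ExteriorAlgebra.ιMulti ℂ n (etaCov (cmat b) ∘ σ)

theorem etaVol_dual (b : Matrix (Fin n) (Fin n) ℂ) (σ : Equiv.Perm (Fin n)) (i j : Fin n) :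
    (etaCov b ∘ σ) i ⬝ᵥ unitVec (fi (σ j)) = if i = j then 1 else 0 := by
  simp [etaCov_dual]

theorem mem_T01_etaVol (b : Matrix (Fin n) (Fin n) ℝ) (σ : Equiv.Perm (Fin n)) (u : Idx n → ℂ) :
    u ∈ T01 (etaVol b σ) ↔ fibrePart u = -Complex.I • (cmat b *ᵥ basePart u) := by
  rw [etaVol, mem_T01_ιMulti _ _ (etaVol_dual (cmat b) σ), σ.forall_congr_left]
  simp only [Function.comp_apply, Equiv.apply_symm_apply, etaCov_dotProduct]
  rw [funext_iff]
  refine forall_congr' fun i => ?_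
  rw [add_eq_zero_iff_eq_neg]
  simp

theorem mem_T10_etaVol (b : Matrix (Fin n) (Fin n) ℝ) (σ : Equiv.Perm (Fin n)) (u : Idx n → ℂ) :
    u ∈ T10 (etaVol b σ) ↔ fibrePart u = Complex.I • (cmat b *ᵥ basePart u) := by
  have h0 : u ∈ T10 (etaVol b σ) ↔ star u ∈ T01 (etaVol b σ) := Iff.rfl
  rw [h0, mem_T01_etaVol]
  have h1 : fibrePart (star u) = star (fibrePart u) := rfl
  have h2 : cmat b *ᵥ basePart (star u) = star (cmat b *ᵥ basePart u) := by
    ext i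
    simp [cmat, Matrix.mulVec, dotProduct, basePart]
  rw [h1, h2, ← star_inj]
  simp [star_smul]

/-- Real and imaginary parts of the equation of `T^(0,1)`. For singular `b` a suitable `w` may fail
to exist, and then `acs` is arbitrary at `v`; hence `acs_spec` asks for a solution. -/
theorem exists_acs_iff (b : Matrix (Fin n) (Fin n) ℝ) (σ : Equiv.Perm (Fin n)) (v w : Idx n → ℝ) :
    realVec v + Complex.I • realVec w ∈ T01 (etaVol b σ) ↔
      fib v = b *ᵥ base w ∧ fib w = -(b *ᵥ base v) := by
  rw [mem_T01_etaVol]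
  have h2 : cmat b *ᵥ basePart (realVec v + Complex.I • realVec w) =
      (fun i => ((b *ᵥ base v) i : ℂ)) + Complex.I • fun i => ((b *ᵥ base w) i : ℂ) := by
    have : basePart (realVec v + Complex.I • realVec w) =
      (fun i => ((base v i : ℝ) : ℂ)) + Complex.I • fun i => ((base w i : ℝ) : ℂ) := rfl
    rw [this, Matrix.mulVec_add, Matrix.mulVec_smul]
    ext i
    simp [cmat_mulVec]
  rw [h2, funext_iff, funext_iff, funext_iff, ← forall_and]
  refine forall_congr' fun i => ?_
  rw [Complex.ext_iff]
  simp [fibrePart, realVec, fib]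

theorem acs_spec {b : Matrix (Fin n) (Fin n) ℝ} {σ : Equiv.Perm (Fin n)} {v w : Idx n → ℝ}
    (h1 : fib v = b *ᵥ base w) (h2 : fib w = -(b *ᵥ base v)) :
    fib v = b *ᵥ base (acs (etaVol b σ) v) ∧ fib (acs (etaVol b σ) v) = -(b *ᵥ base v) := by
  have h : ∃ w, realVec v + Complex.I • realVec w ∈ T01 (etaVol b σ) :=
    ⟨w, (exists_acs_iff b σ v w).2 ⟨h1, h2⟩⟩
  exact (exists_acs_iff b σ v _).1 (Classical.epsilon_spec h)

theorem evalForm_mixedForm_real (a : Matrix (Fin n) (Fin n) ℝ) (u v : Idx n → ℝ) :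
    evalForm (mixedForm (cmat a)) ![realVec u, realVec v] =
      ((fib u ⬝ᵥ (a *ᵥ base v) - fib v ⬝ᵥ (a *ᵥ base u) : ℝ) : ℂ) := by
  rw [evalForm_mixedForm]
  have h : ∀ w : Idx n → ℝ, cmat a *ᵥ basePart (realVec w) = fun i => ((a *ᵥ base w) i : ℂ) := by
    intro w
    ext i
    exact cmat_mulVec a (base w) i
  rw [h, h]
  simp [fibrePart, realVec, fib, dotProduct]

/-- Positive definiteness of a real matrix. -/
def IsPos (a : Matrix (Fin n) (Fin n) ℝ) : Prop := ∀ x, x ≠ 0 → 0 < x ⬝ᵥ (a *ᵥ x)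

theorem IsPos.det_ne_zero {a : Matrix (Fin n) (Fin n) ℝ} (ha : IsPos a) : a.det ≠ 0 := by
  intro h
  obtain ⟨v, hv, hav⟩ := Matrix.exists_mulVec_eq_zero_iff.2 h
  have := ha v hv
  rw [hav, dotProduct_zero] at this
  exact this.false

@[simp] theorem base_pt (r θ : Fin n → ℝ) : base (pt r θ) = r := rfl

@[simp] theorem fib_pt (r θ : Fin n → ℝ) : fib (pt r θ) = θ := rfl

theorem pt_base_fib (p : Idx n → ℝ) : pt (base p) (fib p) = p := by
  ext k
  induction k using idx_cases with
  | hb i => rfl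
  | hf i => rfl

theorem idx_ext {p q : Idx n → ℝ} (h : base p = base q) (h' : fib p = fib q) : p = q := by
  rw [← pt_base_fib p, ← pt_base_fib q, h, h']

/-- Every tangent vector has an image under the almost complex structure when `b` is invertible. -/
theorem acs_spec_of_det {b : Matrix (Fin n) (Fin n) ℝ} (hb : b.det ≠ 0) (σ : Equiv.Perm (Fin n))
    (v : Idx n → ℝ) :
    fib v = b *ᵥ base (acs (etaVol b σ) v) ∧ fib (acs (etaVol b σ) v) = -(b *ᵥ base v) := by
  refine acs_spec (w := pt (b⁻¹ *ᵥ fib v) (-(b *ᵥ base v))) ?_ rfl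
  rw [base_pt, Matrix.mulVec_mulVec, Matrix.mul_nonsing_inv _ (isUnit_iff_ne_zero.2 hb),
    Matrix.one_mulVec]

theorem dotProduct_mulVec_comm {a : Matrix (Fin n) (Fin n) ℝ} (ha : a.IsSymm) (x y : Fin n → ℝ) :
    x ⬝ᵥ (a *ᵥ y) = y ⬝ᵥ (a *ᵥ x) := by
  rw [Matrix.dotProduct_mulVec, ← Matrix.mulVec_transpose, ha, dotProduct_comm]

theorem metric_etaVol {a b : Matrix (Fin n) (Fin n) ℝ} (hb : b.det ≠ 0) (σ : Equiv.Perm (Fin n))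
    (u v : Idx n → ℝ) : metric (mixedForm (cmat a)) (etaVol b σ) u v =
      ((fib u ⬝ᵥ (a *ᵥ base (acs (etaVol b σ) v)) + (b *ᵥ base v) ⬝ᵥ (a *ᵥ base u) : ℝ) : ℂ) := by
  rw [metric, evalForm_mixedForm_real, (acs_spec_of_det hb σ v).2, neg_dotProduct, sub_neg_eq_add]

/-- For invertible `b`, the metric at `(u, v)` is the bilinear form of `a b` on the base parts of
`u, v` plus the same form on the base parts of `J u, J v`, so `a b` decides symmetry and positivity.
On `T^(1,0)` and `T^(0,1)` the fibre part is `± i b` times the base part, and symmetry of `a b`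
gives type `(1, 1)`. The splitting and nondegeneracy come from invertibility of `b` and `a`. -/
theorem isSUAt_etaVol_iff {a b : Matrix (Fin n) (Fin n) ℝ} (ha : a.IsSymm) (hb : b.IsSymm)
    (hab : b * a = a * b) (σ : Equiv.Perm (Fin n)) :
    IsSUAt n (mixedForm (cmat a)) (etaVol b σ) ↔ IsPos (a * b) := by
  have hmul : ∀ x y : Fin n → ℝ, (b *ᵥ x) ⬝ᵥ (a *ᵥ y) = x ⬝ᵥ ((a * b) *ᵥ y) := by
    intro x y
    rw [← hab, ← Matrix.mulVec_mulVec, dotProduct_comm, dotProduct_mulVec_comm hb]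
  have hsymm : (a * b).IsSymm := by
    rw [Matrix.IsSymm, Matrix.transpose_mul, ha, hb, hab]
  constructor
  · intro h x hx
    -- Here `b` is not known to be invertible, but a pure base vector has an explicit image under
    -- `J`. The metric on it is `x · (a b) x`.
    have hacs := acs_spec (σ := σ) (v := pt x 0) (w := pt 0 (-(b *ᵥ x))) (b := b) (by simp) (by simp)
    have hpos := h.metric_pos (pt x 0) (fun h0 => hx (by rw [← base_pt x 0, h0]; rfl))
    rw [metric, evalForm_mixedForm_real, hacs.2, Complex.ofReal_re] at hpos
    simpa [hmul] using hpos
  · intro h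
    have hdet : a.det * b.det ≠ 0 := by
      rw [← Matrix.det_mul]
      exact h.det_ne_zero
    have hda : a.det ≠ 0 := left_ne_zero_of_mul hdet
    have hdb : b.det ≠ 0 := right_ne_zero_of_mul hdet
    have hua : IsUnit (cmat a).det := by
      rw [cmat_det]
      exact isUnit_iff_ne_zero.2 (Complex.ofReal_ne_zero.2 hda)
    have hub : IsUnit (cmat b).det := by
      rw [cmat_det]
      exact isUnit_iff_ne_zero.2 (Complex.ofReal_ne_zero.2 hdb)
    have hca := cmat_symm ha
    have hcomm : ∀ x y : Fin n → ℂ, (cmat b *ᵥ x) ⬝ᵥ (cmat a *ᵥ y) = (cmat b *ᵥ y) ⬝ᵥ (cmat a *ᵥ x) := by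
      intro x y
      have hs : (cmat a * cmat b).IsSymm := by
        rw [← cmat_mul]
        exact cmat_symm hsymm
      have hba : cmat b * cmat a = cmat a * cmat b := by rw [← cmat_mul, ← cmat_mul, hab]
      have hm : ∀ x y : Fin n → ℂ, (cmat b *ᵥ x) ⬝ᵥ (cmat a *ᵥ y) = x ⬝ᵥ ((cmat a * cmat b) *ᵥ y) := by
        intro x y
        rw [← hba, ← Matrix.mulVec_mulVec, Matrix.dotProduct_mulVec x, ← Matrix.mulVec_transpose,
          cmat_symm hb]
      rw [hm, hm, Matrix.dotProduct_mulVec, ← Matrix.mulVec_transpose, hs, dotProduct_comm]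
    have hmet : ∀ u v, metric (mixedForm (cmat a)) (etaVol b σ) u v =
        ((base (acs (etaVol b σ) u) ⬝ᵥ ((a * b) *ᵥ base (acs (etaVol b σ) v)) +
          base v ⬝ᵥ ((a * b) *ᵥ base u) : ℝ) : ℂ) := by
      intro u v
      rw [metric_etaVol hdb, hmul, (acs_spec_of_det hdb σ u).1, hmul]
    refine ⟨⟨_, rfl⟩, ιMulti_ne_zero_of_dual _ _ (etaVol_dual _ σ), ?_, mixedForm_mem _,
      conjForm_mixedForm a, ⟨?_, ?_⟩, ?_, ?_, ?_⟩
    · rw [isCompl_iff, Submodule.disjoint_def, codisjoint_iff, Submodule.eq_top_iff']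
      constructor
      · intro u h1 h2
        rw [mem_T10_etaVol] at h1
        rw [mem_T01_etaVol, h1, neg_smul, eq_neg_iff_add_eq_zero, ← two_smul ℂ] at h2
        have h3 : cmat b *ᵥ basePart u = 0 := by
          rw [smul_smul] at h2
          exact (smul_eq_zero.1 h2).resolve_left (by simp)
        have h4 : basePart u = 0 := by
          rw [← Matrix.one_mulVec (basePart u), ← Matrix.nonsing_inv_mul _ hub,
            ← Matrix.mulVec_mulVec, h3, Matrix.mulVec_zero]
        rw [h3, smul_zero] at h1
        ext k
        induction k using idx_cases with
        | hb i => exact congrFun h4 i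
        | hf i => exact congrFun h1 i
      · intro u
        -- If `x'` and `x''` are the base parts of the two components, then `x' + x''` is the base
        -- part of `u` and `i b (x' - x'')` its fibre part; `y` is the resulting value of `x' -
        -- x''`.
        let y : Fin n → ℂ := -Complex.I • ((cmat b)⁻¹ *ᵥ fibrePart u)
        let mk : (Fin n → ℂ) → (Fin n → ℂ) → Idx n → ℂ := fun x z k => Sum.elim x z (ofLex k)
        have hy : Complex.I • (cmat b *ᵥ y) = fibrePart u := by
          simp only [y]
          rw [Matrix.mulVec_smul, Matrix.mulVec_mulVec, Matrix.mul_nonsing_inv _ hub,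
            Matrix.one_mulVec, smul_smul]
          simp
        rw [Submodule.mem_sup]
        refine ⟨mk ((1 / 2 : ℂ) • (basePart u + y)) (Complex.I • (cmat b *ᵥ ((1 / 2 : ℂ) • (basePart u + y)))),
          (mem_T10_etaVol _ _ _).2 rfl,
          mk ((1 / 2 : ℂ) • (basePart u - y)) (-Complex.I • (cmat b *ᵥ ((1 / 2 : ℂ) • (basePart u - y)))),
          (mem_T01_etaVol _ _ _).2 rfl, ?_⟩
        ext k
        induction k using idx_cases with
        | hb i =>
          change ((1 / 2 : ℂ) • (basePart u + y)) i + ((1 / 2 : ℂ) • (basePart u - y)) i = basePart u i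
          simp
          ring
        | hf i =>
          change (Complex.I • (cmat b *ᵥ ((1 / 2 : ℂ) • (basePart u + y)))) i +
            (-Complex.I • (cmat b *ᵥ ((1 / 2 : ℂ) • (basePart u - y)))) i = fibrePart u i
          rw [← hy]
          simp only [Matrix.mulVec_smul, Matrix.mulVec_add, Matrix.mulVec_sub, Pi.smul_apply,
            Pi.add_apply, Pi.sub_apply, smul_eq_mul]
          ring
    · intro u hu v hv
      rw [mem_T10_etaVol] at hu hv
      rw [evalForm_mixedForm, hu, hv, smul_dotProduct, smul_dotProduct, hcomm, sub_self]
    · intro u hu v hv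
      rw [mem_T01_etaVol] at hu hv
      rw [evalForm_mixedForm, hu, hv, smul_dotProduct, smul_dotProduct, hcomm, sub_self]
    · intro u hu
      have h0 : ∀ v, fibrePart u ⬝ᵥ (cmat a *ᵥ basePart v) - fibrePart v ⬝ᵥ (cmat a *ᵥ basePart u) = 0 := by
        intro v
        rw [← evalForm_mixedForm, evalForm_two, hu, contract_zero, map_zero]
      have h1 : cmat a *ᵥ basePart u = 0 := by
        ext i
        have := h0 (unitVec (fi i))
        have e1 : basePart (unitVec (fi i) : Idx n → ℂ) = 0 := by
          ext k
          simp [basePart, unitVec_apply]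
        have e2 : fibrePart (unitVec (fi i) : Idx n → ℂ) = Pi.single i 1 := by
          ext k
          simp [fibrePart, unitVec_apply, Pi.single_apply]
        rw [e1, e2, Matrix.mulVec_zero, dotProduct_zero, zero_sub, neg_eq_zero,
          single_one_dotProduct] at this
        exact this
      have h2 : cmat a *ᵥ fibrePart u = 0 := by
        ext i
        have := h0 (unitVec (bi i))
        have e1 : fibrePart (unitVec (bi i) : Idx n → ℂ) = 0 := by
          ext k
          simp [fibrePart, unitVec_apply]
        have e2 : basePart (unitVec (bi i) : Idx n → ℂ) = Pi.single i 1 := by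
          ext k
          simp [basePart, unitVec_apply, Pi.single_apply]
        rw [e1, e2, zero_dotProduct, sub_zero, Matrix.dotProduct_mulVec, ← Matrix.mulVec_transpose, hca,
          dotProduct_single_one] at this
        exact this
      have hinj : ∀ x : Fin n → ℂ, cmat a *ᵥ x = 0 → x = 0 := by
        intro x hx
        rw [← Matrix.one_mulVec x, ← Matrix.nonsing_inv_mul _ hua, ← Matrix.mulVec_mulVec, hx,
          Matrix.mulVec_zero]
      ext k
      induction k using idx_cases with
      | hb i => exact congrFun (hinj _ h1) i
      | hf i => exact congrFun (hinj _ h2) i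
    · intro u v
      rw [hmet, hmet, dotProduct_mulVec_comm hsymm, dotProduct_mulVec_comm hsymm (base u)]
    · intro u hu
      rw [hmet, Complex.ofReal_re]
      have hnn : ∀ x : Fin n → ℝ, 0 ≤ x ⬝ᵥ ((a * b) *ᵥ x) := by
        intro x
        rcases eq_or_ne x 0 with rfl | hx
        · simp
        · exact (h x hx).le
      -- The base parts of `u` and `J u` cannot both vanish, because `b` maps the latter to the
      -- fibre part of `u`.
      by_cases h1 : base u = 0
      · refine add_pos_of_pos_of_nonneg (h _ fun h2 => hu ?_) (hnn _)
        refine idx_ext h1 ?_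
        rw [(acs_spec_of_det hdb σ u).1, h2, Matrix.mulVec_zero]
        rfl
      · exact add_pos_of_nonneg_of_pos (hnn _) (h _ h1)

/-! ### The polarization by the fibres -/

/-- The product of a fibre vector `u` with `v` pairs the fibre part of `u` with the base part of `J
v`, which vanishes exactly when the fibre part of `v` does. The complement is thus independent of
`b`, and the polarization type simply counts the factors `dθ` and `dr`. -/
theorem perp_fibre {b : Matrix (Fin n) (Fin n) ℝ} (hb : b.det ≠ 0) (σ : Equiv.Perm (Fin n)) :
    perp (mixedForm (cmat 1)) (etaVol b σ)
      (Submodule.span ℝ (Set.range fun i : Fin n => realUnitVec (fi i))) = {v | fib v = 0} := by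
  ext v
  have key : ∀ u, base u = 0 → metric (mixedForm (cmat 1)) (etaVol b σ) u v =
      ((fib u ⬝ᵥ base (acs (etaVol b σ) v) : ℝ) : ℂ) := by
    intro u hu
    rw [metric_etaVol hb, hu, Matrix.one_mulVec, Matrix.mulVec_zero, dotProduct_zero, add_zero]
  have hunit : ∀ i, base (realUnitVec (fi i) : Idx n → ℝ) = 0 := fun i => by
    ext k
    simp [base, realUnitVec]
  have hspan : ∀ u ∈ Submodule.span ℝ (Set.range fun i : Fin n => (realUnitVec (fi i) : Idx n → ℝ)),
      base u = 0 := by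
    intro u hu
    induction hu using Submodule.span_induction with
    | mem x hx =>
      obtain ⟨i, rfl⟩ := hx
      exact hunit i
    | zero => rfl
    | add x y _ _ hx hy =>
      change base x + base y = 0
      rw [hx, hy, add_zero]
    | smul c x _ hx =>
      change c • base x = 0
      rw [hx, smul_zero]
  have hv := acs_spec_of_det hb σ v
  constructor
  · intro h
    have h1 : base (acs (etaVol b σ) v) = 0 := by
      ext i
      have h2 := h _ (Submodule.subset_span ⟨i, rfl⟩)
      simp only at h2
      rw [key _ (hunit i), Complex.ofReal_eq_zero] at h2
      have e : fib (realUnitVec (fi i) : Idx n → ℝ) = Pi.single i 1 := by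
        ext k
        simp [fib, realUnitVec, Pi.single_apply]
      rwa [e, single_one_dotProduct] at h2
    change fib v = 0
    rw [hv.1, h1, Matrix.mulVec_zero]
  · intro h u hu
    have h1 : base (acs (etaVol b σ) v) = 0 := by
      have h2 : b *ᵥ base (acs (etaVol b σ) v) = 0 := hv.1.symm.trans h
      rw [← Matrix.one_mulVec (base _), ← Matrix.nonsing_inv_mul _ (isUnit_iff_ne_zero.2 hb),
        ← Matrix.mulVec_mulVec, h2, Matrix.mulVec_zero]
    rw [key u (hspan u hu), h1, dotProduct_zero, Complex.ofReal_zero]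

theorem realVec_realUnitVec (k : Idx n) : realVec (realUnitVec k) = unitVec k := by
  ext l
  simp [realVec, realUnitVec, unitVec, Pi.single_apply, apply_ite]

theorem annih_perp_fibre : annih {v : Idx n → ℝ | fib v = 0} = fibreCov n := by
  ext α
  constructor
  · intro h i
    have := h (realUnitVec (bi i)) (by ext k; simp [fib, realUnitVec])
    rwa [realVec_realUnitVec, dotProduct_comm, unitVec_dotProduct] at this
  · intro h v hv
    rw [dotProduct, sum_idx, Finset.sum_eq_zero fun i _ => by rw [h i, zero_mul], zero_add]
    refine Finset.sum_eq_zero fun i _ => ?_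
    have : v (fi i) = 0 := congrFun hv i
    simp [realVec, this]

theorem annih_fibre :
    annih (Submodule.span ℝ (Set.range fun i : Fin n => (realUnitVec (fi i) : Idx n → ℝ)) :
      Set (Idx n → ℝ)) = baseCov n := by
  ext α
  constructor
  · intro h i
    have := h (realUnitVec (fi i)) (Submodule.subset_span ⟨i, rfl⟩)
    rwa [realVec_realUnitVec, dotProduct_comm, unitVec_dotProduct] at this
  · intro h v hv
    induction hv using Submodule.span_induction with
    | mem x hx =>
      obtain ⟨i, rfl⟩ := hx
      rw [realVec_realUnitVec]
      exact baseCov_dotProduct h i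
    | zero => simp [realVec, dotProduct]
    | add x y _ _ hx hy =>
      have : realVec (x + y) = realVec x + realVec y := by ext; simp [realVec]
      rw [this, dotProduct_add, hx, hy, add_zero]
    | smul c x _ hx =>
      have : realVec (c • x) = (c : ℂ) • realVec x := by ext; simp [realVec]
      rw [this, dotProduct_smul, hx, smul_zero]

end PointwiseSU

/-! ### Volume forms and determinants -/

section Volumes

variable {n : ℕ}

theorem etaVol_eq (b : Matrix (Fin n) (Fin n) ℝ) (σ : Equiv.Perm (Fin n)) :
    etaVol b σ = ((Equiv.Perm.sign σ : ℤ) : ℂ) • ExteriorAlgebra.ιMulti ℂ n (etaCov (cmat b)) := by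
  rw [etaVol, AlternatingMap.map_perm, Units.smul_def, Int.cast_smul_eq_zsmul]

theorem etaVol_revPerm (b : Matrix (Fin n) (Fin n) ℝ) :
    (List.ofFn fun i => cov (etaCov (cmat b) i)).reverse.prod = etaVol b Fin.revPerm := by
  rw [reverse_prod_eq, etaVol_eq]
  rfl

theorem etaVol_one : etaVol (1 : Matrix (Fin n) (Fin n) ℝ) 1 = ExteriorAlgebra.ιMulti ℂ n dz := by
  rw [etaVol, cmat_one, etaCov_one]
  rfl

/-- The form `dθ 1 ∧ … ∧ dθ n ∧ dr 1 ∧ … ∧ dr n`. -/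
noncomputable def topForm (n : ℕ) : Ext (Idx n) :=
  ExteriorAlgebra.ιMulti ℂ n (fun i => unitVec (fi i)) *
    ExteriorAlgebra.ιMulti ℂ n (fun i => unitVec (bi i))

theorem topForm_ne_zero : topForm n ≠ 0 := by
  rw [topForm, ExteriorAlgebra.ιMulti_mul_ιMulti]
  refine ιMulti_ne_zero_of_dual _
    (Fin.append (fun i : Fin n => unitVec (fi i)) (fun i : Fin n => unitVec (bi i))) ?_
  intro i j
  induction i using Fin.addCases with
  | left i =>
    induction j using Fin.addCases with
    | left j =>
      simp only [Fin.append_left, unitVec_dotProduct, unitVec_apply, fi_inj, Fin.castAdd_inj]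
    | right j =>
      have h : Fin.castAdd n i ≠ Fin.natAdd n j := fun h => by
        have := congrArg Fin.val h
        simp only [Fin.val_castAdd, Fin.val_natAdd] at this
        omega
      simp only [Fin.append_left, Fin.append_right, unitVec_dotProduct, unitVec_apply, fi_ne_bi, h,
        if_false]
  | right i =>
    induction j using Fin.addCases with
    | left j =>
      have h : Fin.natAdd n i ≠ Fin.castAdd n j := fun h => by
        have := congrArg Fin.val h
        simp only [Fin.val_castAdd, Fin.val_natAdd] at this
        omega
      simp only [Fin.append_left, Fin.append_right, unitVec_dotProduct, unitVec_apply, bi_ne_fi, h,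
        if_false]
    | right j =>
      simp only [Fin.append_right, unitVec_dotProduct, unitVec_apply, bi_inj, Fin.natAdd_inj]

theorem mixedForm_pow (b : Matrix (Fin n) (Fin n) ℂ) :
    mixedForm b ^ n = ((n.factorial : ℂ) * revSign n * b.det) • topForm n := by
  rw [mixedForm_eq_sum_pairs, (sum_pairs_pow _ _).1, ← prod_mul_reverse_prod, reverse_prod_eq,
    ιMulti_matrix, topForm, ExteriorAlgebra.ιMulti_apply (v := fun i => unitVec (fi i)),
    ← nsmul_eq_mul, ← Nat.cast_smul_eq_nsmul ℂ, mul_smul_comm, mul_smul_comm, smul_smul, smul_smul]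

variable (n) in
/-- The constant in the conformal factor of the standard structure. -/
noncomputable def confConst : ℝ := ((Equiv.Perm.sign (Fin.revPerm : Equiv.Perm (Fin n)) : ℤ) : ℝ) * (-2) ^ n

theorem confConst_cast : (confConst n : ℂ) = revSign n * (-2) ^ n := by
  simp [confConst, revSign]

theorem confConst_sq : confConst n * confConst n = 2 ^ (2 * n) := by
  have h : (confConst n : ℂ) * confConst n = ((2 ^ (2 * n) : ℝ) : ℂ) := by
    rw [confConst_cast, mul_mul_mul_comm, revSign_mul_self, one_mul, ← mul_pow, pow_mul]
    norm_num
  exact_mod_cast h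

theorem confConst_ne_zero : confConst n ≠ 0 := fun h => by
  have := confConst_sq (n := n)
  rw [h, mul_zero] at this
  exact (pow_ne_zero _ two_ne_zero) this.symm

/-- The substitution `dθ i ↦ dθ i`, `dr i ↦ ∑ b i j dr j`. -/
noncomputable def baseSubst (b : Matrix (Fin n) (Fin n) ℂ) : Ext (Idx n) →ₐ[ℂ] Ext (Idx n) :=
  extHom fun k => Sum.elim (fun i => ∑ j, b i j • unitVec (bi j)) (fun i => unitVec (fi i)) (ofLex k)

theorem baseSubst_fi (b : Matrix (Fin n) (Fin n) ℂ) (i : Fin n) :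
    baseSubst b (cov (unitVec (fi i))) = cov (unitVec (fi i)) := by
  unfold baseSubst
  rw [extHom_unitVec]
  rfl

theorem baseSubst_bi (b : Matrix (Fin n) (Fin n) ℂ) (i : Fin n) :
    baseSubst b (cov (unitVec (bi i))) = cov (∑ j, b i j • unitVec (bi j)) := by
  unfold baseSubst
  rw [extHom_unitVec]
  rfl

theorem star_unitVec (k : Idx n) : star (unitVec k) = unitVec k := by
  ext l
  simp only [Pi.star_apply, unitVec_apply]
  split_ifs <;> simp

theorem star_etaCov (b : Matrix (Fin n) (Fin n) ℝ) (i : Fin n) :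
    star (etaCov (cmat b) i) =
      unitVec (fi i) - Complex.I • ∑ j, cmat b i j • unitVec (bi j) := by
  simp [etaCov, star_smul, star_unitVec, cmat, sub_eq_add_neg]

/-- Each `η i ∧ conj (η i)` equals `-2i dθ i ∧ ∑ b i j dr j`, and collecting the `dr` factors
produces `det b`. -/
theorem prod_etaCov_mul_conj (b : Matrix (Fin n) (Fin n) ℝ) :
    (List.ofFn fun i => cov (etaCov (cmat b) i) * cov (star (etaCov (cmat b) i))).prod =
      (-2 * Complex.I) ^ n • revSign n • (cmat b).det • topForm n := by
  have h1 : ∀ i, cov (etaCov (cmat b) i) * cov (star (etaCov (cmat b) i)) =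
      (-2 * Complex.I) • baseSubst (cmat b) (cov (unitVec (fi i)) * cov (unitVec (bi i))) := by
    intro i
    rw [star_etaCov, etaCov, map_mul, baseSubst_fi, baseSubst_bi]
    simp only [cov_add, cov_sub, cov_smul, add_mul, mul_sub, smul_mul_assoc, mul_smul_comm,
      cov_mul_self, smul_zero]
    rw [cov_mul_comm (∑ j, _) (unitVec (fi i)), zero_add, add_zero, smul_neg, sub_eq_add_neg, ← neg_add,
      ← two_smul ℂ, smul_smul, ← neg_smul, neg_mul]
  have h2 : (List.ofFn fun i => cov (etaCov (cmat b) i) * cov (star (etaCov (cmat b) i))).prod =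
      (-2 * Complex.I) ^ n • (List.ofFn fun i : Fin n =>
        baseSubst (cmat b) (cov (unitVec (fi i)) * cov (unitVec (bi i)))).prod := by
    have key : ∀ (m : ℕ) (c : ℂ) (f : Fin m → Ext (Idx n)),
        (List.ofFn fun i => c • f i).prod = c ^ m • (List.ofFn f).prod := by
      intro m c f
      induction m with
      | zero => simp
      | succ m ih =>
        rw [List.ofFn_succ, List.ofFn_succ, List.prod_cons, List.prod_cons, ih, smul_mul_smul_comm,
          pow_succ']
    simp only [h1]
    exact key _ _ _
  have h3 : (List.ofFn fun i : Fin n =>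
      baseSubst (cmat b) (cov (unitVec (fi i)) * cov (unitVec (bi i)))).prod =
        revSign n • (cmat b).det • topForm n := by
    simp only [map_mul, baseSubst_fi, baseSubst_bi]
    rw [← prod_mul_reverse_prod, reverse_prod_eq, ιMulti_matrix, topForm,
      ExteriorAlgebra.ιMulti_apply (v := fun i => unitVec (fi i)), mul_smul_comm, mul_smul_comm]
  rw [h2, h3]

/-- The order of the factors does not matter, since the sign of `σ` enters twice. The power of
`mixedForm 1` serves as the common unit of top-degree forms on both bundles. -/
theorem etaVol_mul_conj (b : Matrix (Fin n) (Fin n) ℝ) (σ : Equiv.Perm (Fin n)) :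
    etaVol b σ * conjForm (etaVol b σ) =
      (Complex.I ^ n * ((confConst n * b.det : ℝ) : ℂ) / (n.factorial : ℂ)) •
        mixedForm (cmat (1 : Matrix (Fin n) (Fin n) ℝ)) ^ n := by
  have hs : ((Equiv.Perm.sign σ : ℤ) : ℂ) * ((Equiv.Perm.sign σ : ℤ) : ℂ) = 1 := by
    rw [← Int.cast_mul, ← Units.val_mul, Int.units_mul_self]
    simp
  rw [etaVol_eq, conjForm_smul, conjForm_ιMulti, smul_mul_smul_comm]
  have h1 : starRingEnd ℂ ((Equiv.Perm.sign σ : ℤ) : ℂ) = ((Equiv.Perm.sign σ : ℤ) : ℂ) := by simp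
  rw [h1, hs, one_smul]
  have h2 : ExteriorAlgebra.ιMulti ℂ n (fun i => star (etaCov (cmat b) i)) =
      revSign n • (List.ofFn fun i => cov (star (etaCov (cmat b) i))).reverse.prod := by
    rw [reverse_prod_eq, smul_smul, revSign_mul_self, one_smul]
  rw [h2, mul_smul_comm, ExteriorAlgebra.ιMulti_apply]
  have h3 := prod_mul_reverse_prod (etaCov (cmat b)) fun i => star (etaCov (cmat b) i)
  rw [prod_etaCov_mul_conj] at h3
  have hn : (n.factorial : ℂ) ≠ 0 := Nat.cast_ne_zero.2 n.factorial_ne_zero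
  rw [h3, mixedForm_pow, cmat_one, Matrix.det_one, smul_smul, smul_smul, smul_smul, smul_smul, cmat_det,
    Complex.ofReal_mul, confConst_cast, mul_comm (-2) Complex.I, mul_pow]
  congr 1
  field_simp

theorem mixedForm_cmat_pow (a : Matrix (Fin n) (Fin n) ℝ) : mixedForm (cmat a) ^ n =
    (a.det : ℂ) • mixedForm (cmat (1 : Matrix (Fin n) (Fin n) ℝ)) ^ n := by
  rw [mixedForm_pow, mixedForm_pow, cmat_det, cmat_det, Matrix.det_one, smul_smul]
  congr 1
  push_cast
  ring

theorem mixedForm_one_pow_ne_zero : mixedForm (cmat (1 : Matrix (Fin n) (Fin n) ℝ)) ^ n ≠ 0 := by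
  rw [mixedForm_pow, cmat_one, Matrix.det_one, mul_one]
  exact smul_ne_zero (mul_ne_zero (Nat.cast_ne_zero.2 n.factorial_ne_zero) (revSign_ne_zero n))
    topForm_ne_zero

end Volumes

/-! ### Pull-back under block-diagonal linear maps -/

section Pullback

variable {n : ℕ}

/-- The linear map `(v, w) ↦ (A v, D w)` on base and fibre components. -/
noncomputable def blockMap (A D : Matrix (Fin n) (Fin n) ℝ) : (Idx n → ℝ) →L[ℝ] (Idx n → ℝ) :=
  LinearMap.toContinuousLinearMap
    { toFun := fun p => pt (A *ᵥ base p) (D *ᵥ fib p)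
      map_add' := fun p q => by
        refine idx_ext ?_ ?_
        · exact Matrix.mulVec_add A (base p) (base q)
        · exact Matrix.mulVec_add D (fib p) (fib q)
      map_smul' := fun c p => by
        refine idx_ext ?_ ?_
        · exact Matrix.mulVec_smul A c (base p)
        · exact Matrix.mulVec_smul D c (fib p) }

theorem blockMap_apply (A D : Matrix (Fin n) (Fin n) ℝ) (p : Idx n → ℝ) :
    blockMap A D p = pt (A *ᵥ base p) (D *ᵥ fib p) := rfl

@[simp] theorem base_realUnitVec_bi (i : Fin n) :
    base (realUnitVec (bi i) : Idx n → ℝ) = Pi.single i 1 := by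
  ext k
  simp [base, realUnitVec, Pi.single_apply]

@[simp] theorem base_realUnitVec_fi (i : Fin n) : base (realUnitVec (fi i) : Idx n → ℝ) = 0 := by
  ext k
  simp [base, realUnitVec]

@[simp] theorem fib_realUnitVec_fi (i : Fin n) :
    fib (realUnitVec (fi i) : Idx n → ℝ) = Pi.single i 1 := by
  ext k
  simp [fib, realUnitVec, Pi.single_apply]

@[simp] theorem fib_realUnitVec_bi (i : Fin n) : fib (realUnitVec (bi i) : Idx n → ℝ) = 0 := by
  ext k
  simp [fib, realUnitVec]

theorem pullLin_bi (A D : Matrix (Fin n) (Fin n) ℝ) (i : Fin n) :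
    pullLin (blockMap A D) (cov (unitVec (bi i))) = cov (∑ j, cmat A i j • unitVec (bi j)) := by
  unfold pullLin
  rw [extHom_unitVec]
  congr 1
  ext k
  have h : (blockMap A D (realUnitVec k)) (bi i) = (A *ᵥ base (realUnitVec k)) i := rfl
  rw [h]
  induction k using idx_cases with
  | hb j => simp [Finset.sum_apply, unitVec_apply, cmat]
  | hf j => simp [Finset.sum_apply, unitVec_apply, cmat]

theorem pullLin_fi (A D : Matrix (Fin n) (Fin n) ℝ) (i : Fin n) :
    pullLin (blockMap A D) (cov (unitVec (fi i))) = cov (∑ j, cmat D i j • unitVec (fi j)) := by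
  unfold pullLin
  rw [extHom_unitVec]
  congr 1
  ext k
  have h : (blockMap A D (realUnitVec k)) (fi i) = (D *ᵥ fib (realUnitVec k)) i := rfl
  rw [h]
  induction k using idx_cases with
  | hb j => simp [Finset.sum_apply, unitVec_apply, cmat]
  | hf j => simp [Finset.sum_apply, unitVec_apply, cmat]

theorem pullLin_mixedForm (A D : Matrix (Fin n) (Fin n) ℝ) (a : Matrix (Fin n) (Fin n) ℝ) :
    pullLin (blockMap A D) (mixedForm (cmat a)) = mixedForm (cmat (Dᵀ * a * A)) := by
  have h : mixedForm (cmat (Dᵀ * a * A)) = ∑ k, ∑ l, ∑ i, ∑ j,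
      (cmat D i k * cmat a i j * cmat A j l) • (cov (unitVec (fi k)) * cov (unitVec (bi l))) := by
    simp only [mixedForm, ← Finset.sum_smul]
    refine Finset.sum_congr rfl fun k _ => Finset.sum_congr rfl fun l _ => ?_
    congr 1
    simp only [cmat, Matrix.map_apply, Matrix.mul_apply, Matrix.transpose_apply, Finset.sum_mul]
    push_cast
    rw [Finset.sum_comm]
  rw [h]
  simp only [mixedForm, map_sum, map_smul, map_mul, pullLin_fi, pullLin_bi, Finset.sum_mul_sum, smul_mul_smul_comm, Finset.smul_sum, smul_smul]
  calc _ = ∑ i, ∑ j, ∑ k, ∑ l, (cmat D i k * cmat a i j * cmat A j l) •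
        (cov (unitVec (fi k)) * cov (unitVec (bi l))) := by
        refine Finset.sum_congr rfl fun i _ => Finset.sum_congr rfl fun j _ =>
          Finset.sum_congr rfl fun k _ => Finset.sum_congr rfl fun l _ => ?_
        congr 1
        ring
    _ = ∑ i, ∑ k, ∑ l, ∑ j, (cmat D i k * cmat a i j * cmat A j l) •
        (cov (unitVec (fi k)) * cov (unitVec (bi l))) := by
        refine Finset.sum_congr rfl fun i _ => ?_
        rw [Finset.sum_comm]
        refine Finset.sum_congr rfl fun k _ => ?_
        rw [Finset.sum_comm]
    _ = _ := by
        rw [Finset.sum_comm]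
        refine Finset.sum_congr rfl fun k _ => ?_
        rw [Finset.sum_comm]

/-- The relation `D m' = m A` says that the covectors `η` of `m` pull back to `D` times those of
`m'`; a unimodular `D` leaves their product unchanged. -/
theorem pullLin_etaVol {A D m m' : Matrix (Fin n) (Fin n) ℝ} (h : D * m' = m * A) (hD : D.det = 1)
    (σ : Equiv.Perm (Fin n)) : pullLin (blockMap A D) (etaVol m σ) = etaVol m' σ := by
  have h1 : ∀ i, pullLin (blockMap A D) (cov (etaCov (cmat m) i)) =
      cov (∑ j, cmat D i j • etaCov (cmat m') j) := by
    intro i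
    have h2 : ∀ l, ∑ j, cmat m i j * cmat A j l = ∑ j, cmat D i j * cmat m' j l := by
      intro l
      have := congrArg (fun M => cmat M i l) h
      simp only [cmat_mul, Matrix.mul_apply] at this
      exact this.symm
    simp only [etaCov, map_add, map_smul, map_sum, pullLin_fi, pullLin_bi,
      smul_add, Finset.sum_add_distrib, Finset.smul_sum, smul_smul]
    congr 1
    rw [Finset.sum_comm]
    conv_rhs => rw [Finset.sum_comm]
    refine Finset.sum_congr rfl fun l _ => ?_
    simp only [← Finset.sum_smul, mul_assoc]
    rw [← Finset.mul_sum, h2, Finset.mul_sum]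
    congr 1
    refine Finset.sum_congr rfl fun j _ => ?_
    ring
  have h3 : pullLin (blockMap A D) (ExteriorAlgebra.ιMulti ℂ n (etaCov (cmat m))) =
      ExteriorAlgebra.ιMulti ℂ n (etaCov (cmat m')) := by
    rw [ExteriorAlgebra.ιMulti_apply, map_list_prod, List.map_ofFn]
    have h4 : (⇑(pullLin (blockMap A D)) ∘ fun i => ExteriorAlgebra.ι ℂ (etaCov (cmat m) i)) =
        fun i => cov (∑ j, cmat D i j • etaCov (cmat m') j) := funext h1
    rw [h4, ← ExteriorAlgebra.ιMulti_apply, ιMulti_matrix, cmat_det, hD, Complex.ofReal_one, one_smul]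
  rw [etaVol_eq, etaVol_eq, map_smul, h3]

theorem mixedForm_injective {a b : Matrix (Fin n) (Fin n) ℝ}
    (h : mixedForm (cmat a) = mixedForm (cmat b)) : a = b := by
  ext i j
  have := congrArg (fun φ => evalForm φ ![realVec (realUnitVec (fi i)), realVec (realUnitVec (bi j))]) h
  simp only [evalForm_mixedForm_real, Complex.ofReal_inj] at this
  simpa using this

end Pullback

/-! ### Integral unimodular matrices -/

section IntegralMatrices

variable {n : ℕ}

/-- An integral unimodular matrix as a real matrix. -/
def castMat (A : Matrix.SpecialLinearGroup (Fin n) ℤ) : Matrix (Fin n) (Fin n) ℝ :=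
  A.1.map (Int.cast : ℤ → ℝ)

/-- The inverse transpose of an integral unimodular matrix as a real matrix. -/
def dualMat (A : Matrix.SpecialLinearGroup (Fin n) ℤ) : Matrix (Fin n) (Fin n) ℝ :=
  (A⁻¹).1ᵀ.map (Int.cast : ℤ → ℝ)

theorem dualMat_eq (A : Matrix.SpecialLinearGroup (Fin n) ℤ) : dualMat A = (castMat A⁻¹)ᵀ := rfl

theorem castMat_mul (A A' : Matrix.SpecialLinearGroup (Fin n) ℤ) :
    castMat (A * A') = castMat A * castMat A' := by
  unfold castMat
  rw [Matrix.SpecialLinearGroup.coe_mul]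
  exact Matrix.map_mul (f := Int.castRingHom ℝ)

theorem castMat_one : castMat (1 : Matrix.SpecialLinearGroup (Fin n) ℤ) = 1 := by
  unfold castMat
  rw [Matrix.SpecialLinearGroup.coe_one]
  exact Matrix.map_one _ Int.cast_zero Int.cast_one

theorem castMat_det (A : Matrix.SpecialLinearGroup (Fin n) ℤ) : (castMat A).det = 1 := by
  have := (Int.castRingHom ℝ).map_det A.1
  rw [A.2] at this
  simpa [castMat] using this.symm

theorem dualMat_det (A : Matrix.SpecialLinearGroup (Fin n) ℤ) : (dualMat A).det = 1 := by
  rw [dualMat_eq, Matrix.det_transpose, castMat_det]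

theorem castMat_inv_mul (A : Matrix.SpecialLinearGroup (Fin n) ℤ) :
    castMat A⁻¹ * castMat A = 1 := by
  rw [← castMat_mul, inv_mul_cancel, castMat_one]

theorem castMat_mulVec_int (A : Matrix.SpecialLinearGroup (Fin n) ℤ) (m : Fin n → ℤ) :
    castMat A *ᵥ (fun i => (m i : ℝ)) = fun i => ((A.1 *ᵥ m) i : ℝ) := by
  ext i
  simp [castMat, Matrix.mulVec, dotProduct]

theorem eq_of_eventually_affine {M N : Matrix (Fin n) (Fin n) ℝ} {c d r : Fin n → ℝ}
    (h : ∀ᶠ s in 𝓝 r, M *ᵥ s + c = N *ᵥ s + d) : M = N := by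
  have h1 : ∀ (M : Matrix (Fin n) (Fin n) ℝ) c,
      HasFDerivAt (fun s => M *ᵥ s + c) (LinearMap.toContinuousLinearMap M.mulVecLin) r := fun M c =>
    (LinearMap.toContinuousLinearMap M.mulVecLin).hasFDerivAt.add_const c
  have h2 := (h1 M c).unique ((h1 N d).congr_of_eventuallyEq h)
  exact Matrix.toLin'.injective (LinearMap.toContinuousLinearMap.injective h2)

end IntegralMatrices

/-! ### Coordinate changes of the action-angle bundle -/

section Transitions

variable {n : ℕ}

theorem continuous_base : Continuous (base : (Idx n → ℝ) → Fin n → ℝ) :=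
  continuous_pi fun i => continuous_apply (bi i)

theorem continuous_fib : Continuous (fib : (Idx n → ℝ) → Fin n → ℝ) :=
  continuous_pi fun i => continuous_apply (fi i)

theorem eventually_eq_of_integral {E : Type*} [TopologicalSpace E] {g : E → Fin n → ℝ} {p : E}
    (hg : ContinuousAt g p) (hm : ∀ᶠ q in 𝓝 p, ∃ m : Fin n → ℤ, g q = fun i => (m i : ℝ)) :
    ∀ᶠ q in 𝓝 p, g q = g p := by
  obtain ⟨m, hm0⟩ := hm.self_of_nhds
  have h1 : ∀ᶠ q in 𝓝 p, ∀ i, |g q i - g p i| < 1 := by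
    rw [Filter.eventually_all]
    intro i
    have := (continuousAt_pi.1 hg i)
    have := Metric.continuousAt_iff'.1 this 1 one_pos
    simpa [Real.dist_eq] using this
  filter_upwards [h1, hm] with q hq hq'
  obtain ⟨m', hm'⟩ := hq'
  ext i
  have := hq i
  rw [hm', hm0] at this ⊢
  rw [← Int.cast_sub, ← Int.cast_abs] at this
  have h2 : |m' i - m i| < 1 := by exact_mod_cast this
  rw [Int.abs_lt_one_iff, sub_eq_zero] at h2
  change (m' i : ℝ) = m i
  rw [h2]

/-- Angles are known only modulo integers, and the integers may a priori vary with the point.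
Continuity of `τ` makes them locally constant, so they do not affect the derivative. -/
theorem fderiv_eq_blockMap {A D : Matrix (Fin n) (Fin n) ℝ} {c d : Fin n → ℝ}
    {τ : (Idx n → ℝ) → (Idx n → ℝ)} {p : Idx n → ℝ} (hτ : DifferentiableAt ℝ τ p)
    (h : ∀ᶠ q in 𝓝 p, base (τ q) = A *ᵥ base q + c ∧
      ∃ m : Fin n → ℤ, fib (τ q) = D *ᵥ fib q + d + fun i => (m i : ℝ)) :
    fderiv ℝ τ p = blockMap A D := by
  let g : (Idx n → ℝ) → Fin n → ℝ := fun q => fib (τ q) - fib (blockMap A D q) - d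
  have hg : ContinuousAt g p := by
    refine ContinuousAt.sub (ContinuousAt.sub ?_ ?_) continuousAt_const
    · exact continuous_fib.continuousAt.comp hτ.continuousAt
    · exact (continuous_fib.comp (blockMap A D).continuous).continuousAt
  have h1 := eventually_eq_of_integral hg (by
    filter_upwards [h] with q hq
    obtain ⟨m, hm⟩ := hq.2
    refine ⟨m, ?_⟩
    simp only [g]
    rw [hm, blockMap_apply, fib_pt]
    abel)
  have h2 : τ =ᶠ[𝓝 p] fun q => blockMap A D q + pt c (d + g p) := by
    filter_upwards [h, h1] with q hq hq'
    refine idx_ext ?_ ?_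
    · exact hq.1
    · rw [← hq']
      change fib (τ q) = fib (blockMap A D q) + (d + (fib (τ q) - fib (blockMap A D q) - d))
      abel
  rw [h2.fderiv_eq, fderiv_add_const, ContinuousLinearMap.fderiv]

variable {B : Type*} [TopologicalSpace B] [ChartedSpace (Fin n → ℝ) B] {X : Type*}

/-- Near `r`, the change of coordinates from `e` to `e'` is `s ↦ A s + c`. -/
structure ChartChange (e e' : atlas (Fin n → ℝ) B) (r : Fin n → ℝ)
    (A : Matrix.SpecialLinearGroup (Fin n) ℤ) (c : Fin n → ℝ) : Prop where
  mem_target : r ∈ e.1.target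
  mem_source : e.1.symm r ∈ e'.1.source
  eventually : ∀ᶠ s in 𝓝 r, e'.1 (e.1.symm s) = castMat A *ᵥ s + c

theorem ChartChange.eventually_chartChange {e e' : atlas (Fin n → ℝ) B} {r c : Fin n → ℝ}
    {A : Matrix.SpecialLinearGroup (Fin n) ℤ} (h : ChartChange e e' r A c) :
    ∀ᶠ s in 𝓝 r, ChartChange e e' s A c := by
  have h1 : ∀ᶠ s in 𝓝 r, s ∈ e.1.target := e.1.open_target.mem_nhds h.mem_target
  have h2 : ∀ᶠ s in 𝓝 r, e.1.symm s ∈ e'.1.source :=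
    (e.1.continuousAt_symm h.mem_target).eventually (e'.1.open_source.mem_nhds h.mem_source)
  filter_upwards [h1, h2, h.eventually.eventually_nhds] with s hs1 hs2 hs3
  exact ⟨hs1, hs2, hs3⟩

theorem ActionAngle.exists_chartChange (S : ActionAngle n B X) {e e' : atlas (Fin n → ℝ) B}
    {r : Fin n → ℝ} (hr : r ∈ e.1.target) (hr' : e.1.symm r ∈ e'.1.source) :
    ∃ A c, ChartChange e e' r A c := by
  obtain ⟨A, c, d, h⟩ := S.transition e e' r hr hr'
  exact ⟨A, c, hr, hr', h.mono fun s hs => hs.1⟩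

theorem ActionAngle.fderiv_transition (S : ActionAngle n B X) {i j : atlas (Fin n → ℝ) B}
    {p : Idx n → ℝ} {τ : (Idx n → ℝ) → (Idx n → ℝ)} (h : IsTransition S.param i j p τ) :
    ∃ A c, ChartChange i j (base p) A c ∧ j.1.symm (base (τ p)) = i.1.symm (base p) ∧
      base (τ p) ∈ j.1.target ∧ fderiv ℝ τ p = blockMap (castMat A) (dualMat A) := by
  obtain ⟨hp, hτ, hev⟩ := h
  have hdom : ∀ᶠ q in 𝓝 p, base q ∈ i.1.target :=
    continuous_base.continuousAt.eventually (i.1.open_target.mem_nhds hp)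
  have hproj : ∀ᶠ q in 𝓝 p, j.1.symm (base (τ q)) = i.1.symm (base q) := by
    filter_upwards [hev, hdom] with q hq hq'
    have := congrArg S.proj hq.2
    have h1 := S.proj_coord j _ hq.1 (fib (τ q))
    have h2 := S.proj_coord i _ hq' (fib q)
    exact h1.symm.trans (this.trans h2)
  have hp' := hproj.self_of_nhds
  have hτp : base (τ p) ∈ j.1.target := hev.self_of_nhds.1
  have hsrc : i.1.symm (base p) ∈ j.1.source := by
    rw [← hp']
    exact j.1.map_target hτp
  obtain ⟨A, c, d, hA⟩ := S.transition i j (base p) hp hsrc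
  refine ⟨A, c, ⟨hp, hsrc, hA.mono fun s hs => hs.1⟩, hp', hτp, ?_⟩
  refine fderiv_eq_blockMap (c := c) (d := d) hτ ?_
  filter_upwards [hev, hproj, continuous_base.continuousAt.eventually hA] with q hq hq' hqA
  have hb : base (τ q) = j.1 (i.1.symm (base q)) := by
    rw [← hq', j.1.right_inv hq.1]
  refine ⟨hb.trans hqA.1, ?_⟩
  have h1 : S.coord j (base (τ q)) (dualMat A *ᵥ fib q + d) = S.coord j (base (τ q)) (fib (τ q)) := by
    have h2 := hqA.2 (fib q)
    rw [← hb] at h2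
    exact h2.symm.trans hq.2.symm
  obtain ⟨m, hm⟩ := (S.period j _ hq.1 _ _).1 h1
  exact ⟨m, funext hm⟩

end Transitions

/-! ### Coordinate changes of the dual torus bundle -/

section DualBundleTransitions

variable {n : ℕ} {B : Type*} [TopologicalSpace B] [ChartedSpace (Fin n → ℝ) B] {X : Type*}

theorem mem_tangentLattice (b : B) (v : TangentSpace 𝓘(ℝ, Fin n → ℝ) b) :
    v ∈ tangentLattice n b ↔ ∃ m : Fin n → ℤ, v = (fun i => (m i : ℝ) : Fin n → ℝ) := by
  constructor
  · intro h
    induction h using AddSubgroup.closure_induction with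
    | mem x hx =>
      obtain ⟨i, rfl⟩ := hx
      refine ⟨Pi.single i 1, ?_⟩
      change @Eq (Fin n → ℝ) _ _
      ext k
      simp [Pi.single_apply, apply_ite]
    | zero =>
      refine ⟨0, ?_⟩
      change @Eq (Fin n → ℝ) 0 _
      ext k
      simp
    | add x y _ _ hx hy =>
      obtain ⟨m, rfl⟩ := hx
      obtain ⟨m', rfl⟩ := hy
      exact ⟨m + m', funext fun k => (Int.cast_add (m k) (m' k)).symm⟩
    | neg x _ hx =>
      obtain ⟨m, rfl⟩ := hx
      exact ⟨-m, funext fun k => (Int.cast_neg (m k)).symm⟩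
  · rintro ⟨m, rfl⟩
    have h1 : (fun i => (m i : ℝ) : Fin n → ℝ) = ∑ i, m i • (Pi.single i 1 : Fin n → ℝ) := by
      ext k
      simp [Finset.sum_apply, Pi.single_apply]
    rw [h1]
    exact sum_mem fun i _ => zsmul_mem (AddSubgroup.subset_closure (Set.mem_range_self i)) _

theorem dualBundle_eq_iff (b b' : B) (u u' : Fin n → ℝ) :
    ((⟨b, QuotientAddGroup.mk (s := tangentLattice n b) u⟩ : DualBundle n B) =
      ⟨b', QuotientAddGroup.mk (s := tangentLattice n b') u'⟩) ↔
      b = b' ∧ ∃ m : Fin n → ℤ, u' = u + fun i => (m i : ℝ) := by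
  constructor
  · intro h
    obtain ⟨rfl, h2⟩ := Sigma.mk.inj_iff.1 h
    refine ⟨rfl, ?_⟩
    obtain ⟨m, hm⟩ := (mem_tangentLattice b _).1 (QuotientAddGroup.eq.1 (eq_of_heq h2))
    refine ⟨m, ?_⟩
    rw [← hm]
    exact (add_neg_cancel_left u u').symm
  · rintro ⟨rfl, m, rfl⟩
    congr 1
    refine QuotientAddGroup.eq.2 ((mem_tangentLattice b _).2 ⟨m, ?_⟩)
    exact neg_add_cancel_left u _

theorem ActionAngle.fderiv_chart (S : ActionAngle n B X) {e k : atlas (Fin n → ℝ) B}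
    {r : Fin n → ℝ} (hr : r ∈ e.1.target) (hr' : e.1.symm r ∈ k.1.source) :
    ∃ M c, ChartChange e k r M c ∧
      ∀ v, fderiv ℝ (fun s => k.1 (e.1.symm s)) r v = castMat M *ᵥ v := by
  obtain ⟨M, c, h⟩ := S.exists_chartChange hr hr'
  refine ⟨M, c, h, fun v => ?_⟩
  have h1 : HasFDerivAt (fun s => castMat M *ᵥ s + c)
      (LinearMap.toContinuousLinearMap (castMat M).mulVecLin) r :=
    (LinearMap.toContinuousLinearMap (castMat M).mulVecLin).hasFDerivAt.add_const c
  rw [Filter.EventuallyEq.fderiv_eq h.eventually, h1.fderiv]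
  rfl

theorem ChartChange.comp {e e' k : atlas (Fin n → ℝ) B} {r c c1 c2 : Fin n → ℝ}
    {A M M' : Matrix.SpecialLinearGroup (Fin n) ℤ} (h : ChartChange e e' r A c)
    (h1 : ChartChange e k r M c1) (h2 : ChartChange e' k (e'.1 (e.1.symm r)) M' c2) :
    castMat M = castMat M' * castMat A := by
  refine eq_of_eventually_affine (c := c1) (d := castMat M' *ᵥ c + c2) (r := r) ?_
  have hcont : ContinuousAt (fun s => e'.1 (e.1.symm s)) r :=
    (e'.1.continuousAt h.mem_source).comp (e.1.continuousAt_symm h.mem_target)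
  filter_upwards [h.eventually_chartChange, h1.eventually, hcont.eventually h2.eventually,
    h.eventually] with s hs hs1 hs2 hs3
  rw [e'.1.left_inv hs.mem_source, hs1, hs3] at hs2
  rw [hs2, Matrix.mulVec_add, Matrix.mulVec_mulVec, add_assoc]

/-- Both points are read in the preferred chart `k` at their common base point. The changes from `e`
and `e'` to `k` have linear parts `M = N A` and `N`; since `N` is integral and unimodular it
preserves the lattice, and `k` drops out. -/
theorem ActionAngle.dualParam_eq_iff (S : ActionAngle n B X) {e e' : atlas (Fin n → ℝ) B}
    {c : Fin n → ℝ} {p p' : Idx n → ℝ} {A : Matrix.SpecialLinearGroup (Fin n) ℤ}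
    (h : ChartChange e e' (base p) A c) (hp' : base p' ∈ e'.1.target) :
    (dualParam n B).par e p = (dualParam n B).par e' p' ↔
      base p' = castMat A *ᵥ base p + c ∧
        ∃ m : Fin n → ℤ, fib p' = castMat A *ᵥ fib p + fun i => (m i : ℝ) := by
  have hbase : e.1.symm (base p) = e'.1.symm (base p') ↔ base p' = castMat A *ᵥ base p + c := by
    rw [← h.eventually.self_of_nhds]
    constructor
    · intro hb
      rw [hb, e'.1.right_inv hp']
    · intro hb
      rw [hb, e'.1.left_inv h.mem_source]
  refine (dualBundle_eq_iff _ _ _ _).trans ?_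
  rw [← hbase]
  refine and_congr_right fun hb => ?_
  rw [← hb]
  let k : atlas (Fin n → ℝ) B :=
    ⟨chartAt (Fin n → ℝ) (e.1.symm (base p)), chart_mem_atlas _ _⟩
  have hk : e.1.symm (base p) ∈ k.1.source := mem_chart_source _ _
  obtain ⟨M, c1, hM, hM'⟩ := S.fderiv_chart h.mem_target hk
  obtain ⟨N, c2, hN, hN'⟩ := S.fderiv_chart (k := k) hp' (by rw [← hb]; exact hk)
  have hbp : base p' = e'.1 (e.1.symm (base p)) := by rw [hb, e'.1.right_inv hp']
  have hcomp := h.comp hM (hbp ▸ hN)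
  rw [show fderiv ℝ (fun s => (chartAt (Fin n → ℝ) (e.1.symm (base p))) (e.1.symm s)) (base p) (fib p) =
    castMat M *ᵥ fib p from hM' _, show fderiv ℝ (fun s => (chartAt (Fin n → ℝ) (e.1.symm (base p)))
    (e'.1.symm s)) (base p') (fib p') = castMat N *ᵥ fib p' from hN' _, hcomp, ← Matrix.mulVec_mulVec]
  constructor
  · rintro ⟨m, hm⟩
    refine ⟨(N⁻¹).1 *ᵥ m, ?_⟩
    rw [← castMat_mulVec_int, ← Matrix.one_mulVec (fib p'), ← castMat_inv_mul N,
      ← Matrix.mulVec_mulVec, hm, Matrix.mulVec_add, Matrix.mulVec_mulVec, castMat_inv_mul,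
      Matrix.one_mulVec]
  · rintro ⟨m, hm⟩
    refine ⟨N.1 *ᵥ m, ?_⟩
    rw [← castMat_mulVec_int, hm, Matrix.mulVec_add]

theorem ActionAngle.fderiv_dualTransition (S : ActionAngle n B X) {i j : atlas (Fin n → ℝ) B}
    {p : Idx n → ℝ} {τ : (Idx n → ℝ) → (Idx n → ℝ)} (h : IsTransition (dualParam n B) i j p τ) :
    ∃ A : Matrix.SpecialLinearGroup (Fin n) ℤ, fderiv ℝ τ p = blockMap (castMat A) (castMat A) := by
  obtain ⟨hp, hτ, hev⟩ := h
  have hp' : j.1.symm (base (τ p)) = i.1.symm (base p) :=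
    congrArg Sigma.fst hev.self_of_nhds.2
  have hτp : base (τ p) ∈ j.1.target := hev.self_of_nhds.1
  have hsrc : i.1.symm (base p) ∈ j.1.source := by
    rw [← hp']
    exact j.1.map_target hτp
  obtain ⟨A, c, hA⟩ := S.exists_chartChange hp hsrc
  refine ⟨A, fderiv_eq_blockMap (c := c) (d := 0) hτ ?_⟩
  filter_upwards [hev, continuous_base.continuousAt.eventually hA.eventually_chartChange] with q hq hqA
  have := (S.dualParam_eq_iff hqA hq.1).1 hq.2.symm
  simpa using this

/-- Supplies actual coordinate changes to which the compatibility of `ω̌` can be applied; the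
transformation law of `μ` in `semiFlatMat_transition` rests on it. -/
theorem ActionAngle.isTransition_dual (S : ActionAngle n B X) {e e' : atlas (Fin n → ℝ) B}
    {c : Fin n → ℝ} {p : Idx n → ℝ} {A : Matrix.SpecialLinearGroup (Fin n) ℤ}
    (h : ChartChange e e' (base p) A c) :
    IsTransition (dualParam n B) e e' p fun q => blockMap (castMat A) (castMat A) q + pt c 0 := by
  refine ⟨h.mem_target, (blockMap _ _).differentiableAt.add_const _, ?_⟩
  filter_upwards [continuous_base.continuousAt.eventually h.eventually_chartChange] with q hq
  have hb : base (blockMap (castMat A) (castMat A) q + pt c 0) = castMat A *ᵥ base q + c := rfl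
  have hf : fib (blockMap (castMat A) (castMat A) q + pt c 0) = castMat A *ᵥ fib q + 0 := rfl
  have hdom : base (blockMap (castMat A) (castMat A) q + pt c 0) ∈ e'.1.target := by
    rw [hb, ← hq.eventually.self_of_nhds]
    exact e'.1.map_source hq.mem_source
  refine ⟨hdom, ((S.dualParam_eq_iff hq hdom).2 ⟨hb, 0, ?_⟩).symm⟩
  rw [hf]
  congr 1
  ext
  simp

end DualBundleTransitions

/-! ### Smoothness of families of forms -/

section Smooth

variable {ι κ : Type*} [Fintype ι] [LinearOrder ι] [Fintype κ] [LinearOrder κ]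
  {E : Type*} [NormedAddCommGroup E] [NormedSpace ℝ E]

/-- Smoothness of a family of exterior forms, coefficient by coefficient. -/
def CoeffSmoothOn (φ : E → Ext ι) (s : Set E) : Prop :=
  ∀ I, ContDiffOn ℝ (⊤ : ℕ∞) (fun p => coeff I (φ p)) s

theorem CoeffSmoothOn.const (x : Ext ι) (s : Set E) : CoeffSmoothOn (fun _ => x) s :=
  fun _ => contDiffOn_const

theorem CoeffSmoothOn.congr {φ ψ : E → Ext ι} {s : Set E} (h : CoeffSmoothOn φ s)
    (hφ : ∀ p ∈ s, ψ p = φ p) : CoeffSmoothOn ψ s :=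
  fun I => (h I).congr fun p hp => by rw [hφ p hp]

theorem CoeffSmoothOn.functional {φ : E → Ext ι} {s : Set E} (h : CoeffSmoothOn φ s)
    (l : Ext ι →ₗ[ℂ] ℂ) : ContDiffOn ℝ (⊤ : ℕ∞) (fun p => l (φ p)) s := by
  have : ∀ p, l (φ p) = ∑ I, coeff I (φ p) * l (mono I) := by
    intro p
    conv_lhs => rw [← sum_coeff_mono (φ p), map_sum]
    simp
  simp only [this]
  exact ContDiffOn.sum fun I _ => (h I).mul contDiffOn_const

theorem CoeffSmoothOn.map {φ : E → Ext ι} {s : Set E} (h : CoeffSmoothOn φ s)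
    (L : Ext ι →ₗ[ℂ] Ext κ) : CoeffSmoothOn (fun p => L (φ p)) s := fun J =>
  h.functional ((mono.coord J) ∘ₗ L)

theorem CoeffSmoothOn.add {φ ψ : E → Ext ι} {s : Set E} (h : CoeffSmoothOn φ s)
    (h' : CoeffSmoothOn ψ s) : CoeffSmoothOn (fun p => φ p + ψ p) s := fun I => by
  simp only [coeff_add]
  exact (h I).add (h' I)

theorem CoeffSmoothOn.sum {σ : Type*} {t : Finset σ} {φ : σ → E → Ext ι} {s : Set E}
    (h : ∀ k ∈ t, CoeffSmoothOn (φ k) s) : CoeffSmoothOn (fun p => ∑ k ∈ t, φ k p) s := fun I => by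
  simp only [coeff_sum]
  exact ContDiffOn.sum fun k hk => h k hk I

theorem CoeffSmoothOn.smul {f : E → ℂ} {φ : E → Ext ι} {s : Set E}
    (hf : ContDiffOn ℝ (⊤ : ℕ∞) f s) (h : CoeffSmoothOn φ s) :
    CoeffSmoothOn (fun p => f p • φ p) s := fun I => by
  simp only [coeff_smul]
  exact hf.mul (h I)

theorem CoeffSmoothOn.mul {φ ψ : E → Ext ι} {s : Set E} (h : CoeffSmoothOn φ s)
    (h' : CoeffSmoothOn ψ s) : CoeffSmoothOn (fun p => φ p * ψ p) s := by
  have : ∀ p, φ p * ψ p = ∑ I, coeff I (φ p) • (LinearMap.mulLeft ℂ (mono I) (ψ p)) := by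
    intro p
    conv_lhs => rw [← sum_coeff_mono (φ p), Finset.sum_mul]
    simp
  simp only [this]
  exact CoeffSmoothOn.sum fun I _ => CoeffSmoothOn.smul (h I) (h'.map _)

theorem CoeffSmoothOn.pow {φ : E → Ext ι} {s : Set E} (h : CoeffSmoothOn φ s) (k : ℕ) :
    CoeffSmoothOn (fun p => φ p ^ k) s := by
  induction k with
  | zero => simpa using CoeffSmoothOn.const 1 s
  | succ k ih =>
    simp only [pow_succ]
    exact ih.mul h

theorem CoeffSmoothOn.comp {E' : Type*} [NormedAddCommGroup E'] [NormedSpace ℝ E'] {φ : E → Ext ι}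
    {s : Set E} {t : Set E'} {g : E' → E} (h : CoeffSmoothOn φ s) (hg : ContDiff ℝ (⊤ : ℕ∞) g)
    (hst : Set.MapsTo g t s) : CoeffSmoothOn (fun p => φ (g p)) t := fun I =>
  (h I).comp hg.contDiffOn hst

end Smooth

/-! ### The global transform, and equivalence of the two SU(n) conditions -/

section Transforms

variable {n : ℕ} {B : Type*} [TopologicalSpace B] [ChartedSpace (Fin n → ℝ) B] {X : Type*}

/-- The unit cube has volume 1, so on torus-invariant integrands the fibre integral is purely
algebraic. -/
theorem pushForward_of_const {Ψ : (Idx n → ℝ) → (Fin n → ℝ) → Ext (Idx3 n)} {p : Idx n → ℝ}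
    {Y : Ext (Idx3 n)} (h : ∀ t, Ψ p t = Y) : pushForward Ψ p = stripFibre Y := by
  unfold pushForward
  simp only [h]
  have hvol : (MeasureTheory.volume.real (Set.Icc (0 : Fin n → ℝ) 1)) = 1 := by
    rw [MeasureTheory.Measure.real, Real.volume_Icc_pi_toReal]
    · simp
    · intro i
      simp
  simp only [MeasureTheory.setIntegral_const, hvol, one_smul]
  exact sum_coeff_mono _

theorem FT_eq (S : ActionAngle n B X) {φ : FormFamily (dualParam n B)} {e : atlas (Fin n → ℝ) B}
    {p : Idx n → ℝ} {x : Ext (Idx n)} (h : ∀ t, φ e (pt (base p) t) = x) :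
    FT S φ e p = fourier x := by
  rw [fourier_apply]
  exact pushForward_of_const fun t => by rw [h]; rfl

theorem FTdual_eq (S : ActionAngle n B X) {φ : FormFamily S.param} {e : atlas (Fin n → ℝ) B}
    {p : Idx n → ℝ} {x : Ext (Idx n)} (h : ∀ t, φ e (pt (base p) t) = x) :
    FTdual S φ e p = fourierDual x := by
  rw [fourierDual_apply]
  exact congrArg polSwitchInv (pushForward_of_const fun t => by rw [h]; rfl)

theorem contDiff_pt_zero : ContDiff ℝ (⊤ : ℕ∞) (fun r : Fin n → ℝ => pt r 0) := by
  refine contDiff_pi.2 fun k => ?_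
  induction k using idx_cases with
  | hb i => exact contDiff_apply ℝ ℝ i
  | hf i => exact contDiff_const

theorem contDiff_base : ContDiff ℝ (⊤ : ℕ∞) (base : (Idx n → ℝ) → Fin n → ℝ) :=
  contDiff_pi.2 fun i => contDiff_apply ℝ ℝ (bi i)

variable {ω' : FormFamily (dualParam n B)}

/-- The symmetric matrix `μ` of a semi-flat form in the chart `e`. -/
noncomputable def semiFlatMat (hω : IsSemiFlatRealOneOne ω') (e : atlas (Fin n → ℝ) B) :
    (Fin n → ℝ) → Matrix (Fin n) (Fin n) ℝ := Classical.choose (hω.2 e)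

theorem semiFlatMat_symm (hω : IsSemiFlatRealOneOne ω') {e : atlas (Fin n → ℝ) B} {r : Fin n → ℝ}
    (hr : r ∈ e.1.target) : (semiFlatMat hω e r).IsSymm :=
  (Classical.choose_spec (hω.2 e)).1 r hr

theorem semiFlat_eq (hω : IsSemiFlatRealOneOne ω') {e : atlas (Fin n → ℝ) B} {p : Idx n → ℝ}
    (hp : base p ∈ e.1.target) : ω' e p = mixedForm (cmat (semiFlatMat hω e (base p))) := by
  rw [← mixedForm_of_symm (cmat_symm (semiFlatMat_symm hω hp))]
  exact (Classical.choose_spec (hω.2 e)).2 p hp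

theorem mirrorVol_eq_fourier (S : ActionAngle n B X) (hω : IsSemiFlatRealOneOne ω')
    {e : atlas (Fin n → ℝ) B} {p : Idx n → ℝ} (hp : base p ∈ e.1.target) : mirrorVol S ω' e p =
      fourier (IsNilpotent.exp ((2 : ℂ) • mixedForm (cmat (semiFlatMat hω e (base p))))) := by
  refine FT_eq S fun t => ?_
  exact congrArg (fun x => IsNilpotent.exp ((2 : ℂ) • x)) (semiFlat_eq hω (p := pt (base p) t) hp)

theorem mirrorVol_eq (S : ActionAngle n B X) (hω : IsSemiFlatRealOneOne ω')
    {e : atlas (Fin n → ℝ) B} {p : Idx n → ℝ} (hp : base p ∈ e.1.target) :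
    mirrorVol S ω' e p = etaVol (semiFlatMat hω e (base p)) Fin.revPerm := by
  rw [mirrorVol_eq_fourier S hω hp, fourier_exp (cmat_symm (semiFlatMat_symm hω hp)), etaVol_revPerm]

theorem symp_eq (S : ActionAngle n B X) (e : atlas (Fin n → ℝ) B) (p : Idx n → ℝ) :
    S.symp e p = mixedForm (cmat 1) := by
  rw [cmat_one]
  simp [ActionAngle.symp, mixedForm, Matrix.one_apply, dx_eq_cov]

theorem dualVol_eq (e : atlas (Fin n → ℝ) B) (p : Idx n → ℝ) :
    dualVol n B e p = etaVol 1 1 := etaVol_one.symm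

theorem semiFlat_smooth (hω : IsSemiFlatRealOneOne ω') (e : atlas (Fin n → ℝ) B) :
    CoeffSmoothOn (fun r => mixedForm (cmat (semiFlatMat hω e r))) e.1.target := by
  have h : CoeffSmoothOn (ω' e) {p | base p ∈ e.1.target} := hω.1.smooth e
  refine (h.comp contDiff_pt_zero (t := e.1.target) fun r hr => hr).congr fun r hr => ?_
  rw [semiFlat_eq hω (p := pt r 0) hr]
  rfl

/-- Smoothness is required of the form only, not of `μ`. It passes to `μ` because each entry is a
value of the form on coordinate vectors. -/
theorem semiFlatMat_smooth (hω : IsSemiFlatRealOneOne ω') (e : atlas (Fin n → ℝ) B) (i j : Fin n) :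
    ContDiffOn ℝ (⊤ : ℕ∞) (fun r => ((semiFlatMat hω e r i j : ℝ) : ℂ)) e.1.target := by
  have h := (semiFlat_smooth hω e).functional
    (ExteriorAlgebra.algebraMapInv.toLinearMap ∘ₗ contractBilin (unitVec (bi j)) ∘ₗ
      contractBilin (unitVec (fi i)))
  refine h.congr fun r _ => ?_
  have h1 := evalForm_two (mixedForm (cmat (semiFlatMat hω e r))) (realVec (realUnitVec (fi i)))
    (realVec (realUnitVec (bi j)))
  rw [evalForm_mixedForm_real, realVec_realUnitVec, realVec_realUnitVec] at h1
  refine Eq.trans ?_ h1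
  simp

theorem semiFlatMat_det_smooth (hω : IsSemiFlatRealOneOne ω') (e : atlas (Fin n → ℝ) B) :
    ContDiffOn ℝ (⊤ : ℕ∞) (fun r => ((semiFlatMat hω e r).det : ℂ)) e.1.target := by
  have h : ∀ r, ((semiFlatMat hω e r).det : ℂ) = ∑ σ : Equiv.Perm (Fin n),
      ((Equiv.Perm.sign σ : ℤ) : ℂ) * ∏ i, ((semiFlatMat hω e r (σ i) i : ℝ) : ℂ) := by
    intro r
    rw [Matrix.det_apply']
    push_cast
    rfl
  simp only [h]
  exact ContDiffOn.sum fun σ _ => contDiffOn_const.mul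
    (contDiffOn_prod fun i _ => semiFlatMat_smooth hω e (σ i) i)

theorem semiFlatMat_transition (S : ActionAngle n B X) (hω : IsSemiFlatRealOneOne ω')
    {e e' : atlas (Fin n → ℝ) B} {r c : Fin n → ℝ} {A : Matrix.SpecialLinearGroup (Fin n) ℤ}
    (h : ChartChange e e' r A c) : semiFlatMat hω e r =
      (castMat A)ᵀ * semiFlatMat hω e' (e'.1 (e.1.symm r)) * castMat A := by
  have ht := S.isTransition_dual (p := pt r 0) h
  have hr' : castMat A *ᵥ r + c = e'.1 (e.1.symm r) := h.eventually.self_of_nhds.symm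
  have hmem : e'.1 (e.1.symm r) ∈ e'.1.target := e'.1.map_source h.mem_source
  have h1 := hω.1.compat e e' (pt r 0) _ ht
  have hb : base (blockMap (castMat A) (castMat A) (pt r 0) + pt c 0) = e'.1 (e.1.symm r) := by
    rw [← hr']
    rfl
  rw [semiFlat_eq hω (p := pt r 0) h.mem_target, semiFlat_eq hω (by rw [hb]; exact hmem), hb,
    fderiv_add_const, ContinuousLinearMap.fderiv, pullLin_mixedForm] at h1
  exact mixedForm_injective h1

theorem isForm_dualVol (S : ActionAngle n B X) : IsForm (dualParam n B) (dualVol n B) := by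
  refine ⟨fun i => CoeffSmoothOn.const (ExteriorAlgebra.ιMulti ℂ n dz) _, fun i j p τ h => ?_⟩
  obtain ⟨A, hA⟩ := S.fderiv_dualTransition h
  rw [hA]
  refine (dualVol_eq (B := B) i p).trans (Eq.trans ?_
    (congrArg (pullLin (blockMap (castMat A) (castMat A))) (dualVol_eq (B := B) j (τ p)).symm))
  rw [pullLin_etaVol (m' := 1) _ (castMat_det A)]
  rw [mul_one, one_mul]

theorem isForm_symp (S : ActionAngle n B X) : IsForm S.param S.symp := by
  refine ⟨fun i => CoeffSmoothOn.const (∑ i, dx (fi i) * dx (bi i)) _, fun i j p τ h => ?_⟩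
  obtain ⟨A, c, -, -, -, hA⟩ := S.fderiv_transition h
  rw [hA]
  refine (symp_eq S i p).trans (Eq.trans ?_
    (congrArg (pullLin (blockMap (castMat A) (dualMat A))) (symp_eq S j (τ p)).symm))
  rw [pullLin_mixedForm, mul_one, dualMat_eq, Matrix.transpose_transpose, castMat_inv_mul]

/-- Compatibility holds because the angles of `X` change by `D = A⁻ᵀ` while `μ = Aᵀ μ' A`, so that
`D μ = μ' A`, as `pullLin_etaVol` requires. -/
theorem isForm_mirrorVol (S : ActionAngle n B X) (hω : IsSemiFlatRealOneOne ω') :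
    IsForm S.param (mirrorVol S ω') := by
  constructor
  · intro e
    have h1 : CoeffSmoothOn (fun r => fourier (∑ k ∈ Finset.range (n + 1),
        ((k.factorial : ℂ)⁻¹) • ((2 : ℂ) • mixedForm (cmat (semiFlatMat hω e r))) ^ k)) e.1.target := by
      refine CoeffSmoothOn.map (CoeffSmoothOn.sum fun k _ => CoeffSmoothOn.smul contDiffOn_const
        (CoeffSmoothOn.pow (CoeffSmoothOn.smul contDiffOn_const (semiFlat_smooth hω e)) k)) fourier
    have h2 : CoeffSmoothOn (mirrorVol S ω' e) (S.param.dom e) := by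
      refine (h1.comp contDiff_base (t := S.param.dom e) fun p hp => hp).congr fun p hp => ?_
      rw [mirrorVol_eq_fourier S hω hp, exp_eq_sum_smul]
      rw [smul_pow, mixedForm_pow_succ, smul_zero]
    exact h2
  · intro i j p τ h
    obtain ⟨A, c, hch, hb, ht, hA⟩ := S.fderiv_transition h
    have hbase : base (τ p) = j.1 (i.1.symm (base p)) := by rw [← hb, j.1.right_inv ht]
    rw [hA, mirrorVol_eq S hω hch.mem_target, mirrorVol_eq S hω ht,
      pullLin_etaVol (m' := semiFlatMat hω i (base p)) _ (dualMat_det A)]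
    rw [semiFlatMat_transition S hω hch, hbase, dualMat_eq, ← mul_assoc, ← mul_assoc,
      ← Matrix.transpose_mul]
    have : castMat A * castMat A⁻¹ = 1 := by rw [← castMat_mul, mul_inv_cancel, castMat_one]
    rw [this, Matrix.transpose_one, one_mul]

theorem isSUAt_dual_iff (hω : IsSemiFlatRealOneOne ω') {e : atlas (Fin n → ℝ) B} {p : Idx n → ℝ}
    (hp : base p ∈ e.1.target) :
    IsSUAt n (ω' e p) (dualVol n B e p) ↔ IsPos (semiFlatMat hω e (base p)) := by
  rw [semiFlat_eq hω hp, dualVol_eq, isSUAt_etaVol_iff (semiFlatMat_symm hω hp)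
    Matrix.isSymm_one (by rw [one_mul, mul_one]), mul_one]

theorem isSUAt_mirror_iff (S : ActionAngle n B X) (hω : IsSemiFlatRealOneOne ω')
    {e : atlas (Fin n → ℝ) B} {p : Idx n → ℝ} (hp : base p ∈ e.1.target) :
    IsSUAt n (S.symp e p) (mirrorVol S ω' e p) ↔ IsPos (semiFlatMat hω e (base p)) := by
  rw [symp_eq, mirrorVol_eq S hω hp, isSUAt_etaVol_iff Matrix.isSymm_one
    (semiFlatMat_symm hω hp) (by rw [one_mul, mul_one]), one_mul]

theorem isSU_dual_iff (S : ActionAngle n B X) (hω : IsSemiFlatRealOneOne ω') :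
    IsSU (dualParam n B) n ω' (dualVol n B) ↔
      ∀ e : atlas (Fin n → ℝ) B, ∀ r ∈ e.1.target, IsPos (semiFlatMat hω e r) :=
  ⟨fun h e r hr => (isSUAt_dual_iff hω (p := pt r 0) hr).1 (h.su e (pt r 0) hr),
    fun h => ⟨hω.1, isForm_dualVol S, fun e _ hp => (isSUAt_dual_iff hω hp).2 (h e _ hp)⟩⟩

theorem isSU_mirror_iff (S : ActionAngle n B X) (hω : IsSemiFlatRealOneOne ω') :
    IsSU S.param n S.symp (mirrorVol S ω') ↔
      ∀ e : atlas (Fin n → ℝ) B, ∀ r ∈ e.1.target, IsPos (semiFlatMat hω e r) :=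
  ⟨fun h e r hr => (isSUAt_mirror_iff S hω (p := pt r 0) hr).1 (h.su e (pt r 0) hr),
    fun h => ⟨isForm_symp S, isForm_mirrorVol S hω,
      fun e _ hp => (isSUAt_mirror_iff S hω hp).2 (h e _ hp)⟩⟩

end Transforms

/-! ### Conformal factors -/

section Conformal

variable {n : ℕ} {B : Type*} [TopologicalSpace B] [ChartedSpace (Fin n → ℝ) B] {X : Type*}
  {ω' : FormFamily (dualParam n B)}

/-- The determinant of the matrix `μ` of a semi-flat form, as a function on the base. -/
noncomputable def baseDet (hω : IsSemiFlatRealOneOne ω') (b : B) : ℝ :=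
  (semiFlatMat hω ⟨chartAt (Fin n → ℝ) b, chart_mem_atlas _ b⟩ (chartAt (Fin n → ℝ) b b)).det

/-- The law `μ = Aᵀ μ' A` with `det A = 1` makes the determinant chart-independent. This is where
the special linear condition on the atlas matters. -/
theorem det_semiFlatMat (S : ActionAngle n B X) (hω : IsSemiFlatRealOneOne ω')
    {e : atlas (Fin n → ℝ) B} {r : Fin n → ℝ} (hr : r ∈ e.1.target) :
    (semiFlatMat hω e r).det = baseDet hω (e.1.symm r) := by
  obtain ⟨A, c, h⟩ := S.exists_chartChange
    (e' := ⟨chartAt (Fin n → ℝ) (e.1.symm r), chart_mem_atlas _ _⟩) hr (mem_chart_source _ _)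
  rw [semiFlatMat_transition S hω h, Matrix.det_mul, Matrix.det_mul, Matrix.det_transpose,
    castMat_det, one_mul, mul_one]
  rfl

theorem smul_mixedForm_one_pow_inj {a b : ℝ} :
    (Complex.I ^ n * (a : ℂ) / (n.factorial : ℂ)) •
        mixedForm (cmat (1 : Matrix (Fin n) (Fin n) ℝ)) ^ n =
      (Complex.I ^ n * (b : ℂ) / (n.factorial : ℂ)) •
        mixedForm (cmat (1 : Matrix (Fin n) (Fin n) ℝ)) ^ n ↔ a = b := by
  refine ⟨fun h => ?_, fun h => by rw [h]⟩
  have h1 := smul_left_injective ℂ mixedForm_one_pow_ne_zero h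
  have hn : (n.factorial : ℂ) ≠ 0 := Nat.cast_ne_zero.2 n.factorial_ne_zero
  have hI : Complex.I ^ n ≠ 0 := pow_ne_zero _ Complex.I_ne_zero
  have h2 := mul_left_cancel₀ hI ((div_left_inj' hn).1 h1)
  exact_mod_cast h2

theorem mem_chartAt_target (b : B) : chartAt (Fin n → ℝ) b b ∈ (chartAt (Fin n → ℝ) b).target :=
  (chartAt (Fin n → ℝ) b).map_source (mem_chart_source _ b)

theorem ActionAngle.exists_par (S : ActionAngle n B X) (x : X) :
    ∃ (e : atlas (Fin n → ℝ) B) (p : Idx n → ℝ), base p ∈ e.1.target ∧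
      S.param.par e p = x ∧ e.1.symm (base p) = S.proj x := by
  obtain ⟨θ, hθ⟩ := S.surj ⟨chartAt (Fin n → ℝ) (S.proj x), chart_mem_atlas _ _⟩ x
    (mem_chart_source _ _)
  exact ⟨⟨chartAt (Fin n → ℝ) (S.proj x), chart_mem_atlas _ _⟩,
    pt (chartAt (Fin n → ℝ) (S.proj x) (S.proj x)) θ, mem_chartAt_target _, hθ,
    (chartAt (Fin n → ℝ) (S.proj x)).left_inv (mem_chart_source _ _)⟩

theorem ActionAngle.exists_dualParam (S : ActionAngle n B X) (y : DualBundle n B) :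
    ∃ (e : atlas (Fin n → ℝ) B) (p : Idx n → ℝ), base p ∈ e.1.target ∧
      (dualParam n B).par e p = y ∧ e.1.symm (base p) = y.proj := by
  obtain ⟨b, u⟩ := y
  obtain ⟨v, rfl⟩ := QuotientAddGroup.mk_surjective u
  let e : atlas (Fin n → ℝ) B := ⟨chartAt (Fin n → ℝ) b, chart_mem_atlas _ _⟩
  have hb : e.1.symm (e.1 b) = b := e.1.left_inv (mem_chart_source _ _)
  have ht : e.1 b ∈ e.1.target := mem_chartAt_target b
  let k : atlas (Fin n → ℝ) B :=
    ⟨chartAt (Fin n → ℝ) (e.1.symm (e.1 b)), chart_mem_atlas _ _⟩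
  obtain ⟨M, c, -, hM⟩ := S.fderiv_chart (k := k) ht (mem_chart_source _ _)
  -- The parametrization reads angles through the derivative `M` of the change to the preferred
  -- chart, so `M⁻¹` has to be applied to `v` beforehand.
  refine ⟨e, pt (e.1 b) (castMat M⁻¹ *ᵥ v), ht, ?_, hb⟩
  refine (dualBundle_eq_iff _ _ _ _).2 ⟨hb, 0, ?_⟩
  have h1 : ∀ w : Fin n → ℝ,
      fderiv ℝ (fun s => k.1 (e.1.symm s)) (e.1 b) (castMat M⁻¹ *ᵥ w) = w := by
    intro w
    rw [hM, Matrix.mulVec_mulVec, ← castMat_mul, mul_inv_cancel, castMat_one, Matrix.one_mulVec]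
  refine Eq.trans (h1 v).symm (Eq.trans (add_zero _).symm ?_)
  congr 1
  ext
  simp

theorem baseDet_ne_zero (hω : IsSemiFlatRealOneOne ω')
    (hpos : ∀ e : atlas (Fin n → ℝ) B, ∀ r ∈ e.1.target, IsPos (semiFlatMat hω e r)) (b : B) :
    baseDet hω b ≠ 0 :=
  (hpos ⟨chartAt (Fin n → ℝ) b, chart_mem_atlas _ b⟩ _ (mem_chartAt_target b)).det_ne_zero

/-- The defining equation compares multiples of one nonzero top-degree form, so it determines `F` at
every point; positivity of `μ` makes the resulting function nowhere zero. -/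
theorem isConformalFactor_mirror_iff (S : ActionAngle n B X) (hω : IsSemiFlatRealOneOne ω')
    (hpos : ∀ e : atlas (Fin n → ℝ) B, ∀ r ∈ e.1.target, IsPos (semiFlatMat hω e r)) (F : X → ℝ) :
    IsConformalFactor S.param n S.symp (mirrorVol S ω') F ↔
      ∀ x, F x = confConst n * baseDet hω (S.proj x) := by
  have key : ∀ (e : atlas (Fin n → ℝ) B) (p : Idx n → ℝ), base p ∈ e.1.target →
      (mirrorVol S ω' e p * conjForm (mirrorVol S ω' e p) =
        (Complex.I ^ n * (F (S.param.par e p) : ℂ) / (n.factorial : ℂ)) • S.symp e p ^ n ↔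
      F (S.param.par e p) = confConst n * baseDet hω (S.proj (S.param.par e p))) := by
    intro e p hp
    have h1 : S.proj (S.param.par e p) = e.1.symm (base p) := S.proj_coord e _ hp _
    rw [mirrorVol_eq S hω hp, symp_eq, etaVol_mul_conj, smul_mixedForm_one_pow_inj,
      det_semiFlatMat S hω hp, h1]
    exact eq_comm
  constructor
  · intro h x
    obtain ⟨e, p, hp, rfl, -⟩ := S.exists_par x
    exact (key e p hp).1 (h.2 e p hp)
  · intro h
    refine ⟨fun x => ?_, fun e p hp => (key e p hp).2 (h _)⟩
    rw [h]
    exact mul_ne_zero confConst_ne_zero (baseDet_ne_zero hω hpos _)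

theorem isConformalFactor_dual_iff (S : ActionAngle n B X) (hω : IsSemiFlatRealOneOne ω')
    (hpos : ∀ e : atlas (Fin n → ℝ) B, ∀ r ∈ e.1.target, IsPos (semiFlatMat hω e r))
    (F : DualBundle n B → ℝ) :
    IsConformalFactor (dualParam n B) n ω' (dualVol n B) F ↔
      ∀ y, F y = confConst n * (baseDet hω y.proj)⁻¹ := by
  have key : ∀ (e : atlas (Fin n → ℝ) B) (p : Idx n → ℝ), base p ∈ e.1.target →
      (dualVol n B e p * conjForm (dualVol n B e p) =
        (Complex.I ^ n * (F ((dualParam n B).par e p) : ℂ) / (n.factorial : ℂ)) • ω' e p ^ n ↔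
      F ((dualParam n B).par e p) =
        confConst n * (baseDet hω ((dualParam n B).par e p).proj)⁻¹) := by
    intro e p hp
    have h1 : ((dualParam n B).par e p).proj = e.1.symm (base p) := rfl
    have h2 : Complex.I ^ n * (F ((dualParam n B).par e p) : ℂ) / (n.factorial : ℂ) *
        (((semiFlatMat hω e (base p)).det : ℝ) : ℂ) = Complex.I ^ n *
        ((F ((dualParam n B).par e p) * (semiFlatMat hω e (base p)).det : ℝ) : ℂ) /
          (n.factorial : ℂ) := by
      push_cast
      ring
    rw [dualVol_eq, semiFlat_eq hω hp, mixedForm_cmat_pow (semiFlatMat hω e (base p)),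
      etaVol_mul_conj, smul_smul, h2, smul_mixedForm_one_pow_inj, Matrix.det_one, mul_one,
      det_semiFlatMat S hω hp, h1, eq_mul_inv_iff_mul_eq₀ (baseDet_ne_zero hω hpos _)]
    exact eq_comm
  constructor
  · intro h y
    obtain ⟨e, p, hp, rfl, -⟩ := S.exists_dualParam y
    exact (key e p hp).1 (h.2 e p hp)
  · intro h
    refine ⟨fun y => ?_, fun e p hp => (key e p hp).2 (h _)⟩
    rw [h]
    exact mul_ne_zero confConst_ne_zero (inv_ne_zero (baseDet_ne_zero hω hpos _))

theorem conformalFactor_mirror (d : ℝ) :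
    confConst n * d⁻¹ = 2 ^ (2 * n) * (confConst n * d)⁻¹ := by
  have := confConst_ne_zero (n := n)
  rw [mul_inv, ← confConst_sq]
  field_simp

end Conformal

/-! ### Directional derivatives of families of forms -/

section FormDerivative

variable {ι κ : Type*} [Fintype ι] [LinearOrder ι] [Fintype κ] [LinearOrder κ]
  {E : Type*} [NormedAddCommGroup E] [NormedSpace ℝ E]

/-- The directional derivative of a family of exterior forms, coefficient by coefficient. -/
noncomputable def formDeriv (v : E) (g : E → Ext ι) (r : E) : Ext ι :=
  ∑ I, (fderiv ℝ (fun q => coeff I (g q)) r v) • mono I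

theorem coeff_formDeriv (v : E) (g : E → Ext ι) (r : E) (I : Finset ι) :
    coeff I (formDeriv v g r) = fderiv ℝ (fun q => coeff I (g q)) r v := by
  unfold formDeriv
  simp [coeff_sum, coeff_smul, coeff_mono]

theorem formDeriv_congr {v : E} {g g' : E → Ext ι} {r : E} (h : g =ᶠ[𝓝 r] g') :
    formDeriv v g r = formDeriv v g' r := by
  refine ext_coeff fun I => ?_
  rw [coeff_formDeriv, coeff_formDeriv]
  congr 1
  exact Filter.EventuallyEq.fderiv_eq (h.mono fun q hq => by simp only [hq])

theorem formDeriv_congr_of_mem {v : E} {g g' : E → Ext ι} {s : Set E} (hs : IsOpen s)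
    (h : ∀ q ∈ s, g q = g' q) {r : E} (hr : r ∈ s) : formDeriv v g r = formDeriv v g' r :=
  formDeriv_congr (Filter.eventually_of_mem (hs.mem_nhds hr) h)

theorem formDeriv_const (v : E) (x : Ext ι) (r : E) : formDeriv v (fun _ => x) r = 0 := by
  simp [formDeriv]

theorem CoeffSmoothOn.differentiableAt {g : E → Ext ι} {s : Set E} (h : CoeffSmoothOn g s)
    (hs : IsOpen s) {r : E} (hr : r ∈ s) (I : Finset ι) :
    DifferentiableAt ℝ (fun q => coeff I (g q)) r :=
  ((h I).contDiffAt (hs.mem_nhds hr)).differentiableAt (by simp)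

theorem formDeriv_map {v : E} {g : E → Ext ι} {s : Set E} (h : CoeffSmoothOn g s) (hs : IsOpen s)
    {r : E} (hr : r ∈ s) (L : Ext ι →ₗ[ℂ] Ext κ) :
    formDeriv v (fun q => L (g q)) r = L (formDeriv v g r) := by
  have key : ∀ (x : Ext ι) J, coeff J (L x) = ∑ I, coeff I x * coeff J (L (mono I)) := by
    intro x J
    conv_lhs => rw [← sum_coeff_mono x, map_sum, coeff_sum]
    simp [coeff_smul]
  refine ext_coeff fun J => ?_
  have h1 : (fun q => coeff J (L (g q))) = fun q => ∑ I, coeff I (g q) * coeff J (L (mono I)) :=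
    funext fun q => key _ _
  rw [coeff_formDeriv, key, h1]
  simp only [coeff_formDeriv]
  rw [fderiv_fun_sum fun I _ => (h.differentiableAt hs hr I).mul_const _]
  simp only [sum_apply]
  refine Finset.sum_congr rfl fun I _ => ?_
  rw [fderiv_mul_const (h.differentiableAt hs hr I)]
  simp [mul_comm]

theorem formDeriv_sum {σ : Type*} {v : E} {t : Finset σ} {g : σ → E → Ext ι} {s : Set E}
    (h : ∀ k ∈ t, CoeffSmoothOn (g k) s) (hs : IsOpen s) {r : E} (hr : r ∈ s) :
    formDeriv v (fun q => ∑ k ∈ t, g k q) r = ∑ k ∈ t, formDeriv v (g k) r := by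
  refine ext_coeff fun J => ?_
  simp only [coeff_formDeriv, coeff_sum]
  rw [fderiv_fun_sum fun k hk => (h k hk).differentiableAt hs hr J]
  simp

theorem CoeffSmoothOn.formDeriv {g : E → Ext ι} {s : Set E} (h : CoeffSmoothOn g s)
    (hs : IsOpen s) (v : E) : CoeffSmoothOn (formDeriv v g) s := fun I => by
  simp only [coeff_formDeriv]
  exact ((h I).fderiv_of_isOpen hs (m := (⊤ : ℕ∞)) (by simp)).clm_apply contDiffOn_const

theorem formDeriv_comm {g : E → Ext ι} {s : Set E} (h : CoeffSmoothOn g s) (hs : IsOpen s)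
    (u v : E) {r : E} (hr : r ∈ s) :
    formDeriv u (formDeriv v g) r = formDeriv v (formDeriv u g) r := by
  refine ext_coeff fun I => ?_
  have hc : ContDiffAt ℝ (⊤ : ℕ∞) (fun q => coeff I (g q)) r := (h I).contDiffAt (hs.mem_nhds hr)
  have hd : DifferentiableAt ℝ (fderiv ℝ fun q => coeff I (g q)) r :=
    (hc.fderiv_right (m := 1) (by norm_cast)).differentiableAt (by simp)
  have key : ∀ u v : E, coeff I (formDeriv u (formDeriv v g) r) =
      fderiv ℝ (fderiv ℝ fun q => coeff I (g q)) r u v := by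
    intro u v
    rw [coeff_formDeriv]
    simp only [coeff_formDeriv]
    rw [fderiv_clm_apply hd (differentiableAt_const v)]
    simp
  rw [key, key]
  exact (hc.isSymmSndFDerivAt (by simpa using by norm_cast)).eq u v

theorem pderiv_eq_formDeriv (i : ι) (φ : (ι → ℝ) → Ext ι) (p : ι → ℝ) :
    pderiv i φ p = formDeriv (realUnitVec i) φ p := rfl

end FormDerivative

/-! ### Differential operators on forms depending on the base coordinates only -/

section BaseForms

variable {n : ℕ}

/-- The map `base` as a continuous linear map. -/
noncomputable def baseCLM (n : ℕ) : (Idx n → ℝ) →L[ℝ] (Fin n → ℝ) :=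
  ContinuousLinearMap.pi fun i => ContinuousLinearMap.proj (bi i)

/-- The partial derivative in the `k`-th base coordinate of a form that depends on the base
coordinates only. -/
noncomputable def baseDeriv (k : Fin n) (g : (Fin n → ℝ) → Ext (Idx n)) :
    (Fin n → ℝ) → Ext (Idx n) := formDeriv (Pi.single k 1) g

variable {φ : (Idx n → ℝ) → Ext (Idx n)} {g : (Fin n → ℝ) → Ext (Idx n)} {s : Set (Fin n → ℝ)}

theorem pderiv_of_base (hg : CoeffSmoothOn g s) (hs : IsOpen s)
    (hφ : ∀ q, base q ∈ s → φ q = g (base q)) {p : Idx n → ℝ} (hp : base p ∈ s) (k : Idx n) :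
    pderiv k φ p = formDeriv (base (realUnitVec k)) g (base p) := by
  rw [pderiv_eq_formDeriv, formDeriv_congr (g' := fun q => g (baseCLM n q))
    (Filter.eventually_of_mem (continuous_base.continuousAt.preimage_mem_nhds (hs.mem_nhds hp)) hφ)]
  refine ext_coeff fun I => ?_
  rw [coeff_formDeriv, coeff_formDeriv]
  have h1 : HasFDerivAt (fun r => coeff I (g r)) (fderiv ℝ (fun r => coeff I (g r)) (base p))
      (baseCLM n p) := (hg.differentiableAt hs hp I).hasFDerivAt
  have h2 := h1.comp p (baseCLM n).hasFDerivAt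
  have h3 : (fun q => coeff I (g (baseCLM n q))) = (fun r => coeff I (g r)) ∘ baseCLM n := rfl
  rw [h3, h2.fderiv]
  rfl

theorem pderiv_bi_of_base (hg : CoeffSmoothOn g s) (hs : IsOpen s)
    (hφ : ∀ q, base q ∈ s → φ q = g (base q)) {p : Idx n → ℝ} (hp : base p ∈ s) (k : Fin n) :
    pderiv (bi k) φ p = baseDeriv k g (base p) := by
  rw [pderiv_of_base hg hs hφ hp, base_realUnitVec_bi]
  rfl

theorem pderiv_fi_of_base (hg : CoeffSmoothOn g s) (hs : IsOpen s)
    (hφ : ∀ q, base q ∈ s → φ q = g (base q)) {p : Idx n → ℝ} (hp : base p ∈ s) (k : Fin n) :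
    pderiv (fi k) φ p = 0 := by
  rw [pderiv_of_base hg hs hφ hp, base_realUnitVec_fi]
  simp [formDeriv]

theorem extd_of_base (hg : CoeffSmoothOn g s) (hs : IsOpen s)
    (hφ : ∀ q, base q ∈ s → φ q = g (base q)) {p : Idx n → ℝ} (hp : base p ∈ s) :
    extd φ p = ∑ k, cov (unitVec (bi k)) * baseDeriv k g (base p) := by
  unfold extd
  rw [sum_idx]
  simp only [pderiv_bi_of_base hg hs hφ hp, pderiv_fi_of_base hg hs hφ hp, mul_zero,
    Finset.sum_const_zero, add_zero]
  rfl

theorem extd_of_const {x : Ext (Idx n)} (hs : IsOpen s)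
    (hφ : ∀ q, base q ∈ s → φ q = x) {p : Idx n → ℝ} (hp : base p ∈ s) : extd φ p = 0 := by
  rw [extd_of_base (CoeffSmoothOn.const x s) hs hφ hp]
  simp [baseDeriv, formDeriv_const]

theorem del_of_base (hg : CoeffSmoothOn g s) (hs : IsOpen s)
    (hφ : ∀ q, base q ∈ s → φ q = g (base q)) {p : Idx n → ℝ} (hp : base p ∈ s) :
    del φ p = ∑ k, cov (dz k) * ((-Complex.I / 2) • baseDeriv k g (base p)) := by
  unfold del
  simp only [pderiv_bi_of_base hg hs hφ hp, pderiv_fi_of_base hg hs hφ hp, zero_sub, ← neg_smul,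
    smul_smul]
  refine Finset.sum_congr rfl fun k _ => ?_
  congr 2
  ring

theorem delbar_of_base (hg : CoeffSmoothOn g s) (hs : IsOpen s)
    (hφ : ∀ q, base q ∈ s → φ q = g (base q)) {p : Idx n → ℝ} (hp : base p ∈ s) :
    delbar φ p = ∑ k, cov (dzbar k) * ((Complex.I / 2) • baseDeriv k g (base p)) := by
  unfold delbar
  simp only [pderiv_bi_of_base hg hs hφ hp, pderiv_fi_of_base hg hs hφ hp, zero_add,
    smul_smul]
  refine Finset.sum_congr rfl fun k _ => ?_
  congr 2
  ring

end BaseForms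

/-! ### The adjoint Lefschetz operator and `d^Λ` -/

section Lefschetz

variable {n : ℕ}

variable (n) in
/-- The adjoint Lefschetz operator `∑ ι_(∂/∂r i) ι_(∂/∂θ i)` of the form `∑ dθ i ∧ dr i`. -/
noncomputable def stdAdj : Ext (Idx n) →ₗ[ℂ] Ext (Idx n) :=
  ∑ i : Fin n, contractBilin (unitVec (bi i)) ∘ₗ contractBilin (unitVec (fi i))

theorem stdAdj_apply (x : Ext (Idx n)) :
    stdAdj n x = ∑ i : Fin n, contract (unitVec (bi i)) (contract (unitVec (fi i)) x) := by
  simp [stdAdj, contract]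

theorem evalForm_mixedForm_one (k l : Idx n) :
    evalForm (mixedForm (cmat (1 : Matrix (Fin n) (Fin n) ℝ))) ![unitVec k, unitVec l] =
      ((fib (realUnitVec k) ⬝ᵥ base (realUnitVec l) -
        fib (realUnitVec l) ⬝ᵥ base (realUnitVec k) : ℝ) : ℂ) := by
  rw [← realVec_realUnitVec, ← realVec_realUnitVec, evalForm_mixedForm_real, Matrix.one_mulVec,
    Matrix.one_mulVec]

/-- The matrix `W` of the standard form squares to `-1`, so its inverse is `-W`. The two
off-diagonal blocks give equal sums, which absorbs the factor `1/2`. -/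
theorem lefschetzAdj_mixedForm_one (x : Ext (Idx n)) :
    lefschetzAdj (mixedForm (cmat (1 : Matrix (Fin n) (Fin n) ℝ))) x = stdAdj n x := by
  set W : Matrix (Idx n) (Idx n) ℂ := .of fun i j =>
    evalForm (mixedForm (cmat (1 : Matrix (Fin n) (Fin n) ℝ))) ![unitVec i, unitVec j] with hW
  have hbb : ∀ i j, W (bi i) (bi j) = 0 := fun i j => by simp [hW, evalForm_mixedForm_one]
  have hff : ∀ i j, W (fi i) (fi j) = 0 := fun i j => by simp [hW, evalForm_mixedForm_one]
  have hfb : ∀ i j, W (fi i) (bi j) = if i = j then 1 else 0 := fun i j => by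
    simp only [hW, Matrix.of_apply, evalForm_mixedForm_one]
    by_cases h : i = j <;> simp [h, eq_comm]
  have hbf : ∀ i j, W (bi i) (fi j) = if i = j then -1 else 0 := fun i j => by
    simp only [hW, Matrix.of_apply, evalForm_mixedForm_one]
    by_cases h : i = j <;> simp [h]
  have hinv : W⁻¹ = -W := by
    refine Matrix.inv_eq_right_inv ?_
    ext k l
    rw [Matrix.mul_apply, sum_idx]
    induction k using idx_cases with
    | hb i =>
      induction l using idx_cases with
      | hb j => by_cases h : i = j <;> simp [hbb, hfb, hbf, Matrix.one_apply, h]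
      | hf j => simp [hbb, hff, hbf]
    | hf i =>
      induction l using idx_cases with
      | hb j => simp [hbb, hff, hfb]
      | hf j => by_cases h : i = j <;> simp [hff, hfb, hbf, Matrix.one_apply, h]
  change (1 / 2 : ℂ) • ∑ i, ∑ j, W⁻¹ i j • contract (unitVec i) (contract (unitVec j) x) = _
  rw [hinv, stdAdj_apply]
  simp only [sum_idx, Matrix.neg_apply, hbb, hff, hfb, hbf, neg_zero, zero_smul,
    Finset.sum_const_zero, zero_add, add_zero, neg_ite, neg_neg, ite_smul, one_smul, neg_smul,
    Finset.sum_ite_eq, Finset.mem_univ, if_true]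
  simp only [contract_comm (unitVec (fi _)) (unitVec (bi _)), neg_neg]
  rw [← two_smul ℂ, smul_smul]
  norm_num

theorem stdAdj_dr_mul (k : Fin n) (x : Ext (Idx n)) :
    stdAdj n (cov (unitVec (bi k)) * x) =
      cov (unitVec (bi k)) * stdAdj n x - contract (unitVec (fi k)) x := by
  have h : ∀ i : Fin n, contract (unitVec (bi i)) (contract (unitVec (fi i))
      (cov (unitVec (bi k)) * x)) = cov (unitVec (bi k)) *
        contract (unitVec (bi i)) (contract (unitVec (fi i)) x) -
          if i = k then contract (unitVec (fi i)) x else 0 := by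
    intro i
    rw [contract_cov_mul, dotProduct_comm, unitVec_dotProduct, unitVec_apply, if_neg (fi_ne_bi _ _),
      zero_smul, zero_sub, contract_neg, contract_cov_mul, dotProduct_comm, unitVec_dotProduct,
      unitVec_apply]
    by_cases h : i = k <;> simp [h]
  simp only [stdAdj_apply, h, Finset.sum_sub_distrib, Finset.mul_sum, Finset.sum_ite_eq',
    Finset.mem_univ, if_true]

/-- `Λ` has constant coefficients and commutes with `∂_k`, so `d^Λ` is the sum of the commutators of
`dr k ∧` with `Λ` applied to `∂_k g`. By `stdAdj_dr_mul` these commutators are contractions with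
`∂/∂θ k`. -/
theorem extdLambda_of_base {φ ω : (Idx n → ℝ) → Ext (Idx n)} {g : (Fin n → ℝ) → Ext (Idx n)}
    {s : Set (Fin n → ℝ)} (hg : CoeffSmoothOn g s) (hs : IsOpen s)
    (hω : ∀ q, ω q = mixedForm (cmat 1))
    (hφ : ∀ q, base q ∈ s → φ q = g (base q)) {p : Idx n → ℝ} (hp : base p ∈ s) :
    extdLambda ω φ p = ∑ k, contract (unitVec (fi k)) (baseDeriv k g (base p)) := by
  unfold extdLambda
  simp only [hω, lefschetzAdj_mixedForm_one]
  rw [extd_of_base hg hs hφ hp, extd_of_base (g := fun r => stdAdj n (g r)) (hg.map (stdAdj n)) hs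
    (fun q hq => by rw [hφ q hq]) hp, map_sum, ← Finset.sum_sub_distrib]
  refine Finset.sum_congr rfl fun k _ => ?_
  rw [stdAdj_dr_mul, baseDeriv, formDeriv_map hg hs hp]
  exact sub_sub_cancel _ _

end Lefschetz

/-! ### `d d^Λ` under the transform, compared with `∂∂̄` -/

section Flux

variable {n : ℕ} {B : Type*} [TopologicalSpace B] [ChartedSpace (Fin n → ℝ) B] {X : Type*}
  {ω' : FormFamily (dualParam n B)}

/-- The semi-flat form as a function of the base coordinates. -/
noncomputable def semiFlatForm (hω : IsSemiFlatRealOneOne ω') (e : atlas (Fin n → ℝ) B)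
    (r : Fin n → ℝ) : Ext (Idx n) := mixedForm (cmat (semiFlatMat hω e r))

theorem ActionAngle.polProj_mirror (S : ActionAngle n B X) (hω : IsSemiFlatRealOneOne ω')
    {e : atlas (Fin n → ℝ) B} {p : Idx n → ℝ} (hp : base p ∈ e.1.target)
    (hpos : IsPos (semiFlatMat hω e (base p))) {k : ℕ} (hk : k ≤ n) :
    polProj (S.symp e p) (mirrorVol S ω' e p) (S.fibrePol e p) (n - k) k (mirrorVol S ω' e p) =
      fourier ((k.factorial : ℂ)⁻¹ • ((2 : ℂ) • semiFlatForm hω e (base p)) ^ k) := by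
  have h1 : annih (perp (S.symp e p) (mirrorVol S ω' e p) (S.fibrePol e p)) = fibreCov n := by
    rw [symp_eq, mirrorVol_eq S hω hp]
    exact (congrArg annih (perp_fibre hpos.det_ne_zero _)).trans annih_perp_fibre
  have h2 : annih (S.fibrePol e p : Set (Idx n → ℝ)) = baseCov n := annih_fibre
  rw [polProj, h1, h2, mirrorVol_eq_fourier S hω hp]
  exact bidegProj_fourier_exp (cmat_symm (semiFlatMat_symm hω hp)) hk

theorem cov_mul_topForm (α : Idx n → ℂ) : cov α * topForm n = 0 := by
  rw [topForm, ExteriorAlgebra.ιMulti_mul_ιMulti]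
  set v : Fin (n + n) → Idx n → ℂ :=
    Fin.append (fun i : Fin n => unitVec (fi i)) (fun i : Fin n => unitVec (bi i))
  have h : cov α * ExteriorAlgebra.ιMulti ℂ (n + n) v =
      ExteriorAlgebra.ιMulti ℂ (n + n).succ (Fin.cons α v) := by
    rw [ExteriorAlgebra.ιMulti_succ_apply]
    rfl
  rw [h]
  refine AlternatingMap.map_linearDependent _ _ fun hli => ?_
  have h1 := hli.fintype_card_le_finrank
  have h2 : Fintype.card (Idx n) = n + n := by
    rw [Fintype.card_lex, Fintype.card_sum, Fintype.card_fin]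
  rw [Module.finrank_fintype_fun_eq_card, h2, Fintype.card_fin] at h1
  omega

theorem cov_mul_mixedForm_pow (α : Idx n → ℂ) (a : Matrix (Fin n) (Fin n) ℂ) :
    cov α * mixedForm a ^ n = 0 := by
  rw [mixedForm_pow, mul_smul_comm, cov_mul_topForm, smul_zero]

theorem CoeffSmoothOn.baseDeriv {g : (Fin n → ℝ) → Ext (Idx n)} {s : Set (Fin n → ℝ)}
    (hg : CoeffSmoothOn g s) (hs : IsOpen s) (k : Fin n) : CoeffSmoothOn (baseDeriv k g) s :=
  hg.formDeriv hs _

theorem baseDeriv_map {g : (Fin n → ℝ) → Ext (Idx n)} {s : Set (Fin n → ℝ)}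
    (hg : CoeffSmoothOn g s) (hs : IsOpen s) {r : Fin n → ℝ} (hr : r ∈ s) (k : Fin n)
    (L : Ext (Idx n) →ₗ[ℂ] Ext (Idx n)) :
    baseDeriv k (fun r => L (g r)) r = L (baseDeriv k g r) := formDeriv_map hg hs hr L

theorem baseDeriv_cov_mul {g : (Fin n → ℝ) → Ext (Idx n)} {s : Set (Fin n → ℝ)}
    (hg : CoeffSmoothOn g s) (hs : IsOpen s) {r : Fin n → ℝ} (hr : r ∈ s) (k : Fin n)
    (α : Idx n → ℂ) :
    baseDeriv k (fun r => cov α * g r) r = cov α * baseDeriv k g r :=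
  formDeriv_map hg hs hr (LinearMap.mulLeft ℂ (cov α))

theorem baseDeriv_smul {g : (Fin n → ℝ) → Ext (Idx n)} {s : Set (Fin n → ℝ)}
    (hg : CoeffSmoothOn g s) (hs : IsOpen s) {r : Fin n → ℝ} (hr : r ∈ s) (k : Fin n) (c : ℂ) :
    baseDeriv k (fun r => c • g r) r = c • baseDeriv k g r := by
  have h := baseDeriv_map hg hs hr k (c • LinearMap.id)
  simpa only [LinearMap.smul_apply, LinearMap.id_apply] using h

theorem CoeffSmoothOn.cov_mul {g : (Fin n → ℝ) → Ext (Idx n)} {s : Set (Fin n → ℝ)}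
    (hg : CoeffSmoothOn g s) (α : Idx n → ℂ) : CoeffSmoothOn (fun r => cov α * g r) s :=
  hg.map (LinearMap.mulLeft ℂ (cov α))

theorem CoeffSmoothOn.const_smul {g : (Fin n → ℝ) → Ext (Idx n)} {s : Set (Fin n → ℝ)}
    (hg : CoeffSmoothOn g s) (c : ℂ) : CoeffSmoothOn (fun r => c • g r) s :=
  CoeffSmoothOn.smul contDiffOn_const hg

/-- Multiplication by a covector commutes with second derivatives, so these agree on two forms
whose products with the covector agree. -/
theorem cov_mul_baseDeriv_baseDeriv_congr {g g' : (Fin n → ℝ) → Ext (Idx n)}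
    {s : Set (Fin n → ℝ)} (hg : CoeffSmoothOn g s) (hg' : CoeffSmoothOn g' s) (hs : IsOpen s)
    {r : Fin n → ℝ} (hr : r ∈ s) {α : Idx n → ℂ} (h : ∀ q ∈ s, cov α * g q = cov α * g' q)
    (k l : Fin n) :
    cov α * baseDeriv k (baseDeriv l g) r = cov α * baseDeriv k (baseDeriv l g') r := by
  rw [← baseDeriv_cov_mul (hg.baseDeriv hs l) hs hr, ← baseDeriv_cov_mul (hg'.baseDeriv hs l) hs hr]
  refine formDeriv_congr_of_mem hs (fun q hq => ?_) hr
  rw [← baseDeriv_cov_mul hg hs hq, ← baseDeriv_cov_mul hg' hs hq]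
  exact formDeriv_congr_of_mem hs h hq

variable {φ : (Idx n → ℝ) → Ext (Idx n)} {g : (Fin n → ℝ) → Ext (Idx n)} {s : Set (Fin n → ℝ)}

theorem extd_extdLambda_fourier {ω : (Idx n → ℝ) → Ext (Idx n)} (hg : CoeffSmoothOn g s)
    (hs : IsOpen s) (hω : ∀ q, ω q = mixedForm (cmat 1))
    (hφ : ∀ q, base q ∈ s → φ q = fourier (g (base q))) {p : Idx n → ℝ} (hp : base p ∈ s) :
    extd (extdLambda ω φ) p = ∑ k, ∑ l, cov (unitVec (bi k)) *
      contract (unitVec (fi l)) (fourier (baseDeriv k (baseDeriv l g) (base p))) := by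
  have h1 : ∀ q, base q ∈ s → extdLambda ω φ q =
      ∑ l, (contractBilin (unitVec (fi l)) ∘ₗ fourier) (baseDeriv l g (base q)) := by
    intro q hq
    rw [extdLambda_of_base (g := fun r => fourier (g r)) (hg.map fourier) hs hω hφ hq]
    refine Finset.sum_congr rfl fun l _ => ?_
    rw [baseDeriv_map hg hs hq]
    rfl
  have h2 : ∀ l, CoeffSmoothOn (fun r => (contractBilin (unitVec (fi l)) ∘ₗ fourier)
      (baseDeriv l g r)) s := fun l => (hg.baseDeriv hs l).map _
  rw [extd_of_base (g := fun r => ∑ l, (contractBilin (unitVec (fi l)) ∘ₗ fourier)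
    (baseDeriv l g r)) (CoeffSmoothOn.sum fun l _ => h2 l) hs h1 hp]
  refine Finset.sum_congr rfl fun k _ => ?_
  rw [baseDeriv, formDeriv_sum (fun l _ => h2 l) hs hp, Finset.mul_sum]
  refine Finset.sum_congr rfl fun l _ => ?_
  congr 1
  exact baseDeriv_map (hg.baseDeriv hs l) hs hp k _

theorem del_delbar_of_base (hg : CoeffSmoothOn g s) (hs : IsOpen s)
    (hφ : ∀ q, base q ∈ s → φ q = g (base q)) {p : Idx n → ℝ} (hp : base p ∈ s) :
    del (delbar φ) p = (1 / 4 : ℂ) • ∑ k, ∑ l, cov (dz k) *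
      (cov (dzbar l) * baseDeriv k (baseDeriv l g) (base p)) := by
  have h2 : ∀ l, CoeffSmoothOn (fun r => cov (dzbar l) * ((Complex.I / 2) • baseDeriv l g r)) s :=
    fun l => ((hg.baseDeriv hs l).const_smul _).cov_mul _
  rw [del_of_base (g := fun r => ∑ l, cov (dzbar l) * ((Complex.I / 2) • baseDeriv l g r))
    (CoeffSmoothOn.sum fun l _ => h2 l) hs (fun q hq => delbar_of_base hg hs hφ hq) hp,
    Finset.smul_sum]
  refine Finset.sum_congr rfl fun k _ => ?_
  rw [baseDeriv, formDeriv_sum (fun l _ => h2 l) hs hp, Finset.smul_sum, Finset.smul_sum,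
    Finset.mul_sum]
  refine Finset.sum_congr rfl fun l _ => ?_
  have h3 := (baseDeriv_cov_mul ((hg.baseDeriv hs l).const_smul (Complex.I / 2)) hs hp k
    (dzbar l)).trans (congrArg (cov (dzbar l) * ·)
      (baseDeriv_smul (hg.baseDeriv hs l) hs hp k (Complex.I / 2)))
  rw [baseDeriv] at h3
  rw [h3]
  simp only [mul_smul_comm, smul_smul]
  congr 1
  linear_combination (-1 / 4 : ℂ) * Complex.I_sq

/-- The operators become `conj (dz k) ∧ dz l ∧`, with a minus sign from `fourierDual_contract`.
Reordering the two covectors cancels the minus, and symmetry of `Y`, meant for second derivatives,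
allows the indices to be swapped. -/
theorem fourierDual_sum_flux (Y : Fin n → Fin n → Ext (Idx n)) (hY : ∀ k l, Y k l = Y l k) :
    fourierDual (∑ k, ∑ l, cov (unitVec (bi k)) *
      contract (unitVec (fi l)) (fourier (Y k l))) =
      revSign n • ∑ k, ∑ l, cov (dz k) * (cov (dzbar l) * Y k l) := by
  have hs : (-1 : ℂ) ^ (n * 2) = 1 := by
    rw [mul_comm, pow_mul]
    simp
  simp only [map_sum, fourierDual_dr_mul, fourierDual_contract, fourierDual_fourier,
    mul_smul_comm, smul_smul]
  rw [Finset.sum_comm, Finset.smul_sum]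
  refine Finset.sum_congr rfl fun l _ => ?_
  rw [Finset.smul_sum]
  refine Finset.sum_congr rfl fun k _ => ?_
  rw [cov_mul_comm_assoc, hY, smul_neg, ← neg_smul]
  congr 1
  linear_combination revSign n * hs

end Flux

/-! ### Comparison of the two fluxes -/

section FluxTransform

variable {n : ℕ} {B : Type*} [TopologicalSpace B] [ChartedSpace (Fin n → ℝ) B] {X : Type*}
  {ω' : FormFamily (dualParam n B)}

theorem baseDeriv_baseDeriv_smul {g : (Fin n → ℝ) → Ext (Idx n)} {s : Set (Fin n → ℝ)}
    (hg : CoeffSmoothOn g s) (hs : IsOpen s) {r : Fin n → ℝ} (hr : r ∈ s) (k l : Fin n) (c : ℂ) :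
    baseDeriv k (baseDeriv l fun r => c • g r) r = c • baseDeriv k (baseDeriv l g) r := by
  rw [← baseDeriv_smul (hg.baseDeriv hs l) hs hr]
  exact formDeriv_congr_of_mem hs (fun q hq => baseDeriv_smul hg hs hq l c) hr

theorem semiFlatForm_smooth (hω : IsSemiFlatRealOneOne ω') (e : atlas (Fin n → ℝ) B) :
    CoeffSmoothOn (semiFlatForm hω e) e.1.target := semiFlat_smooth hω e

/-- The form `F (π^(n-1,1) Ω + π^(0,n) Ω)` before the Fourier-Mukai transform. -/
noncomputable def fluxPotential (hω : IsSemiFlatRealOneOne ω') (e : atlas (Fin n → ℝ) B)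
    (r : Fin n → ℝ) : Ext (Idx n) :=
  ((confConst n : ℂ) * ((semiFlatMat hω e r).det : ℂ)) •
    (((1 : ℕ).factorial : ℂ)⁻¹ • ((2 : ℂ) • semiFlatForm hω e r) ^ 1 +
      (n.factorial : ℂ)⁻¹ • ((2 : ℂ) • semiFlatForm hω e r) ^ n)

/-- The form `F⁻¹ ω` on the dual bundle. -/
noncomputable def dualPotential (hω : IsSemiFlatRealOneOne ω') (e : atlas (Fin n → ℝ) B)
    (r : Fin n → ℝ) : Ext (Idx n) :=
  (((confConst n)⁻¹ : ℂ) * ((semiFlatMat hω e r).det : ℂ)) • semiFlatForm hω e r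

theorem fluxPotential_smooth (hω : IsSemiFlatRealOneOne ω') (e : atlas (Fin n → ℝ) B) :
    CoeffSmoothOn (fluxPotential hω e) e.1.target :=
  CoeffSmoothOn.smul (contDiffOn_const.mul (semiFlatMat_det_smooth hω e))
    (((((semiFlatForm_smooth hω e).const_smul 2).pow 1).const_smul _).add
      ((((semiFlatForm_smooth hω e).const_smul 2).pow n).const_smul _))

theorem dualPotential_smooth (hω : IsSemiFlatRealOneOne ω') (e : atlas (Fin n → ℝ) B) :
    CoeffSmoothOn (dualPotential hω e) e.1.target :=
  CoeffSmoothOn.smul (contDiffOn_const.mul (semiFlatMat_det_smooth hω e))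
    (semiFlatForm_smooth hω e)

/-- The term from `π^(0,n) Ω` is of top degree and is annihilated by any covector. What remains is
`2 F ω̌`, and the product of the two conformal factors is `confConst² = 2^(2n)`. -/
theorem cov_mul_fluxPotential (hω : IsSemiFlatRealOneOne ω') (e : atlas (Fin n → ℝ) B)
    (r : Fin n → ℝ) (α : Idx n → ℂ) : cov α * fluxPotential hω e r =
      cov α * ((2 ^ (2 * n + 1) : ℂ) • dualPotential hω e r) := by
  have h : (2 : ℂ) ^ (2 * n) = (confConst n : ℂ) * (confConst n : ℂ) := by
    rw [← Complex.ofReal_mul, confConst_sq]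
    simp
  have h0 : (confConst n : ℂ) ≠ 0 := Complex.ofReal_ne_zero.2 confConst_ne_zero
  rw [fluxPotential, dualPotential, smul_pow _ _ n, semiFlatForm, mul_smul_comm, mul_add,
    mul_smul_comm, mul_smul_comm, mul_smul_comm, cov_mul_mixedForm_pow, smul_zero, smul_zero, add_zero,
    pow_one, mul_smul_comm, mul_smul_comm, mul_smul_comm, smul_smul, smul_smul, smul_smul, pow_succ, h,
    Nat.factorial_one, Nat.cast_one]
  congr 1
  field_simp

theorem FTdual_fluxA (hn : 0 < n) (S : ActionAngle n B X) (hω : IsSemiFlatRealOneOne ω')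
    (hpos : ∀ e : atlas (Fin n → ℝ) B, ∀ r ∈ e.1.target, IsPos (semiFlatMat hω e r)) {F : X → ℝ}
    (hF : ∀ x, F x = confConst n * baseDet hω (S.proj x)) {e : atlas (Fin n → ℝ) B}
    {p : Idx n → ℝ} (hp : base p ∈ e.1.target) :
    FTdual S (fluxA S.param n S.symp (mirrorVol S ω') S.fibrePol F) e p =
      -Complex.I • revSign n • ∑ k, ∑ l, cov (dz k) * (cov (dzbar l) *
        baseDeriv k (baseDeriv l (fluxPotential hω e)) (base p)) := by
  have hφ : ∀ q, base q ∈ e.1.target → (F (S.param.par e q) : ℂ) •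
      (polProj (S.symp e q) (mirrorVol S ω' e q) (S.fibrePol e q) (n - 1) 1 (mirrorVol S ω' e q) +
        polProj (S.symp e q) (mirrorVol S ω' e q) (S.fibrePol e q) 0 n (mirrorVol S ω' e q)) =
      fourier (fluxPotential hω e (base q)) := by
    intro q hq
    have h1 : S.proj (S.param.par e q) = e.1.symm (base q) := S.proj_coord e _ hq _
    have h2 := S.polProj_mirror hω hq (hpos e _ hq) le_rfl
    rw [Nat.sub_self] at h2
    rw [S.polProj_mirror hω hq (hpos e _ hq) (Nat.one_le_of_lt hn), h2, hF, h1,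
      ← det_semiFlatMat S hω hq, ← map_add, ← map_smul, Complex.ofReal_mul]
    rfl
  have key : ∀ t, fluxA S.param n S.symp (mirrorVol S ω') S.fibrePol F e (pt (base p) t) =
      -Complex.I • ∑ k, ∑ l, cov (unitVec (bi k)) * contract (unitVec (fi l))
        (fourier (baseDeriv k (baseDeriv l (fluxPotential hω e)) (base p))) := by
    intro t
    exact congrArg (-Complex.I • ·) (extd_extdLambda_fourier (fluxPotential_smooth hω e)
      e.1.open_target (symp_eq S e) hφ (p := pt (base p) t) hp)
  rw [FTdual_eq S key, map_smul]
  exact congrArg (-Complex.I • ·) (fourierDual_sum_flux _ fun k l =>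
    formDeriv_comm (fluxPotential_smooth hω e) e.1.open_target _ _ hp)

theorem fluxB_eq (S : ActionAngle n B X) (hω : IsSemiFlatRealOneOne ω') {F : DualBundle n B → ℝ}
    (hF : ∀ y, F y = confConst n * (baseDet hω y.proj)⁻¹) {e : atlas (Fin n → ℝ) B}
    {p : Idx n → ℝ} (hp : base p ∈ e.1.target) :
    fluxB ω' F e p = (Complex.I / 2) • ∑ k, ∑ l, cov (dz k) * (cov (dzbar l) *
      baseDeriv k (baseDeriv l (dualPotential hω e)) (base p)) := by
  have hφ : ∀ q, base q ∈ e.1.target →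
      (((F ((dualParam n B).par e q))⁻¹ : ℝ) : ℂ) • ω' e q = dualPotential hω e (base q) := by
    intro q hq
    have h1 : ((dualParam n B).par e q).proj = e.1.symm (base q) := rfl
    rw [hF, h1, ← det_semiFlatMat S hω hq, semiFlat_eq hω hq, mul_inv, inv_inv]
    push_cast
    rfl
  refine (congrArg ((2 * Complex.I) • ·) (del_delbar_of_base (dualPotential_smooth hω e)
    e.1.open_target hφ hp)).trans ?_
  rw [smul_smul]
  congr 1
  ring

variable (n) in
/-- The constant that relates the two fluxes. -/
noncomputable def fluxConst : ℝ :=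
  -((Equiv.Perm.sign (Fin.revPerm : Equiv.Perm (Fin n)) : ℤ) : ℝ) * 2 ^ (2 * n + 2)

theorem fluxConst_cast : (fluxConst n : ℂ) = -revSign n * 2 ^ (2 * n + 2) := by
  simp [fluxConst, revSign]

theorem fluxConst_ne_zero : fluxConst n ≠ 0 := by
  have h : (fluxConst n : ℂ) ≠ 0 := by
    rw [fluxConst_cast]
    exact mul_ne_zero (neg_ne_zero.2 (revSign_ne_zero n)) (pow_ne_zero _ two_ne_zero)
  exact_mod_cast h

theorem FTdual_fluxA_eq_fluxB (hn : 0 < n) (S : ActionAngle n B X) (hω : IsSemiFlatRealOneOne ω')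
    (hpos : ∀ e : atlas (Fin n → ℝ) B, ∀ r ∈ e.1.target, IsPos (semiFlatMat hω e r)) {F : X → ℝ}
    (hF : ∀ x, F x = confConst n * baseDet hω (S.proj x)) {F' : DualBundle n B → ℝ}
    (hF' : ∀ y, F' y = confConst n * (baseDet hω y.proj)⁻¹) {e : atlas (Fin n → ℝ) B}
    {p : Idx n → ℝ} (hp : base p ∈ e.1.target) :
    FTdual S (fluxA S.param n S.symp (mirrorVol S ω') S.fibrePol F) e p =
      (fluxConst n : ℂ) • fluxB ω' F' e p := by
  have h : ∀ k l, cov (dzbar l) * baseDeriv k (baseDeriv l (fluxPotential hω e)) (base p) =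
      (2 ^ (2 * n + 1) : ℂ) • (cov (dzbar l) *
        baseDeriv k (baseDeriv l (dualPotential hω e)) (base p)) := by
    intro k l
    rw [cov_mul_baseDeriv_baseDeriv_congr (fluxPotential_smooth hω e)
      ((dualPotential_smooth hω e).const_smul (2 ^ (2 * n + 1))) e.1.open_target hp
      fun q _ => cov_mul_fluxPotential hω e q (dzbar l),
      baseDeriv_baseDeriv_smul (dualPotential_smooth hω e) e.1.open_target hp, mul_smul_comm]
  rw [FTdual_fluxA hn S hω hpos hF hp, fluxB_eq S hω hF' hp]
  simp only [h, mul_smul_comm, ← Finset.smul_sum]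
  -- The coefficients `-i revSign 2^(2n+1)` and `i/2` of the same sum fix the value of `fluxConst`.
  rw [smul_smul, smul_smul, smul_smul, fluxConst_cast]
  congr 1
  ring

end FluxTransform

/-! ### The symmetry that exchanges `dθ̌` and `dr` -/

section Balanced

variable {n : ℕ}

variable (n) in
/-- The exchange of `dθ i` and `dr i`. -/
noncomputable def exchange : Ext (Idx n) →ₐ[ℂ] Ext (Idx n) :=
  extHom fun k => Sum.elim (fun i => unitVec (fi i)) (fun i => unitVec (bi i)) (ofLex k)

theorem exchange_fi (i : Fin n) : exchange n (cov (unitVec (fi i))) = cov (unitVec (bi i)) := by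
  unfold exchange
  rw [extHom_unitVec]
  rfl

theorem exchange_bi (i : Fin n) : exchange n (cov (unitVec (bi i))) = cov (unitVec (fi i)) := by
  unfold exchange
  rw [extHom_unitVec]
  rfl

theorem exchange_dzbar (i : Fin n) :
    exchange n (cov (dzbar i)) = -Complex.I • cov (dz i) := by
  rw [dzbar, dz, cov_sub, cov_smul, map_sub, map_smul, exchange_fi, exchange_bi, cov_add, cov_smul,
    smul_add, smul_smul, neg_mul, Complex.I_mul_I, neg_neg, one_smul, neg_smul, sub_eq_add_neg,
    add_comm]

theorem exchange_mixedForm {a : Matrix (Fin n) (Fin n) ℂ} (ha : a.IsSymm) :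
    exchange n (mixedForm a) = -mixedForm a := by
  simp only [mixedForm, map_sum, map_smul, map_mul, exchange_fi, exchange_bi]
  rw [Finset.sum_comm, ← Finset.sum_neg_distrib]
  refine Finset.sum_congr rfl fun i _ => ?_
  rw [← Finset.sum_neg_distrib]
  refine Finset.sum_congr rfl fun j _ => ?_
  rw [cov_mul_comm, smul_neg, ha.apply]

/-- For forms that the exchange of `dθ` and `dr` multiplies by a sign, `∑ conj (dz k) ∧ v k`
vanishes if and only if `∑ dr k ∧ v k` does. -/
theorem sum_dzbar_mul_eq_zero_iff {v : Fin n → Ext (Idx n)} {c : ℂ} (hc : c ≠ 0)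
    (hv : ∀ k, exchange n (v k) = c • v k) :
    ∑ k, cov (dzbar k) * v k = 0 ↔ ∑ k, cov (unitVec (bi k)) * v k = 0 := by
  constructor
  · intro h
    -- The exchange turns the sum with `conj (dz k)` into one with `dz k`; the difference of the two
    -- is `2i` times the sum with `dr k`.
    have h1 : (-Complex.I * c) • ∑ k, cov (dz k) * v k = 0 := by
      have := congrArg (exchange n) h
      simpa only [map_sum, map_mul, exchange_dzbar, hv, map_zero, smul_mul_smul_comm,
        ← Finset.smul_sum] using this
    have h2 : ∑ k, cov (dz k) * v k = 0 :=
      (smul_eq_zero.1 h1).resolve_left (mul_ne_zero (neg_ne_zero.2 Complex.I_ne_zero) hc)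
    have h3 : (2 * Complex.I) • ∑ k, cov (unitVec (bi k)) * v k =
        ∑ k, cov (dz k) * v k - ∑ k, cov (dzbar k) * v k := by
      rw [← Finset.sum_sub_distrib, Finset.smul_sum]
      refine Finset.sum_congr rfl fun k _ => ?_
      rw [← sub_mul, ← smul_mul_assoc, ← cov_sub, ← cov_smul, dz, dzbar, add_sub_sub_cancel,
        ← two_smul ℂ, smul_smul]
    rw [h, h2, sub_zero] at h3
    exact (smul_eq_zero.1 h3).resolve_left (mul_ne_zero two_ne_zero Complex.I_ne_zero)
  · intro h
    -- Here the exchange yields the sum with `dθ̌ k`, and `conj (dz k) = dθ̌ k - i dr k`.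
    have h1 : c • ∑ k, cov (unitVec (fi k)) * v k = 0 := by
      have := congrArg (exchange n) h
      simpa only [map_sum, map_mul, exchange_bi, hv, map_zero, mul_smul_comm,
        ← Finset.smul_sum] using this
    have h2 : ∑ k, cov (unitVec (fi k)) * v k = 0 := (smul_eq_zero.1 h1).resolve_left hc
    have h3 : ∑ k, cov (dzbar k) * v k = ∑ k, cov (unitVec (fi k)) * v k -
        Complex.I • ∑ k, cov (unitVec (bi k)) * v k := by
      rw [Finset.smul_sum, ← Finset.sum_sub_distrib]
      refine Finset.sum_congr rfl fun k _ => ?_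
      rw [dzbar, cov_sub, cov_smul, sub_mul, smul_mul_assoc]
    rw [h3, h2, h, smul_zero, sub_zero]

end Balanced

/-! ### Equivalence of Type IIA and Type IIB -/

section Supersymmetry

variable {n : ℕ} {B : Type*} [TopologicalSpace B] [ChartedSpace (Fin n → ℝ) B] {X : Type*}
  {ω' : FormFamily (dualParam n B)}

theorem ActionAngle.mem_fibrePol (S : ActionAngle n B X) (e : atlas (Fin n → ℝ) B)
    (p v : Idx n → ℝ) : v ∈ S.fibrePol e p ↔ base v = 0 := by
  constructor
  · intro h
    refine Submodule.span_induction (p := fun v _ => base v = 0) ?_ rfl ?_ ?_ h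
    · rintro _ ⟨i, rfl⟩
      exact base_realUnitVec_fi i
    · intro x y _ _ hx hy
      change base x + base y = 0
      rw [hx, hy, add_zero]
    · intro c x _ hx
      change c • base x = 0
      rw [hx, smul_zero]
  · intro h
    have h1 : v = ∑ i, fib v i • (realUnitVec (fi i) : Idx n → ℝ) := by
      refine funext fun k => ?_
      rw [Finset.sum_apply]
      induction k using idx_cases with
      | hb j => simpa [realUnitVec, base] using congrFun h j
      | hf j => simp [realUnitVec, Pi.single_apply, fib]
    rw [h1]
    exact Submodule.sum_mem _ fun i _ => Submodule.smul_mem _ _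
      (Submodule.subset_span (Set.mem_range_self i))

theorem ActionAngle.fibrePol_eq_ker (S : ActionAngle n B X) (e : atlas (Fin n → ℝ) B)
    (p : Idx n → ℝ) : S.fibrePol e p = LinearMap.ker (baseCLM n).toLinearMap := by
  ext v
  exact S.mem_fibrePol e p v

theorem isRealPolarization_fibrePol (S : ActionAngle n B X) :
    IsRealPolarization S.param n S.symp Set.univ S.fibrePol where
  isOpen e := by
    have h : {p | p ∈ S.param.dom e ∧ S.param.par e p ∈ Set.univ} =
        (base : (Idx n → ℝ) → _) ⁻¹' (show atlas (Fin n → ℝ) B from e).1.target := by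
      ext p
      exact and_iff_left trivial
    rw [h]
    exact (show atlas (Fin n → ℝ) B from e).1.open_target.preimage continuous_base
  dense e p hp := subset_closure ⟨hp, trivial⟩
  compat e e' p τ h _ := by
    obtain ⟨A, c, -, -, -, hA⟩ := S.fderiv_transition h
    ext v
    rw [hA]
    refine (S.mem_fibrePol e p v).trans (Iff.trans ?_ (S.mem_fibrePol e' (τ p) _).symm)
    change base v = 0 ↔ castMat A *ᵥ base v = 0
    refine ⟨fun hv => by rw [hv, Matrix.mulVec_zero], fun hv => ?_⟩
    rw [← Matrix.one_mulVec (base v), ← castMat_inv_mul A, ← Matrix.mulVec_mulVec, hv,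
      Matrix.mulVec_zero]
  integrable e p _ _ := by
    refine ⟨baseCLM n, (baseCLM n).contDiff.contDiffAt, Filter.Eventually.of_forall fun q => ?_⟩
    rw [ContinuousLinearMap.fderiv]
    exact S.fibrePol_eq_ker e q
  finrank_eq e p _ _ := by
    have hli : LinearIndependent ℝ fun i : Fin n => (realUnitVec (fi i) : Idx n → ℝ) := by
      have := (Pi.basisFun ℝ (Idx n)).linearIndependent.comp (fi : Fin n → Idx n)
        fun i j h => (fi_inj i j).1 h
      have h1 : (Pi.basisFun ℝ (Idx n)) ∘ (fi : Fin n → Idx n) =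
          fun i : Fin n => (realUnitVec (fi i) : Idx n → ℝ) := by
        ext i k
        simp [realUnitVec, Pi.single_apply]
      rwa [h1] at this
    exact (finrank_span_eq_card hli).trans (Fintype.card_fin n)
  lagrangian e p _ _ u hu v hv := by
    refine (congrArg (fun x => evalForm x ![realVec u, realVec v]) (symp_eq S e p)).trans ?_
    rw [evalForm_mixedForm_real, (S.mem_fibrePol e p u).1 hu, (S.mem_fibrePol e p v).1 hv]
    simp

theorem isSpecial_fibrePol (S : ActionAngle n B X) (hω : IsSemiFlatRealOneOne ω') :
    IsSpecial S.param n (mirrorVol S ω') Set.univ S.fibrePol 0 := by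
  intro e p hp _
  -- The fibre vectors are listed in the reversed order in which the factors of `Ω` occur, so `Ω`
  -- takes the value 1 on them and the phase is 0.
  refine ⟨fun k => realUnitVec (fi (Fin.revPerm k)), fun k => Submodule.subset_span ⟨_, rfl⟩,
    1, one_pos, ?_⟩
  have h : evalForm (etaVol (semiFlatMat hω e (base p)) Fin.revPerm)
      (fun k => realVec (realUnitVec (fi (Fin.revPerm k)))) = 1 := by
    rw [evalForm, foldl_contract, etaVol, ExteriorAlgebra.ιMulti_apply]
    refine (congrArg ExteriorAlgebra.algebraMapInv
      (contractList_prod_of_dual _ _ fun i j => ?_)).trans (map_one _)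
    rw [realVec_realUnitVec]
    exact etaVol_dual _ _ i j
  rw [mirrorVol_eq S hω hp, h]
  simp

/-- Only `π^(1,n-1) Ω` imposes a condition: `ω` has constant coefficients, and so does `π^(n,0) Ω`,
the transform of `1`. The condition is moved to the dual bundle by injectivity of `fourier`, which
turns `conj (dz k) ∧` into `dr k ∧`. -/
theorem isTypeIIA_iff (S : ActionAngle n B X) (hn : 0 < n) (hω : IsSemiFlatRealOneOne ω') :
    IsTypeIIA S.param n S.symp (mirrorVol S ω') Set.univ S.fibrePol ↔
      IsSU S.param n S.symp (mirrorVol S ω') ∧ ∀ (e : atlas (Fin n → ℝ) B), ∀ r ∈ e.1.target,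
        ∑ k, cov (dzbar k) * baseDeriv k (fun r => semiFlatForm hω e r ^ (n - 1)) r = 0 := by
  have key : ∀ (_ : IsSU S.param n S.symp (mirrorVol S ω')) (e : atlas (Fin n → ℝ) B)
      (p : Idx n → ℝ) (_ : base p ∈ e.1.target),
      (extd (fun q => polProj (S.symp e q) (mirrorVol S ω' e q) (S.fibrePol e q) 1 (n - 1)
        (mirrorVol S ω' e q)) p = 0 ↔ ∑ k, cov (dzbar k) *
          baseDeriv k (fun r => semiFlatForm hω e r ^ (n - 1)) (base p) = 0) := by
    intro hsu e p hp
    have hpos := (isSU_mirror_iff S hω).1 hsu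
    have hsm : CoeffSmoothOn (fun r => semiFlatForm hω e r ^ (n - 1)) e.1.target :=
      (semiFlatForm_smooth hω e).pow _
    set c : ℂ := ((n - 1).factorial : ℂ)⁻¹ * 2 ^ (n - 1) with hc
    have hc0 : c ≠ 0 := mul_ne_zero (inv_ne_zero (Nat.cast_ne_zero.2 (Nat.factorial_ne_zero _)))
      (pow_ne_zero _ two_ne_zero)
    have h1 : ∀ q, base q ∈ e.1.target → polProj (S.symp e q) (mirrorVol S ω' e q) (S.fibrePol e q)
        1 (n - 1) (mirrorVol S ω' e q) =
          (c • fourier) (semiFlatForm hω e (base q) ^ (n - 1)) := by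
      intro q hq
      have := S.polProj_mirror hω hq (hpos e _ hq) (Nat.sub_le n 1)
      rw [Nat.sub_sub_self hn] at this
      rw [this, smul_pow, smul_smul, map_smul]
      rfl
    have h2 : ∀ k, baseDeriv k (fun r => (c • fourier) (semiFlatForm hω e r ^ (n - 1))) (base p) =
        c • fourier (baseDeriv k (fun r => semiFlatForm hω e r ^ (n - 1)) (base p)) :=
      fun k => baseDeriv_map hsm e.1.open_target hp k (c • fourier)
    have h3 : (-1 : ℂ) ^ n ≠ 0 := pow_ne_zero _ (neg_ne_zero.2 one_ne_zero)
    have h4 : (-1 : ℂ) ^ n • extd (fun q => polProj (S.symp e q) (mirrorVol S ω' e q)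
        (S.fibrePol e q) 1 (n - 1) (mirrorVol S ω' e q)) p = c • fourier (∑ k, cov (dzbar k) *
          baseDeriv k (fun r => semiFlatForm hω e r ^ (n - 1)) (base p)) := by
      rw [extd_of_base (hsm.map (c • fourier)) e.1.open_target h1 hp]
      simp only [h2, map_sum, fourier_dzbar_mul, Finset.smul_sum, mul_smul_comm]
      exact Finset.sum_congr rfl fun k _ => smul_comm _ _ _
    constructor
    · intro h
      rw [h, smul_zero] at h4
      exact fourier_injective (((smul_eq_zero.1 h4.symm).resolve_left hc0).trans (map_zero _).symm)
    · intro h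
      rw [h, map_zero, smul_zero] at h4
      exact (smul_eq_zero.1 h4).resolve_left h3
  constructor
  · exact fun h => ⟨h.su, fun e r hr =>
      (key h.su e (pt r 0) hr).1 (h.closed_right e (pt r 0) hr trivial)⟩
  · rintro ⟨hsu, h⟩
    refine ⟨hsu, isRealPolarization_fibrePol S, ⟨0, isSpecial_fibrePol S hω⟩, fun e p hp => ?_,
      fun e p hp _ => ?_, fun e p hp _ => (key hsu e p hp).2 (h e _ hp)⟩
    · exact extd_of_const (show atlas (Fin n → ℝ) B from e).1.open_target
        (fun q _ => symp_eq S e q) hp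
    · refine extd_of_const (x := fourier 1) (show atlas (Fin n → ℝ) B from e).1.open_target
        (fun q hq => ?_) hp
      refine (S.polProj_mirror hω hq ((isSU_mirror_iff S hω).1 hsu e _ hq) n.zero_le).trans ?_
      simp

theorem isTypeIIB_iff (hω : IsSemiFlatRealOneOne ω') :
    IsTypeIIB (dualParam n B) n ω' (dualVol n B) ↔
      IsSU (dualParam n B) n ω' (dualVol n B) ∧ ∀ (e : atlas (Fin n → ℝ) B), ∀ r ∈ e.1.target,
        ∑ k, cov (unitVec (bi k)) *
          baseDeriv k (fun r => semiFlatForm hω e r ^ (n - 1)) r = 0 := by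
  have key : ∀ (e : atlas (Fin n → ℝ) B) (p : Idx n → ℝ) (_ : base p ∈ e.1.target),
      extd (fun q => ω' e q ^ (n - 1)) p = ∑ k, cov (unitVec (bi k)) *
        baseDeriv k (fun r => semiFlatForm hω e r ^ (n - 1)) (base p) := fun e p hp =>
    extd_of_base ((semiFlatForm_smooth hω e).pow _) e.1.open_target
      (fun q hq => by rw [semiFlat_eq hω hq]; rfl) hp
  constructor
  · exact fun h => ⟨h.su, fun e r hr =>
      (key e (pt r 0) hr).symm.trans (h.balanced e (pt r 0) hr)⟩
  · rintro ⟨hsu, h⟩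
    exact ⟨hsu, fun e p hp => extd_of_const (show atlas (Fin n → ℝ) B from e).1.open_target
      (fun q _ => dualVol_eq e q) hp, fun e p hp => (key e p hp).trans (h e _ hp)⟩

theorem isTypeIIA_iff_isTypeIIB (S : ActionAngle n B X) (hn : 0 < n)
    (hω : IsSemiFlatRealOneOne ω') :
    IsTypeIIA S.param n S.symp (mirrorVol S ω') Set.univ S.fibrePol ↔
      IsTypeIIB (dualParam n B) n ω' (dualVol n B) := by
  rw [isTypeIIA_iff S hn hω, isTypeIIB_iff hω, isSU_dual_iff S hω, isSU_mirror_iff S hω]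
  refine and_congr_right fun _ => forall_congr' fun e => forall₂_congr fun r hr => ?_
  -- The exchange sends `ω̌` to `-ω̌`, hence scales `ω̌^(n-1)` and its derivatives by `(-1)^(n-1)`.
  refine sum_dzbar_mul_eq_zero_iff (c := (-1) ^ (n - 1))
    (pow_ne_zero _ (neg_ne_zero.2 one_ne_zero)) fun k => ?_
  have hsm : CoeffSmoothOn (fun r => semiFlatForm hω e r ^ (n - 1)) e.1.target :=
    (semiFlatForm_smooth hω e).pow _
  have h := baseDeriv_map hsm e.1.open_target hr k (exchange n).toLinearMap
  refine h.symm.trans (Eq.trans ?_ (baseDeriv_smul hsm e.1.open_target hr k _))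
  refine formDeriv_congr_of_mem e.1.open_target (fun q hq => ?_) hr
  change exchange n (semiFlatForm hω e q ^ (n - 1)) = _
  rw [map_pow, semiFlatForm, exchange_mixedForm (cmat_symm (semiFlatMat_symm hω hq)),
    ← neg_one_smul ℂ, smul_pow]

end Supersymmetry

end SemiFlat

theorem theorem1p1 (n : ℕ) (hn : 0 < n) :
    ∃ c : ℝ, c ≠ 0 ∧
      ∀ (B : Type*) [TopologicalSpace B] [ChartedSpace (Fin n → ℝ) B] (X : Type*)
        (S : SemiFlat.ActionAngle n B X) (ω' : SemiFlat.FormFamily (SemiFlat.dualParam n B)),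
        SemiFlat.IsSemiFlatRealOneOne ω' →
        -- the two `SU(n)` structures
        (SemiFlat.IsSU (SemiFlat.dualParam n B) n ω' (SemiFlat.dualVol n B) ↔
          SemiFlat.IsSU S.param n S.symp (SemiFlat.mirrorVol S ω')) ∧
        -- their conformal factors
        (SemiFlat.IsSU S.param n S.symp (SemiFlat.mirrorVol S ω') →
          (∃! F, SemiFlat.IsConformalFactor S.param n S.symp (SemiFlat.mirrorVol S ω') F) ∧
          (∃! F', SemiFlat.IsConformalFactor (SemiFlat.dualParam n B) n ω'
            (SemiFlat.dualVol n B) F') ∧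
          ∀ F F',
            SemiFlat.IsConformalFactor S.param n S.symp (SemiFlat.mirrorVol S ω') F →
            SemiFlat.IsConformalFactor (SemiFlat.dualParam n B) n ω' (SemiFlat.dualVol n B) F' →
            (∀ x y, S.proj x = y.proj → F' y = 2 ^ (2 * n) * (F x)⁻¹) ∧
            -- their fluxes
            ∀ e, ∀ p ∈ (SemiFlat.dualParam n B).dom e,
              SemiFlat.FTdual S (SemiFlat.fluxA S.param n S.symp (SemiFlat.mirrorVol S ω')
                S.fibrePol F) e p = (c : ℂ) • SemiFlat.fluxB ω' F' e p) ∧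
        -- supersymmetry
        (SemiFlat.IsTypeIIA S.param n S.symp (SemiFlat.mirrorVol S ω') Set.univ S.fibrePol ↔
          SemiFlat.IsTypeIIB (SemiFlat.dualParam n B) n ω' (SemiFlat.dualVol n B)) := by
  refine ⟨SemiFlat.fluxConst n, SemiFlat.fluxConst_ne_zero, ?_⟩
  intro B _ _ X S ω' hω
  refine ⟨(SemiFlat.isSU_dual_iff S hω).trans (SemiFlat.isSU_mirror_iff S hω).symm, fun hsu => ?_,
    SemiFlat.isTypeIIA_iff_isTypeIIB S hn hω⟩
  have hpos := (SemiFlat.isSU_mirror_iff S hω).1 hsu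
  have hF := SemiFlat.isConformalFactor_mirror_iff S hω hpos
  have hF' := SemiFlat.isConformalFactor_dual_iff S hω hpos
  -- The characterizations provide the conformal factors explicitly, as `C det μ` and `C / det μ`,
  -- together with their uniqueness.
  refine ⟨⟨_, (hF _).2 fun _ => rfl, fun G hG => funext ((hF G).1 hG)⟩,
    ⟨_, (hF' _).2 fun _ => rfl, fun G hG => funext ((hF' G).1 hG)⟩, fun F F' h h' => ⟨?_, ?_⟩⟩
  · intro x y hxy
    rw [(hF F).1 h, (hF' F').1 h', hxy]
    exact SemiFlat.conformalFactor_mirror _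
  · intro e p hp
    exact SemiFlat.FTdual_fluxA_eq_fluxB hn S hω hpos ((hF F).1 h) ((hF' F').1 h') hp
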